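/- **Setting.** For each $n$ let $p=p_n\ge 1$, and let $X$ be an $n\times p$ matrix with independent rows $X^{(r)}\sim\mathcal N_p(0,\Theta^{-1})$; write $\mathbb E_\Theta$, $\mathrm{var}_\Theta$ for expectation and variance under this law. All parameters are sequences indexed by $n$ (index suppressed), and $O$, $o$ refer to $n\to\infty$. $\Theta_j$ is the $j$-th column of $\Theta$, $\|\cdot\|_0$ counts nonzero entries, $\|\cdot\|_F$ is the Frobenius norm. Given a parameter space $S\subset\mathbb R^{p\times p}$, numbers $d_1,\dots,d_p$ and constants $C_1,C_2,C_3>0$, let $$\mathcal G=\mathcal G(d_1,\dots,d_p)=\{\Theta\in S:\ \Theta=\Theta^T \text{ positive definite},\ \|\Theta_j\|_0\le C_1d_j\ (j\le p),\ 1/\Lambda_{\min}(\Theta)\le C_2,\ \Lambda_{\max}(\Theta)\le C_3\},$$ $$B(\Theta,\varepsilon)=\{\tilde\Theta\in\mathcal G:\ \|\tilde\Theta-\Theta\|_F\le\varepsilon\}.$$ **Strong asymptotic unbiasedness.** Let $c>0$ and let $m_n>0$ satisfy $n=o(m_n)$. An estimator $T=T_n(X)$ is strongly asymptotically unbiased for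 $g(\Theta)$ at $\Theta_0$ (in a neighbourhood of size $c$) with rate $m_n$ if $\mathrm{var}_{\Theta_0}(T_n)$ is finite for large $n$ and $O(1/n)$, and for every sequence $\Theta\in B(\Theta_0,c/\sqrt{m_n})$ the expectation $\mathbb E_\Theta T_n$ exists for large $n$ and $\sqrt{m_n}\,(\mathbb E_\Theta T_n-g(\Theta))\to0$. **Estimator.** For $j\le p$ and $\lambda_j>0$ let, with $\|v\|_n^2=\|v\|_2^2/n$ and $X_{-j}$ the matrix $X$ without its $j$-th column $X_j$, $$\hat\gamma_j\in\arg\min_{\gamma\in\mathbb R^{p-1}}\|X_j-X_{-j}\gamma\|_n^2+2\lambda_j\|\gamma\|_1,\qquad \hat\tau_j^2=\|X_j-X_{-j}\hat\gamma_j\|_n^2+\lambda_j\|\hat\gamma_j\|_1,$$ (a measurable choice of minimiser), let $\hat\Theta_j$ be the vector with entry $1/\hat\tau_j^2$ at position $j$ and $-\hat\gamma_{j,k}/\hat\tau_j^2$ at positions $k\ne j$, and, with $\hat\Sigma=X^TX/n$, $$\hat T_{ij}=\hat\Theta_{ij}+\hat\Theta_{ji}-\hat\Theta_i^T\hat\Sigma\hat\Theta_j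 .$$ (For $p=1$, where $\log p=0$, take $\lambda_1=0$.) **Theorem.** For all $C_1,C_2,C_3>0$ there is $c_0>0$, depending only on $C_1,C_2,C_3$, such that the following holds. Let $c>0$, let $\Theta_0\in\mathcal G(d_1,\dots,d_p)$ and $i,j\in\{1,\dots,p\}$ (possibly $i=j$), with $\max(d_i,d_j)\log p=o(\sqrt n)$, and put $\sigma^2=\Theta^0_{ii}\Theta^0_{jj}+(\Theta^0_{ij})^2$ and $H=(\Theta^0_i(\Theta^0_j)^T+\Theta^0_j(\Theta^0_i)^T)/\sigma$. 1. If, for some constant $c_1$ and all large $n$, $c_0\sqrt{\log p/n}\le\lambda_k\le c_1\sqrt{\log p/n}$ for $k\in\{i,j\}$, then $\hat T_{ij}$ is a strongly asymptotically unbiased estimator of $\Theta_{ij}$ at $\Theta_0$ (in a neighbourhood of size $c$, with some rate), and $$\mathrm{var}_{\Theta_0}(\hat T_{ij})=\frac{\Theta^0_{ii}\Theta^0_{jj}+(\Theta^0_{ij})^2+o(1)}{n}.$$ 2. If $T$ is any strongly asymptotically unbiased estimator of $\Theta_{ij}$ at $\Theta_0$ (in a neighbourhood of size $c$) with any rate $m_n$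 such that $\Theta_0+H/\sqrt{m_n}\in B(\Theta_0,c/\sqrt{m_n})$ for all large $n$, then $$\mathrm{var}_{\Theta_0}(T)\ge\frac{\Theta^0_{ii}\Theta^0_{jj}+(\Theta^0_{ij})^2+o(1)}{n}.$$ -/

import Mathlib

open Filter Topology MeasureTheory ProbabilityTheory Asymptotics

noncomputable section

namespace GGM

/-- A data set: `n` observations (the rows of the data matrix) in `ℝ^p`. -/
abbrev Data (n p : ℕ) : Type := Fin n → EuclideanSpace ℝ (Fin p)

/-- The law of `n` independent `N_p(0, Θ⁻¹)` observations, `Θ` being the precision matrix. -/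
def dataLaw (n : ℕ) {p : ℕ} (Θ : Matrix (Fin p) (Fin p) ℝ) : Measure (Data n p) :=
  Measure.pi fun _ : Fin n => multivariateGaussian 0 Θ⁻¹

/-- The number of nonzero entries of a vector. -/
def l0 {p : ℕ} (v : Fin p → ℝ) : ℕ := {k : Fin p | v k ≠ 0}.ncard

/-- The Frobenius norm. -/
def frob {p : ℕ} (A : Matrix (Fin p) (Fin p) ℝ) : ℝ := √(∑ k, ∑ l, A k l ^ 2)

/-- The class of symmetric positive definite matrices in the parameter space `S` whose `k`-th
column has at most `C₁ d_k` nonzero entries and whose eigenvalues `μ` satisfy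
`1 / μ ≤ C₂` and `μ ≤ C₃`. -/
def precisionClass {p : ℕ} (S : Set (Matrix (Fin p) (Fin p) ℝ)) (C₁ C₂ C₃ : ℝ) (d : Fin p → ℝ) :
    Set (Matrix (Fin p) (Fin p) ℝ) :=
  {Θ | Θ ∈ S ∧ (∀ k, (l0 (Θ.col k) : ℝ) ≤ C₁ * d k) ∧
    ∃ h : Θ.PosDef, ∀ k, 1 / h.isHermitian.eigenvalues k ≤ C₂ ∧ h.isHermitian.eigenvalues k ≤ C₃}

/-- The Frobenius neighbourhood of `Θ` of radius `ε` within the class `G`. -/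
def nbhd {p : ℕ} (G : Set (Matrix (Fin p) (Fin p) ℝ)) (Θ : Matrix (Fin p) (Fin p) ℝ) (ε : ℝ) :
    Set (Matrix (Fin p) (Fin p) ℝ) :=
  {Θ' | Θ' ∈ G ∧ frob (Θ' - Θ) ≤ ε}

/-- `T` is a strongly asymptotically unbiased estimator of `g` at the sequence `Θ₀`, in a
neighbourhood of size `c` and with rate `m`. Finiteness of the moments that occur is required for
all sufficiently large `n`. -/
structure IsStronglyAsympUnbiased {p : ℕ → ℕ} (G : ∀ n, Set (Matrix (Fin (p n)) (Fin (p n)) ℝ))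
    (g : ∀ n, Matrix (Fin (p n)) (Fin (p n)) ℝ → ℝ)
    (Θ₀ : ∀ n, Matrix (Fin (p n)) (Fin (p n)) ℝ) (c : ℝ) (m : ℕ → ℝ)
    (T : ∀ n, Data n (p n) → ℝ) : Prop where
  rate_pos : ∀ᶠ n in atTop, 0 < m n
  rate : (fun n : ℕ => (n : ℝ)) =o[atTop] m
  memLp : ∀ᶠ n in atTop, MemLp (T n) 2 (dataLaw n (Θ₀ n))
  variance_bound : (fun n => variance (T n) (dataLaw n (Θ₀ n))) =O[atTop] fun n : ℕ => 1 / (n : ℝ)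
  unbiased : ∀ Θ : ∀ n, Matrix (Fin (p n)) (Fin (p n)) ℝ,
    (∀ᶠ n in atTop, Θ n ∈ nbhd (G n) (Θ₀ n) (c / √(m n))) →
      (∀ᶠ n in atTop, Integrable (T n) (dataLaw n (Θ n))) ∧
      Tendsto (fun n => √(m n) * ((∫ X, T n X ∂dataLaw n (Θ n)) - g n (Θ n))) atTop (𝓝 0)

/-- The quantity `‖X_j - X_{-j} γ‖_n² = ‖X_j - X_{-j} γ‖₂² / n`. -/
def residualSq {n p : ℕ} (X : Data n p) (j : Fin p) (γ : {k : Fin p // k ≠ j} → ℝ) : ℝ :=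
  (∑ r, (X r j - ∑ k : {k : Fin p // k ≠ j}, X r k * γ k) ^ 2) / n

/-- `γ` minimises the Lasso objective for the regression of column `j` on the other columns. -/
def IsNodewiseLasso {n p : ℕ} (X : Data n p) (j : Fin p) (lam : ℝ)
    (γ : {k : Fin p // k ≠ j} → ℝ) : Prop :=
  ∀ γ' : {k : Fin p // k ≠ j} → ℝ,
    residualSq X j γ + 2 * lam * ∑ k, |γ k| ≤ residualSq X j γ' + 2 * lam * ∑ k, |γ' k|

/-- `τ̂_j² = ‖X_j - X_{-j} γ_j‖_n² + λ_j ‖γ_j‖₁`. -/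
def tauSq {n p : ℕ} (X : Data n p) (j : Fin p) (lam : ℝ) (γ : {k : Fin p // k ≠ j} → ℝ) : ℝ :=
  residualSq X j γ + lam * ∑ k, |γ k|

/-- The nodewise estimator: its `j`-th column has entry `1 / τ̂_j²` at position `j` and
`-γ_{j,k} / τ̂_j²` at position `k ≠ j`. -/
def nodewise {n p : ℕ} (X : Data n p) (lam : Fin p → ℝ)
    (γ : ∀ j : Fin p, {k : Fin p // k ≠ j} → ℝ) : Matrix (Fin p) (Fin p) ℝ :=
  Matrix.of fun k j =>
    (if h : k = j then 1 else -γ j ⟨k, h⟩) / tauSq X j (lam j) (γ j)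

/-- The empirical covariance (Gram) matrix `Xᵀ X / n`. -/
def gram {n p : ℕ} (X : Data n p) : Matrix (Fin p) (Fin p) ℝ :=
  Matrix.of fun k l => (∑ r, X r k * X r l) / n

/-- The de-sparsified nodewise estimator; its `(i, j)` entry is
`Θ̂_ij + Θ̂_ji - Θ̂_iᵀ Σ̂ Θ̂_j` and involves only the columns `i` and `j` of `Θ̂`. -/
def desparsified {n p : ℕ} (X : Data n p) (lam : Fin p → ℝ)
    (γ : ∀ j : Fin p, {k : Fin p // k ≠ j} → ℝ) : Matrix (Fin p) (Fin p) ℝ :=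
  nodewise X lam γ + (nodewise X lam γ).transpose
    - (nodewise X lam γ).transpose * gram X * nodewise X lam γ

/-- `σ² = Θ_ii Θ_jj + Θ_ij²`. -/
def sigmaSq {p : ℕ} (Θ : Matrix (Fin p) (Fin p) ℝ) (i j : Fin p) : ℝ :=
  Θ i i * Θ j j + Θ i j ^ 2

/-- The direction `H = (Θ_i Θ_jᵀ + Θ_j Θ_iᵀ) / σ`, with `Θ_i` the `i`-th column of `Θ`. -/
def direction {p : ℕ} (Θ : Matrix (Fin p) (Fin p) ℝ) (i j : Fin p) : Matrix (Fin p) (Fin p) ℝ :=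
  (√(sigmaSq Θ i j))⁻¹ •
    (Matrix.vecMulVec (Θ.col i) (Θ.col j) + Matrix.vecMulVec (Θ.col j) (Θ.col i))

end GGM

end

/-!
# Efficiency of the de-sparsified nodewise Lasso

Write `Σ̂` for the Gram matrix and `Θ_k` for the `k`-th column of the precision matrix.

**Upper bound.** The quadratic `Z = 2 Θ_ij - Θ_iᵀ Σ̂ Θ_j` is exactly unbiased for `Θ_ij`, and its
variance is exactly `(Θ_ii Θ_jj + Θ_ij²) / n` (`linear_part_moments`). The estimator differs from it
by a remainder `R`, and everything follows once `n 𝔼 R² → 0` uniformly over the class: the bias is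
then `o(1/√n)`, the variance changes by `o(1/n)`, and a rate slightly faster than `n` can be read
off (`desparsified_isStronglyAsympUnbiased`). The second moment of `R` splits over an event on which
`Σ̂` is close to `Θ⁻¹` (`second_moment_split`). On that event the Lasso oracle inequality
(`lasso_oracle`, `nodewise_column_error`) makes `R` of order `s log p / n`. Off it there is a bound
for `R⁴` that holds for almost every data set and has polynomial expectation (`crudeBound_moment`);
it needs negative moments of the diagonal of `Σ̂`, as the noise estimates `τ̂²` are inverted. The
event fails with probability `e^{-K L}`, and `K` can be taken as large as needed to beat any
polynomial in `n` and `p` provided `log n` and `log p` are both `O(L)`. For `p⁸ > n` one takes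
`L = log p`. For `p⁸ ≤ n` one takes `L = log n`; the penalty may then be smaller than the noise, but
no sparsity is needed, because the whole vector can serve as its own support.

**Lower bound.** Let `Θ₁ = Θ₀ + t H` with `t = 1/√m` and `H` the given direction, for which
`H_ij = σ`. Unbiasedness at `Θ₀` and at `Θ₁` forces the mean of `T` to change by `t (σ + o(1))`,
while the Hammersley–Chapman–Robbins inequality (`sq_integral_sub_le`) bounds the square of this
change by `Var T` times the `χ²` distance of the two laws. That distance is explicit in terms of
determinants (`dataRatio_second_moment`), and as `H` has rank two the determinants are those of
`2 × 2` matrices (`det_add_smul_direction`). The result is a `χ²` distance of at most `e^{n t² (1 + 16 t)} - 1`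
(`sq_mean_change_le`), which is `n t² (1 + o(1))` because `n = o(m)`; dividing gives
`n Var T ≥ σ² + o(1)`.
-/

namespace GGM
open Matrix

/-! ### Precision matrices with bounded spectrum -/

/-- The quantitative consequences of an eigenvalue bound `1 / C₂ ≤ μ ≤ C₃` for a precision matrix,
phrased through quadratic forms of `Θ⁻¹` and through the columns of `Θ`. -/
structure IsRegular {p : ℕ} (C₂ C₃ : ℝ) (Θ : Matrix (Fin p) (Fin p) ℝ) : Prop where
  posDef : Θ.PosDef
  lower : ∀ v : Fin p → ℝ, v ⬝ᵥ v ≤ C₃ * (v ⬝ᵥ Θ⁻¹ *ᵥ v)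
  upper : ∀ v : Fin p → ℝ, v ⬝ᵥ Θ⁻¹ *ᵥ v ≤ C₂ * (v ⬝ᵥ v)
  col_sq : ∀ k, Θ.col k ⬝ᵥ Θ.col k ≤ C₃ ^ 2
  diag_lower : ∀ k, 1 ≤ C₂ * Θ k k
  diag_upper : ∀ k, Θ k k ≤ C₃

/-- Expansion of `v` in an orthonormal basis of eigenvectors. -/
theorem exists_eigenvector_expansion {p : ℕ} {Θ : Matrix (Fin p) (Fin p) ℝ} (h : Θ.IsHermitian)
    (v : Fin p → ℝ) :
    ∃ y : Fin p → ℝ, v ⬝ᵥ v = ∑ k, y k ^ 2 ∧ v ⬝ᵥ Θ *ᵥ v = ∑ k, h.eigenvalues k * y k ^ 2 ∧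
      (Θ *ᵥ v) ⬝ᵥ (Θ *ᵥ v) = ∑ k, h.eigenvalues k ^ 2 * y k ^ 2 := by
  have key : ∀ k, inner ℝ (h.eigenvectorBasis k) (WithLp.toLp 2 (Θ *ᵥ v)) =
      h.eigenvalues k * inner ℝ (h.eigenvectorBasis k) (WithLp.toLp 2 v) := by
    intro k
    have e := h.mulVec_eigenvectorBasis k
    have hs : Θᵀ = Θ := by simpa [Matrix.IsHermitian, conjTranspose_eq_transpose_of_trivial] using h
    rw [EuclideanSpace.inner_eq_star_dotProduct, EuclideanSpace.inner_eq_star_dotProduct]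
    simp only [star_trivial]
    rw [dotProduct_comm, dotProduct_mulVec, ← mulVec_transpose, hs, e, smul_dotProduct,
      dotProduct_comm, smul_eq_mul]
  have expand : ∀ x y : Fin p → ℝ, x ⬝ᵥ y =
      ∑ k, inner ℝ (h.eigenvectorBasis k) (WithLp.toLp 2 x) *
        inner ℝ (h.eigenvectorBasis k) (WithLp.toLp 2 y) := by
    intro x y
    have := h.eigenvectorBasis.sum_inner_mul_inner (WithLp.toLp 2 x) (WithLp.toLp 2 y)
    rw [EuclideanSpace.inner_eq_star_dotProduct] at this
    simp only [star_trivial] at this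
    rw [dotProduct_comm, ← this]
    refine Finset.sum_congr rfl fun k _ => ?_
    rw [real_inner_comm (h.eigenvectorBasis k)]
  refine ⟨fun k => inner ℝ (h.eigenvectorBasis k) (WithLp.toLp 2 v), ?_, ?_, ?_⟩
  · rw [expand]; exact Finset.sum_congr rfl fun k _ => by ring
  · rw [expand]; exact Finset.sum_congr rfl fun k _ => by rw [key]; ring
  · rw [expand]; exact Finset.sum_congr rfl fun k _ => by rw [key]; ring

theorem isRegular_of_mem {p : ℕ} {S : Set (Matrix (Fin p) (Fin p) ℝ)} {C₁ C₂ C₃ : ℝ}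
    {d : Fin p → ℝ} {Θ : Matrix (Fin p) (Fin p) ℝ}
    (hΘ : Θ ∈ precisionClass S C₁ C₂ C₃ d) : IsRegular C₂ C₃ Θ := by
  obtain ⟨-, -, h, hev⟩ := hΘ
  have hpos := fun k => h.eigenvalues_pos k
  have hlow : ∀ k, 1 ≤ C₂ * h.isHermitian.eigenvalues k := fun k => by
    have := (hev k).1
    rwa [div_le_iff₀ (hpos k)] at this
  have f1 : ∀ w : Fin p → ℝ, (Θ *ᵥ w) ⬝ᵥ (Θ *ᵥ w) ≤ C₃ * (w ⬝ᵥ Θ *ᵥ w) := by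
    intro w
    obtain ⟨y, -, h2, h3⟩ := exists_eigenvector_expansion h.isHermitian w
    rw [h2, h3, Finset.mul_sum]
    refine Finset.sum_le_sum fun k _ => ?_
    have := mul_le_mul_of_nonneg_right (hev k).2 (mul_nonneg (hpos k).le (sq_nonneg (y k)))
    nlinarith
  have f2 : ∀ w : Fin p → ℝ, w ⬝ᵥ Θ *ᵥ w ≤ C₂ * ((Θ *ᵥ w) ⬝ᵥ (Θ *ᵥ w)) := by
    intro w
    obtain ⟨y, -, h2, h3⟩ := exists_eigenvector_expansion h.isHermitian w
    rw [h2, h3, Finset.mul_sum]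
    refine Finset.sum_le_sum fun k _ => ?_
    have := mul_le_mul_of_nonneg_right (hlow k) (mul_nonneg (hpos k).le (sq_nonneg (y k)))
    nlinarith
  have f3 : ∀ w : Fin p → ℝ, w ⬝ᵥ w ≤ C₂ * (w ⬝ᵥ Θ *ᵥ w) := by
    intro w
    obtain ⟨y, h1, h2, -⟩ := exists_eigenvector_expansion h.isHermitian w
    rw [h1, h2, Finset.mul_sum]
    refine Finset.sum_le_sum fun k _ => ?_
    have := mul_le_mul_of_nonneg_right (hlow k) (sq_nonneg (y k))
    nlinarith
  have hdet : IsUnit Θ.det := h.det_pos.ne'.isUnit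
  have hinv : ∀ v : Fin p → ℝ, Θ *ᵥ (Θ⁻¹ *ᵥ v) = v := fun v => by
    rw [mulVec_mulVec, Matrix.mul_nonsing_inv _ hdet, one_mulVec]
  have hcol : ∀ k, Θ *ᵥ Pi.single k 1 = Θ.col k := fun k => by simp
  have hdiag : ∀ k, (Pi.single k 1 : Fin p → ℝ) ⬝ᵥ Θ *ᵥ Pi.single k 1 = Θ k k := fun k => by simp
  have hdu : ∀ k, Θ k k ≤ C₃ := by
    intro k
    have h1 := f1 (Pi.single k 1)
    rw [hcol] at h1
    rw [← hcol k, hdiag, hcol] at h1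
    have h2 : Θ k k ^ 2 ≤ Θ.col k ⬝ᵥ Θ.col k := by
      have := Finset.single_le_sum (f := fun l => Θ.col k l * Θ.col k l)
        (fun l _ => mul_self_nonneg _) (Finset.mem_univ k)
      simpa [dotProduct, sq] using this
    have := h.diag_pos (i := k)
    nlinarith
  refine ⟨h, fun v => ?_, fun v => ?_, fun k => ?_, fun k => ?_, hdu⟩
  · have := f1 (Θ⁻¹ *ᵥ v)
    rwa [hinv, dotProduct_comm (Θ⁻¹ *ᵥ v)] at this
  · have := f2 (Θ⁻¹ *ᵥ v)
    rwa [hinv, dotProduct_comm (Θ⁻¹ *ᵥ v)] at this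
  · have h1 := f1 (Pi.single k 1)
    rw [hdiag, hcol] at h1
    have := hdu k
    have := h.diag_pos (i := k)
    nlinarith
  · have h1 := f3 (Pi.single k 1)
    rw [hdiag] at h1
    simpa using h1

/-! ### Deterministic analysis of the nodewise Lasso -/

theorem abs_quadratic_le {p : ℕ} (W : Matrix (Fin p) (Fin p) ℝ) {μ : ℝ} (h : ∀ k l, |W k l| ≤ μ)
    (v : Fin p → ℝ) : |v ⬝ᵥ W *ᵥ v| ≤ μ * (∑ k, |v k|) ^ 2 := by
  have : v ⬝ᵥ W *ᵥ v = ∑ k, ∑ l, v k * (W k l * v l) := by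
    simp [dotProduct, mulVec, Finset.mul_sum]
  rw [this, sq, Finset.sum_mul_sum, Finset.mul_sum]
  refine (Finset.abs_sum_le_sum_abs _ _).trans (Finset.sum_le_sum fun k _ => ?_)
  rw [Finset.mul_sum]
  refine (Finset.abs_sum_le_sum_abs _ _).trans (Finset.sum_le_sum fun l _ => ?_)
  rw [abs_mul, abs_mul]
  have := mul_le_mul_of_nonneg_right (h k l) (mul_nonneg (abs_nonneg (v k)) (abs_nonneg (v l)))
  nlinarith

theorem abs_dotProduct_le {p : ℕ} {v w : Fin p → ℝ} {ν : ℝ} (h : ∀ k, |w k| ≤ ν) :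
    |v ⬝ᵥ w| ≤ ν * ∑ k, |v k| := by
  rw [dotProduct, Finset.mul_sum]
  refine (Finset.abs_sum_le_sum_abs _ _).trans (Finset.sum_le_sum fun k _ => ?_)
  rw [abs_mul, mul_comm]
  exact mul_le_mul_of_nonneg_right (h k) (abs_nonneg _)

theorem sum_abs_sq_le {p : ℕ} (S : Finset (Fin p)) (v : Fin p → ℝ) :
    (∑ k ∈ S, |v k|) ^ 2 ≤ S.card * (v ⬝ᵥ v) := by
  refine sq_sum_le_card_mul_sum_sq.trans (mul_le_mul_of_nonneg_left ?_ (Nat.cast_nonneg _))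
  simp only [sq_abs, dotProduct, ← sq]
  exact Finset.sum_le_sum_of_subset_of_nonneg (Finset.subset_univ _) fun _ _ _ => sq_nonneg _

theorem quadratic_add {p : ℕ} {G : Matrix (Fin p) (Fin p) ℝ} (hG : Gᵀ = G) (v w : Fin p → ℝ) :
    (v + w) ⬝ᵥ G *ᵥ (v + w) = v ⬝ᵥ G *ᵥ v + 2 * (w ⬝ᵥ G *ᵥ v) + w ⬝ᵥ G *ᵥ w := by
  have : v ⬝ᵥ G *ᵥ w = w ⬝ᵥ G *ᵥ v := by
    rw [dotProduct_mulVec, ← mulVec_transpose, hG, dotProduct_comm]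
  rw [mulVec_add, dotProduct_add, add_dotProduct, add_dotProduct, this]; ring

/-- The final step of the oracle inequality. Here `a` and `b` stand for the `ℓ₁` norms of the error
on and off the support, `D` for its squared Euclidean norm and `Q` for the squared prediction
error. -/
theorem cone_arithmetic {a b D Q s κ μ Λ : ℝ} (hκ : 0 < κ) (ha : 0 ≤ a) (hb : 0 ≤ b) (hD : 0 ≤ D)
    (hμ0 : 0 ≤ μ) (hΛ : 0 ≤ Λ) (hs : 0 ≤ s) (hba : b ≤ 3 * a) (hQ : Q ≤ 4 * Λ * a)
    (hquad : κ * D - μ * (a + b) ^ 2 ≤ Q) (ha2 : a ^ 2 ≤ s * D) (hμ : 32 * s * μ ≤ κ) :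
    κ * (a + b) ≤ 32 * Λ * s ∧ κ * Q ≤ 32 * Λ ^ 2 * s := by
  have h1 : (a + b) ^ 2 ≤ 16 * (s * D) := by
    have : (a + b) ^ 2 ≤ (4 * a) ^ 2 := pow_le_pow_left₀ (by linarith) (by linarith) 2
    linarith
  have h2 : μ * (a + b) ^ 2 ≤ κ / 2 * D := by
    have e1 := mul_le_mul_of_nonneg_left h1 hμ0
    have e2 := mul_le_mul_of_nonneg_right hμ hD
    linarith
  have h3 : κ * D ≤ 8 * Λ * a := by linarith
  have h4 : κ * a ≤ 8 * Λ * s := by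
    rcases ha.eq_or_lt with h0 | h0
    · rw [← h0]; have : 0 ≤ 8 * Λ * s := by positivity
      linarith
    · have e1 := mul_le_mul_of_nonneg_left ha2 hκ.le
      have e2 := mul_le_mul_of_nonneg_left h3 hs
      refine le_of_mul_le_mul_right ?_ h0
      linarith
  have h5 : κ * Q ≤ κ * (4 * Λ * a) := mul_le_mul_of_nonneg_left hQ hκ.le
  have h6 := mul_le_mul_of_nonneg_left h4 (by positivity : 0 ≤ 4 * Λ)
  have h7 := mul_le_mul_of_nonneg_left hba hκ.le
  constructor <;> linarith

/-- The oracle inequality for the nodewise Lasso, in terms of the normalised coefficient vectors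
`θ₀` and `θ` (whose `j`-th entries agree). The support set `S` either satisfies the usual noise
condition, which puts the error into a cone, or is everything, in which case the cone condition is
void and the noise level may exceed the penalty. -/
theorem lasso_oracle {p : ℕ} {G V : Matrix (Fin p) (Fin p) ℝ} (hG : Gᵀ = G)
    (hG0 : ∀ v : Fin p → ℝ, 0 ≤ v ⬝ᵥ G *ᵥ v) {θ₀ θ : Fin p → ℝ}
    {j : Fin p} {S : Finset (Fin p)} {s κ μ ν lam Λ τ : ℝ} (hκ : 0 < κ)
    (hV : ∀ v : Fin p → ℝ, κ * (v ⬝ᵥ v) ≤ v ⬝ᵥ V *ᵥ v) (hW : ∀ k l, |(G - V) k l| ≤ μ)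
    (hν : ∀ k, |((G - V) *ᵥ θ₀) k| ≤ ν) (hθ₀ : V *ᵥ θ₀ = Pi.single j τ) (hj : θ j = θ₀ j)
    (hmin : θ ⬝ᵥ G *ᵥ θ + 2 * lam * ∑ k ∈ Finset.univ.erase j, |θ k| ≤
      θ₀ ⬝ᵥ G *ᵥ θ₀ + 2 * lam * ∑ k ∈ Finset.univ.erase j, |θ₀ k|)
    (hS : ∀ k, k ∉ S → θ₀ k = 0) (hs : (S.card : ℝ) ≤ s)
    (hcone : S = Finset.univ ∨ 2 * ν ≤ lam ∧ 0 < lam) (hlam : 0 ≤ lam) (hΛ : lam ≤ Λ)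
    (hνΛ : ν ≤ Λ) (hμ : 32 * s * μ ≤ κ) :
    κ * ∑ k, |(θ - θ₀) k| ≤ 32 * Λ * s ∧ κ * ((θ - θ₀) ⬝ᵥ G *ᵥ (θ - θ₀)) ≤ 32 * Λ ^ 2 * s ∧
      |(θ - θ₀) ⬝ᵥ G *ᵥ θ₀| ≤ ν * ∑ k, |(θ - θ₀) k| := by
  set δ := θ - θ₀ with hδ
  have hθ : θ = θ₀ + δ := by simp [hδ]
  have hδj : δ j = 0 := by simp [hδ, hj]
  have hμ0 : 0 ≤ μ := (abs_nonneg _).trans (hW j j)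
  have hν0 : 0 ≤ ν := (abs_nonneg _).trans (hν j)
  have hs0 : 0 ≤ s := (Nat.cast_nonneg _).trans hs
  have hcross : |δ ⬝ᵥ G *ᵥ θ₀| ≤ ν * ∑ k, |δ k| := by
    have : δ ⬝ᵥ G *ᵥ θ₀ = δ ⬝ᵥ (G - V) *ᵥ θ₀ := by
      rw [sub_mulVec, dotProduct_sub, hθ₀]; simp [hδj]
    rw [this]; exact abs_dotProduct_le hν
  have hA : (∑ k, |δ k|) = ∑ k ∈ S, |δ k| + ∑ k ∈ Sᶜ, |δ k| :=
    (Finset.sum_add_sum_compl S _).symm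
  set a := ∑ k ∈ S, |δ k| with ha
  set b := ∑ k ∈ Sᶜ, |δ k| with hb
  have ha0 : 0 ≤ a := Finset.sum_nonneg fun _ _ => abs_nonneg _
  have hb0 : 0 ≤ b := Finset.sum_nonneg fun _ _ => abs_nonneg _
  have hpen : (∑ k ∈ Finset.univ.erase j, |θ₀ k|) - (∑ k ∈ Finset.univ.erase j, |θ k|) ≤ a - b := by
    have e1 : ∀ f : Fin p → ℝ, ∑ k ∈ Finset.univ.erase j, f k = (∑ k, f k) - f j := fun f => by
      rw [← Finset.sum_erase_add _ _ (Finset.mem_univ j)]; ring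
    rw [e1, e1, hj]
    have e2 : (∑ k, |θ₀ k|) - ∑ k, |θ k| =
        ∑ k ∈ S, (|θ₀ k| - |θ k|) + ∑ k ∈ Sᶜ, (|θ₀ k| - |θ k|) := by
      rw [Finset.sum_add_sum_compl, Finset.sum_sub_distrib]
    have e3 : ∑ k ∈ S, (|θ₀ k| - |θ k|) ≤ a := Finset.sum_le_sum fun k _ => by
      have := abs_sub_abs_le_abs_sub (θ₀ k) (θ k)
      rwa [abs_sub_comm] at this
    have e4 : ∑ k ∈ Sᶜ, (|θ₀ k| - |θ k|) = -b := by
      rw [hb, ← Finset.sum_neg_distrib]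
      refine Finset.sum_congr rfl fun k hk => ?_
      have := hS k (by simpa using hk)
      simp [hδ, this]
    linarith
  rw [hθ, quadratic_add hG, ← hθ] at hmin
  have hbasic : δ ⬝ᵥ G *ᵥ δ ≤ 2 * ν * (a + b) + 2 * lam * (a - b) := by
    have h1 := (abs_le.1 hcross).1
    rw [hA] at h1
    have h2 := mul_le_mul_of_nonneg_left hpen (by positivity : (0:ℝ) ≤ 2 * lam)
    linarith
  have hquad : κ * (δ ⬝ᵥ δ) - μ * (a + b) ^ 2 ≤ δ ⬝ᵥ G *ᵥ δ := by
    have h1 := (abs_le.1 (abs_quadratic_le (G - V) hW δ)).1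
    rw [sub_mulVec, dotProduct_sub, hA] at h1
    linarith [hV δ]
  have ha2 : a ^ 2 ≤ s * (δ ⬝ᵥ δ) :=
    (sum_abs_sq_le S δ).trans (mul_le_mul_of_nonneg_right hs
      (Finset.sum_nonneg fun _ _ => mul_self_nonneg _))
  set D := δ ⬝ᵥ δ with hD
  have hD0 : 0 ≤ D := Finset.sum_nonneg fun _ _ => mul_self_nonneg _
  set Q := δ ⬝ᵥ G *ᵥ δ with hQ
  -- the two sources of the cone condition lead to the same pair of bounds
  have hab : b ≤ 3 * a ∧ Q ≤ 4 * Λ * a := by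
    rcases hcone with hc | ⟨hc, hl⟩
    · have : b = 0 := by simp [hb, hc]
      rw [this] at hbasic ⊢
      refine ⟨by linarith, ?_⟩
      nlinarith
    · have hQ0 : 0 ≤ Q := hG0 δ
      have hneg : Q ≤ 3 * lam * a - lam * b := by nlinarith
      have h3 : lam * b ≤ lam * (3 * a) := by linarith
      refine ⟨le_of_mul_le_mul_left h3 hl, ?_⟩
      nlinarith [mul_nonneg hlam hb0, mul_le_mul_of_nonneg_right hΛ ha0, mul_nonneg hlam ha0]
  rw [hA]
  obtain ⟨h1, h2⟩ := cone_arithmetic hκ ha0 hb0 hD0 hμ0 (hlam.trans hΛ) hs0 hab.1 hab.2 hquad ha2 hμ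
  refine ⟨h1, h2, ?_⟩
  rwa [hA] at hcross

theorem quadratic_add_le {p : ℕ} {G : Matrix (Fin p) (Fin p) ℝ} (hG : Gᵀ = G)
    (hG0 : ∀ v : Fin p → ℝ, 0 ≤ v ⬝ᵥ G *ᵥ v) (v w : Fin p → ℝ) :
    (v + w) ⬝ᵥ G *ᵥ (v + w) ≤ 2 * (v ⬝ᵥ G *ᵥ v) + 2 * (w ⬝ᵥ G *ᵥ w) := by
  have h1 := quadratic_add hG v w
  have h2 := quadratic_add hG v (-w)
  have h3 := hG0 (v + -w)
  simp only [mulVec_neg, neg_dotProduct, dotProduct_neg, neg_neg] at h2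
  linarith

theorem quadratic_smul {p : ℕ} (G : Matrix (Fin p) (Fin p) ℝ) (c : ℝ) (v : Fin p → ℝ) :
    (c • v) ⬝ᵥ G *ᵥ (c • v) = c ^ 2 * (v ⬝ᵥ G *ᵥ v) := by
  rw [mulVec_smul, smul_dotProduct, dotProduct_smul]; simp only [smul_eq_mul]; ring

/-- From the error of the normalised Lasso coefficients `θ` to the error of the column estimator
`θ / t`, where `t` estimates the noise variance `1 / Θ_jj`. -/
theorem column_error {p : ℕ} {C₂ C₃ : ℝ} (hC₂ : 0 < C₂) (hC₃ : 0 < C₃)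
    {Θ G : Matrix (Fin p) (Fin p) ℝ} (hΘ : IsRegular C₂ C₃ Θ) (hG : Gᵀ = G)
    (hG0 : ∀ v : Fin p → ℝ, 0 ≤ v ⬝ᵥ G *ᵥ v) {j : Fin p} {θ θ₀ : Fin p → ℝ}
    (hθ₀ : θ₀ = (Θ j j)⁻¹ • Θ.col j) {s Λ t lam : ℝ} (hs : 1 ≤ s) (hlam : 0 ≤ lam) (hΛ : lam ≤ Λ)
    (hnorm : (∑ k, |θ₀ k|) ^ 2 ≤ s * (C₂ * C₃) ^ 2)
    (hν : ∀ k, |((G - Θ⁻¹) *ᵥ θ₀) k| ≤ Λ)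
    (h1 : ∑ k, |(θ - θ₀) k| ≤ 32 * C₃ * Λ * s)
    (h2 : (θ - θ₀) ⬝ᵥ G *ᵥ (θ - θ₀) ≤ 32 * C₃ * Λ ^ 2 * s)
    (h3 : |(θ - θ₀) ⬝ᵥ G *ᵥ θ₀| ≤ Λ * ∑ k, |(θ - θ₀) k|)
    (ht : t = θ ⬝ᵥ G *ᵥ θ + lam * ∑ k ∈ Finset.univ.erase j, |θ k|)
    (hε1 : Λ * s ≤ 1) (hε2 : 2 * C₃ * (2 * (C₂ * C₃) + 128 * C₃) * (Λ * s) ≤ 1) :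
    ∑ k, |t⁻¹ * θ k - Θ k j| ≤
        (64 * C₃ ^ 2 + 2 * C₂ * C₃ ^ 3 * (2 * (C₂ * C₃) + 128 * C₃)) * Λ * s ∧
      (t⁻¹ • θ - Θ.col j) ⬝ᵥ G *ᵥ (t⁻¹ • θ - Θ.col j) ≤
        2 * (128 * C₃ ^ 3 + 4 * C₃ ^ 4 * (C₂ + C₂ * C₃) * (2 * (C₂ * C₃) + 128 * C₃) ^ 2) *
          Λ ^ 2 * s := by
  set K₂ := 2 * (C₂ * C₃) + 128 * C₃ with hK₂
  have hK₂0 : 0 < K₂ := by positivity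
  have hΛ0 : 0 ≤ Λ := hlam.trans hΛ
  set δ := θ - θ₀ with hδ
  have hθ : θ = θ₀ + δ := by simp [hδ]
  have hjj : 0 < Θ j j := hΘ.posDef.diag_pos
  set q := √s with hq
  have hq1 : 1 ≤ q := Real.one_le_sqrt.2 hs
  have hqs : q ^ 2 = s := Real.sq_sqrt (by linarith)
  have hqs' : q ≤ s := by nlinarith
  have hΛq : Λ * q ≤ 1 := (mul_le_mul_of_nonneg_left hqs' hΛ0).trans hε1
  set N := ∑ k, |θ₀ k| with hN
  have hN0 : 0 ≤ N := Finset.sum_nonneg fun _ _ => abs_nonneg _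
  have hNle : N ≤ q * (C₂ * C₃) := by
    refine le_of_sq_le_sq ?_ (by positivity)
    rw [mul_pow, hqs]; exact hnorm
  set τ := (Θ j j)⁻¹ with hτ
  have hτ0 : 0 < τ := inv_pos.2 hjj
  have hτl : 1 ≤ C₃ * τ := by
    rw [hτ, ← div_eq_mul_inv, one_le_div hjj]; exact hΘ.diag_upper j
  have hτu : τ ≤ C₂ := by
    rw [hτ, inv_le_iff_one_le_mul₀ hjj]; exact hΘ.diag_lower j
  have hθj : θ₀ j = 1 := by simp [hθ₀, hτ, hjj.ne']
  have hVθ : Θ⁻¹ *ᵥ θ₀ = Pi.single j τ := by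
    have : Θ⁻¹ *ᵥ Θ.col j = Pi.single j 1 := by
      have e : Θ *ᵥ Pi.single j 1 = Θ.col j := by simp
      rw [← e, mulVec_mulVec, Matrix.nonsing_inv_mul _ hΘ.posDef.det_pos.ne'.isUnit, one_mulVec]
    rw [hθ₀, mulVec_smul, this, ← Pi.single_smul]; simp
  have hG₀ : |θ₀ ⬝ᵥ G *ᵥ θ₀ - τ| ≤ Λ * N := by
    have : θ₀ ⬝ᵥ G *ᵥ θ₀ - τ = θ₀ ⬝ᵥ (G - Θ⁻¹) *ᵥ θ₀ := by
      rw [sub_mulVec, dotProduct_sub, hVθ]; simp [hθj]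
    rw [this]; exact abs_dotProduct_le hν
  set D := ∑ k, |δ k| with hD
  have hD0 : 0 ≤ D := Finset.sum_nonneg fun _ _ => abs_nonneg _
  have hP0 : 0 ≤ ∑ k ∈ Finset.univ.erase j, |θ k| := Finset.sum_nonneg fun _ _ => abs_nonneg _
  have hP : ∑ k ∈ Finset.univ.erase j, |θ k| ≤ N + D := by
    refine (Finset.sum_le_sum_of_subset_of_nonneg (Finset.subset_univ _)
      fun _ _ _ => abs_nonneg _).trans ?_
    rw [hN, hD, ← Finset.sum_add_distrib]
    refine Finset.sum_le_sum fun k _ => ?_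
    rw [hθ]; exact abs_add_le _ _
  set P := ∑ k ∈ Finset.univ.erase j, |θ k| with hPdef
  have hlP : lam * P ≤ Λ * (N + D) := mul_le_mul hΛ hP hP0 hΛ0
  have hlP0 : 0 ≤ lam * P := mul_nonneg hlam hP0
  set Q := δ ⬝ᵥ G *ᵥ δ with hQ
  have hQ0 : 0 ≤ Q := hG0 δ
  have htt : t = θ₀ ⬝ᵥ G *ᵥ θ₀ + 2 * (δ ⬝ᵥ G *ᵥ θ₀) + Q + lam * P := by
    rw [ht, hPdef, hQ, ← quadratic_add hG, ← hθ]
  have hΛN : Λ * N ≤ C₂ * C₃ * (Λ * q) := by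
    have := mul_le_mul_of_nonneg_left hNle hΛ0
    linarith
  have hΛD : Λ * D ≤ 32 * C₃ * (Λ * q) := by
    have e1 := mul_le_mul_of_nonneg_left h1 hΛ0
    have e2 : Λ * (32 * C₃ * Λ * s) = 32 * C₃ * (Λ * q) * (Λ * q) := by rw [← hqs]; ring
    have e3 : 32 * C₃ * (Λ * q) * (Λ * q) ≤ 32 * C₃ * (Λ * q) * 1 :=
      mul_le_mul_of_nonneg_left hΛq (by positivity)
    linarith
  have hQq : Q ≤ 32 * C₃ * (Λ * q) := by
    have e2 : 32 * C₃ * Λ ^ 2 * s = 32 * C₃ * (Λ * q) * (Λ * q) := by rw [← hqs]; ring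
    have e3 : 32 * C₃ * (Λ * q) * (Λ * q) ≤ 32 * C₃ * (Λ * q) * 1 :=
      mul_le_mul_of_nonneg_left hΛq (by positivity)
    linarith
  have htτ : |t - τ| ≤ K₂ * (Λ * q) := by
    rw [abs_le] at hG₀ h3 ⊢
    have p1 : 0 ≤ C₂ * C₃ * (Λ * q) := by positivity
    have p2 : 0 ≤ C₃ * (Λ * q) := by positivity
    constructor <;> rw [htt, hK₂] <;> linarith
  have hsmall : 2 * C₃ * (K₂ * (Λ * q)) ≤ 1 := by
    have : 2 * C₃ * K₂ * (Λ * q) ≤ 2 * C₃ * K₂ * (Λ * s) :=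
      mul_le_mul_of_nonneg_left (mul_le_mul_of_nonneg_left hqs' hΛ0) (by positivity)
    linarith
  have htl : 1 ≤ 2 * C₃ * t := by
    have e1 := (abs_le.1 htτ).1
    have e2 := mul_le_mul_of_nonneg_left e1 (by positivity : 0 ≤ 2 * C₃)
    linarith
  have ht0 : 0 < t := by
    by_contra! hc
    have := mul_nonneg (by positivity : 0 ≤ 2 * C₃) (neg_nonneg.2 hc)
    linarith
  have hti : t⁻¹ ≤ 2 * C₃ := by rw [inv_le_iff_one_le_mul₀ ht0]; exact htl
  have hti0 : 0 < t⁻¹ := inv_pos.2 ht0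
  have hτi : τ⁻¹ ≤ C₃ := by rw [inv_le_iff_one_le_mul₀ hτ0]; exact hτl
  set r := t⁻¹ - τ⁻¹ with hr
  have hrabs : |r| ≤ 2 * C₃ ^ 2 * (K₂ * (Λ * q)) := by
    have : r = -(t - τ) * (t⁻¹ * τ⁻¹) := by rw [hr]; field_simp; ring
    rw [this, abs_mul, abs_neg, abs_of_pos (mul_pos hti0 (inv_pos.2 hτ0))]
    have e1 : t⁻¹ * τ⁻¹ ≤ 2 * C₃ * C₃ := mul_le_mul hti hτi (inv_pos.2 hτ0).le (by positivity)
    calc |t - τ| * (t⁻¹ * τ⁻¹) ≤ K₂ * (Λ * q) * (2 * C₃ * C₃) :=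
          mul_le_mul htτ e1 (mul_pos hti0 (inv_pos.2 hτ0)).le (by positivity)
      _ = _ := by ring
  have hcol : Θ.col j = τ⁻¹ • θ₀ := by
    rw [hθ₀, smul_smul, hτ, inv_inv, mul_inv_cancel₀ hjj.ne', one_smul]
  have herr : t⁻¹ • θ - Θ.col j = t⁻¹ • δ + r • θ₀ := by
    rw [hcol, hθ, hr, smul_add, sub_smul]; abel
  constructor
  · have e : ∀ k, t⁻¹ * θ k - Θ k j = t⁻¹ * δ k + r * θ₀ k := fun k => by
      have := congrFun herr k
      simpa using this
    calc ∑ k, |t⁻¹ * θ k - Θ k j| ≤ ∑ k, (t⁻¹ * |δ k| + |r| * |θ₀ k|) := by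
          refine Finset.sum_le_sum fun k _ => ?_
          rw [e]
          refine (abs_add_le _ _).trans ?_
          rw [abs_mul, abs_mul, abs_of_pos hti0]
      _ = t⁻¹ * D + |r| * N := by rw [Finset.sum_add_distrib, ← Finset.mul_sum, ← Finset.mul_sum]
      _ ≤ 2 * C₃ * (32 * C₃ * Λ * s) + 2 * C₃ ^ 2 * (K₂ * (Λ * q)) * (q * (C₂ * C₃)) :=
          add_le_add (mul_le_mul hti h1 hD0 (by positivity))
            (mul_le_mul hrabs hNle hN0 (by positivity))
      _ = _ := by rw [← hqs]; ring
  · rw [herr]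
    refine (quadratic_add_le hG hG0 _ _).trans ?_
    rw [quadratic_smul, quadratic_smul]
    have e1 : (t⁻¹) ^ 2 ≤ (2 * C₃) ^ 2 := pow_le_pow_left₀ hti0.le hti 2
    have e2 : r ^ 2 ≤ (2 * C₃ ^ 2 * (K₂ * (Λ * q))) ^ 2 := by
      rw [← sq_abs]; exact pow_le_pow_left₀ (abs_nonneg _) hrabs 2
    have e3 : θ₀ ⬝ᵥ G *ᵥ θ₀ ≤ C₂ + C₂ * C₃ := by
      have f1 := (abs_le.1 hG₀).2
      have f2 : C₂ * C₃ * (Λ * q) ≤ C₂ * C₃ * 1 := mul_le_mul_of_nonneg_left hΛq (by positivity)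
      linarith
    have e4 := mul_le_mul e1 h2 hQ0 (by positivity)
    have e5 := mul_le_mul e2 e3 (hG0 _) (by positivity)
    calc _ ≤ 2 * ((2 * C₃) ^ 2 * (32 * C₃ * Λ ^ 2 * s)) +
          2 * ((2 * C₃ ^ 2 * (K₂ * (Λ * q))) ^ 2 * (C₂ + C₂ * C₃)) := by linarith
      _ = _ := by rw [← hqs]; ring

/-- On the event where the Gram matrix is close to `Θ⁻¹` (entrywise, and in the direction of the
column `Θ_j`), the nodewise estimator of the column `Θ_j` has error of order `Λ s` in `ℓ₁` and
`Λ² s` in squared prediction error. -/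
theorem nodewise_column_error {C₂ C₃ : ℝ} (hC₂ : 0 < C₂) (hC₃ : 0 < C₃) :
    ∃ K ε : ℝ, 0 < K ∧ 0 < ε ∧ ∀ (p : ℕ) (Θ G : Matrix (Fin p) (Fin p) ℝ) (j : Fin p)
      (θ : Fin p → ℝ) (S : Finset (Fin p)) (s μ lam Λ t : ℝ),
      IsRegular C₂ C₃ Θ → Gᵀ = G → (∀ v : Fin p → ℝ, 0 ≤ v ⬝ᵥ G *ᵥ v) → θ j = 1 →
      (θ ⬝ᵥ G *ᵥ θ + 2 * lam * ∑ k ∈ Finset.univ.erase j, |θ k| ≤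
        ((Θ j j)⁻¹ • Θ.col j) ⬝ᵥ G *ᵥ ((Θ j j)⁻¹ • Θ.col j) +
          2 * lam * ∑ k ∈ Finset.univ.erase j, |((Θ j j)⁻¹ • Θ.col j) k|) →
      t = θ ⬝ᵥ G *ᵥ θ + lam * ∑ k ∈ Finset.univ.erase j, |θ k| →
      (∀ k, k ∉ S → Θ k j = 0) → (S.card : ℝ) ≤ s →
      (S = Finset.univ ∨ 2 * (C₂ * μ) ≤ lam ∧ 0 < lam) → 0 ≤ lam → lam ≤ Λ →
      C₂ * μ ≤ Λ → μ ≤ Λ → (∀ k l, |(G - Θ⁻¹) k l| ≤ μ) →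
      (∀ k, |((G - Θ⁻¹) *ᵥ Θ.col j) k| ≤ μ) → Λ * s ≤ ε →
      ∑ k, |t⁻¹ * θ k - Θ k j| ≤ K * Λ * s ∧
      (t⁻¹ • θ - Θ.col j) ⬝ᵥ G *ᵥ (t⁻¹ • θ - Θ.col j) ≤ K * Λ ^ 2 * s := by
  set K₂ := 2 * (C₂ * C₃) + 128 * C₃ with hK₂
  have hK₂0 : 0 < K₂ := by positivity
  set A := 64 * C₃ ^ 2 + 2 * C₂ * C₃ ^ 3 * K₂ with hA
  set B := 2 * (128 * C₃ ^ 3 + 4 * C₃ ^ 4 * (C₂ + C₂ * C₃) * K₂ ^ 2) with hB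
  have hA0 : 0 < A := by positivity
  have hB0 : 0 < B := by positivity
  refine ⟨A + B, min (min 1 (1 / (2 * C₃ * K₂))) (1 / (32 * C₃)), by positivity, by positivity, ?_⟩
  intro p Θ G j θ S s μ lam Λ t hΘ hG hG0 hj hmin ht hS hs hcone hlam hΛ hμΛ hμΛ' hW hWj hε
  have hε1 : Λ * s ≤ 1 := hε.trans ((min_le_left _ _).trans (min_le_left _ _))
  have hε2 : 2 * C₃ * K₂ * (Λ * s) ≤ 1 := by
    have := hε.trans ((min_le_left _ _).trans (min_le_right _ _))
    rwa [le_div_iff₀ (by positivity), mul_comm] at this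
  have hε3 : 32 * C₃ * (Λ * s) ≤ 1 := by
    have := hε.trans (min_le_right _ _)
    rwa [le_div_iff₀ (by positivity), mul_comm] at this
  have hjj : 0 < Θ j j := hΘ.posDef.diag_pos
  have hτ0 : 0 < (Θ j j)⁻¹ := inv_pos.2 hjj
  have hτu : (Θ j j)⁻¹ ≤ C₂ := by
    rw [inv_le_iff_one_le_mul₀ hjj]; exact hΘ.diag_lower j
  have hΛ0 : 0 ≤ Λ := hlam.trans hΛ
  have hs1 : 1 ≤ s := by
    have : j ∈ S := by
      by_contra hc
      exact hjj.ne' (hS j hc)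
    have : 1 ≤ S.card := Finset.card_pos.2 ⟨j, this⟩
    exact le_trans (by exact_mod_cast this) hs
  set θ₀ := (Θ j j)⁻¹ • Θ.col j with hθ₀
  have hν : ∀ k, |((G - Θ⁻¹) *ᵥ θ₀) k| ≤ C₂ * μ := fun k => by
    rw [hθ₀, mulVec_smul, Pi.smul_apply, smul_eq_mul, abs_mul, abs_of_pos hτ0]
    exact mul_le_mul hτu (hWj k) (abs_nonneg _) hC₂.le
  have hθj : θ₀ j = 1 := by simp [hθ₀, hjj.ne']
  have hVθ : Θ⁻¹ *ᵥ θ₀ = Pi.single j (Θ j j)⁻¹ := by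
    have : Θ⁻¹ *ᵥ Θ.col j = Pi.single j 1 := by
      have e : Θ *ᵥ Pi.single j 1 = Θ.col j := by simp
      rw [← e, mulVec_mulVec, Matrix.nonsing_inv_mul _ hΘ.posDef.det_pos.ne'.isUnit, one_mulVec]
    rw [hθ₀, mulVec_smul, this, ← Pi.single_smul]; simp
  have hsupp : ∀ k, k ∉ S → θ₀ k = 0 := fun k hk => by simp [hθ₀, hS k hk]
  have hκ : ∀ v : Fin p → ℝ, C₃⁻¹ * (v ⬝ᵥ v) ≤ v ⬝ᵥ Θ⁻¹ *ᵥ v := fun v => by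
    rw [inv_mul_le_iff₀ hC₃]; exact hΘ.lower v
  have hμ32 : 32 * s * μ ≤ C₃⁻¹ := by
    have e1 := mul_le_mul_of_nonneg_left hμΛ' (by linarith : 0 ≤ s)
    rw [← one_div, le_div_iff₀ hC₃]
    have e2 := mul_le_mul_of_nonneg_left e1 hC₃.le
    linarith
  obtain ⟨o1, o2, o3⟩ := lasso_oracle hG hG0 (inv_pos.2 hC₃) hκ hW hν hVθ (hj.trans hθj.symm) hmin
    hsupp hs hcone hlam hΛ hμΛ hμ32
  rw [inv_mul_le_iff₀ hC₃] at o1 o2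
  have hnorm : (∑ k, |θ₀ k|) ^ 2 ≤ s * (C₂ * C₃) ^ 2 := by
    have e1 : ∑ k, |θ₀ k| = ∑ k ∈ S, |θ₀ k| := by
      symm
      refine Finset.sum_subset (Finset.subset_univ _) fun k _ hk => ?_
      simp [hsupp k hk]
    rw [e1]
    refine (sum_abs_sq_le S θ₀).trans ?_
    have e2 : θ₀ ⬝ᵥ θ₀ ≤ (C₂ * C₃) ^ 2 := by
      rw [hθ₀, smul_dotProduct, dotProduct_smul, smul_eq_mul, smul_eq_mul, ← mul_assoc, mul_pow,
        ← sq]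
      refine mul_le_mul (pow_le_pow_left₀ hτ0.le hτu 2) (hΘ.col_sq j) ?_ (by positivity)
      exact Finset.sum_nonneg fun _ _ => mul_self_nonneg _
    exact mul_le_mul hs e2 (Finset.sum_nonneg fun _ _ => mul_self_nonneg _) (by linarith)
  have hfin := column_error hC₂ hC₃ hΘ hG hG0 hθ₀ hs1 hlam hΛ hnorm
    (fun k => (hν k).trans hμΛ) (by linarith) (by linarith)
    (o3.trans (mul_le_mul_of_nonneg_right hμΛ (Finset.sum_nonneg fun _ _ => abs_nonneg _))) ht hε1
    hε2
  have g1 : 0 ≤ B * Λ * s := by positivity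
  have g2 : 0 ≤ A * Λ ^ 2 * s := by positivity
  exact ⟨hfin.1.trans (by linarith), hfin.2.trans (by linarith)⟩

/-! ### The Gram matrix and the nodewise estimator -/

/-- The linear functional `x ↦ wᵀ x`. -/
noncomputable def lin {p : ℕ} (w : Fin p → ℝ) (x : EuclideanSpace ℝ (Fin p)) : ℝ := ∑ k, w k * x k

theorem dotProduct_gram {n p : ℕ} (X : Data n p) (v w : Fin p → ℝ) :
    v ⬝ᵥ gram X *ᵥ w = (∑ r, lin v (X r) * lin w (X r)) / n := by
  simp only [lin, dotProduct, mulVec, gram, of_apply, Finset.sum_div,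
    Finset.mul_sum, Finset.sum_mul]
  conv_lhs => rw [Finset.sum_comm]
  conv_rhs => rw [Finset.sum_comm]
  refine Finset.sum_congr rfl fun k _ => ?_
  rw [Finset.sum_comm]
  refine Finset.sum_congr rfl fun r _ => Finset.sum_congr rfl fun l _ => ?_
  ring

theorem gram_transpose {n p : ℕ} (X : Data n p) : (gram X)ᵀ = gram X := by
  ext k l; simp [gram, mul_comm]

theorem gram_nonneg {n p : ℕ} (X : Data n p) (v : Fin p → ℝ) : 0 ≤ v ⬝ᵥ gram X *ᵥ v := by
  rw [dotProduct_gram]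
  exact div_nonneg (Finset.sum_nonneg fun _ _ => mul_self_nonneg _) (Nat.cast_nonneg _)

/-- The coefficient vector of the nodewise regression: `1` at position `j`, `-γ` elsewhere. -/
noncomputable def coef {p : ℕ} (j : Fin p) (γ : {k : Fin p // k ≠ j} → ℝ) : Fin p → ℝ :=
  fun k => if h : k = j then 1 else -γ ⟨k, h⟩

theorem coef_self {p : ℕ} (j : Fin p) (γ : {k : Fin p // k ≠ j} → ℝ) : coef j γ j = 1 := by
  simp [coef]

theorem coef_of_eq_one {p : ℕ} {j : Fin p} {θ : Fin p → ℝ} (h : θ j = 1) :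
    coef j (fun k => -θ k) = θ := by
  ext k
  by_cases hk : k = j
  · subst hk; simp [coef, h]
  · simp [coef, hk]

theorem sum_subtype_ne {p : ℕ} (j : Fin p) (f : Fin p → ℝ) :
    ∑ k : {k : Fin p // k ≠ j}, f k = ∑ k ∈ Finset.univ.erase j, f k :=
  (Finset.sum_subtype _ (by simp) f).symm

theorem sum_abs_coef {p : ℕ} (j : Fin p) (γ : {k : Fin p // k ≠ j} → ℝ) :
    ∑ k ∈ Finset.univ.erase j, |coef j γ k| = ∑ k, |γ k| := by
  rw [← sum_subtype_ne]
  refine Finset.sum_congr rfl fun k _ => ?_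
  simp [coef, k.2]

theorem residualSq_eq {n p : ℕ} (X : Data n p) (j : Fin p) (γ : {k : Fin p // k ≠ j} → ℝ) :
    residualSq X j γ = coef j γ ⬝ᵥ gram X *ᵥ coef j γ := by
  rw [dotProduct_gram, residualSq]
  congr 1
  refine Finset.sum_congr rfl fun r _ => ?_
  rw [← sq]
  congr 1
  rw [lin, ← Finset.add_sum_erase _ _ (Finset.mem_univ j), coef_self, one_mul, sub_eq_add_neg,
    ← sum_subtype_ne, ← Finset.sum_neg_distrib]
  congr 1
  refine Finset.sum_congr rfl fun k _ => ?_
  simp [coef, k.2, mul_comm]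

theorem tauSq_eq {n p : ℕ} (X : Data n p) (j : Fin p) (lam : ℝ)
    (γ : {k : Fin p // k ≠ j} → ℝ) :
    tauSq X j lam γ = coef j γ ⬝ᵥ gram X *ᵥ coef j γ +
      lam * ∑ k ∈ Finset.univ.erase j, |coef j γ k| := by
  rw [tauSq, residualSq_eq, sum_abs_coef]

theorem IsNodewiseLasso.coef_le {n p : ℕ} {X : Data n p} {j : Fin p} {lam : ℝ}
    {γ : {k : Fin p // k ≠ j} → ℝ} (h : IsNodewiseLasso X j lam γ) {θ : Fin p → ℝ} (hθ : θ j = 1) :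
    coef j γ ⬝ᵥ gram X *ᵥ coef j γ + 2 * lam * ∑ k ∈ Finset.univ.erase j, |coef j γ k| ≤
      θ ⬝ᵥ gram X *ᵥ θ + 2 * lam * ∑ k ∈ Finset.univ.erase j, |θ k| := by
  have := h (fun k => -θ k)
  rw [residualSq_eq, residualSq_eq, coef_of_eq_one hθ, ← sum_abs_coef, ← sum_abs_coef,
    coef_of_eq_one hθ] at this
  exact this

theorem nodewise_col {n p : ℕ} (X : Data n p) (lam : Fin p → ℝ)
    (γ : ∀ j : Fin p, {k : Fin p // k ≠ j} → ℝ) (j : Fin p) :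
    (nodewise X lam γ).col j = (tauSq X j (lam j) (γ j))⁻¹ • coef j (γ j) := by
  ext k
  simp only [nodewise, col_apply, of_apply, coef, Pi.smul_apply, smul_eq_mul]
  rw [div_eq_inv_mul]

theorem desparsified_eq {n p : ℕ} (X : Data n p) (lam : Fin p → ℝ)
    (γ : ∀ j : Fin p, {k : Fin p // k ≠ j} → ℝ) (i j : Fin p) :
    desparsified X lam γ i j = (nodewise X lam γ).col i j + (nodewise X lam γ).col j i -
      (nodewise X lam γ).col i ⬝ᵥ gram X *ᵥ (nodewise X lam γ).col j := by
  simp only [desparsified, Matrix.sub_apply, Matrix.add_apply, transpose_apply, col_apply]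
  rw [Matrix.mul_assoc, add_comm (nodewise X lam γ i j)]
  rfl

theorem abs_bilin_le {p : ℕ} {G : Matrix (Fin p) (Fin p) ℝ} (hG : Gᵀ = G)
    (hG0 : ∀ v : Fin p → ℝ, 0 ≤ v ⬝ᵥ G *ᵥ v) (v w : Fin p → ℝ) :
    |v ⬝ᵥ G *ᵥ w| ≤ (v ⬝ᵥ G *ᵥ v + w ⬝ᵥ G *ᵥ w) / 2 := by
  have h1 := quadratic_add hG w v
  have h2 := quadratic_add hG w (-v)
  have h3 := hG0 (w + -v)
  have h4 := hG0 (w + v)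
  simp only [mulVec_neg, neg_dotProduct, dotProduct_neg, neg_neg] at h2
  rw [abs_le]; constructor <;> linarith

/-! ### The linearisation of the de-sparsified estimator -/

theorem inv_mulVec_col {p : ℕ} {Θ : Matrix (Fin p) (Fin p) ℝ} (hΘ : Θ.PosDef) (j : Fin p) :
    Θ⁻¹ *ᵥ Θ.col j = Pi.single j 1 := by
  have e : Θ *ᵥ Pi.single j 1 = Θ.col j := by simp
  rw [← e, mulVec_mulVec, Matrix.nonsing_inv_mul _ hΘ.det_pos.ne'.isUnit, one_mulVec]

theorem posDef_symm {p : ℕ} {Θ : Matrix (Fin p) (Fin p) ℝ} (hΘ : Θ.PosDef) (k l : Fin p) :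
    Θ k l = Θ l k := by
  simpa using (hΘ.isHermitian.apply l k)

/-- The remainder is second order in the column errors `u - Θ_i`, `v - Θ_j`, up to terms in which a
column error is paired with the small vectors `(Σ̂ - Θ⁻¹) Θ_i` and `(Σ̂ - Θ⁻¹) Θ_j`. -/
theorem abs_remainder_le {p : ℕ} {Θ G : Matrix (Fin p) (Fin p) ℝ} (hΘ : Θ.PosDef) (hG : Gᵀ = G)
    (hG0 : ∀ v : Fin p → ℝ, 0 ≤ v ⬝ᵥ G *ᵥ v) {i j : Fin p} {u v : Fin p → ℝ} {μ : ℝ}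
    (hi : ∀ k, |((G - Θ⁻¹) *ᵥ Θ.col i) k| ≤ μ) (hj : ∀ k, |((G - Θ⁻¹) *ᵥ Θ.col j) k| ≤ μ) :
    |2 * Θ i j - Θ.col i ⬝ᵥ G *ᵥ Θ.col j - (u j + v i - u ⬝ᵥ G *ᵥ v)| ≤
      μ * ∑ k, |u k - Θ k i| + μ * ∑ k, |v k - Θ k j| +
        ((u - Θ.col i) ⬝ᵥ G *ᵥ (u - Θ.col i) + (v - Θ.col j) ⬝ᵥ G *ᵥ (v - Θ.col j)) / 2 := by
  have h1 := abs_dotProduct_le (v := u - Θ.col i) hj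
  have h2 := abs_dotProduct_le (v := v - Θ.col j) hi
  have h3 := abs_bilin_le hG hG0 (u - Θ.col i) (v - Θ.col j)
  have e : 2 * Θ i j - Θ.col i ⬝ᵥ G *ᵥ Θ.col j - (u j + v i - u ⬝ᵥ G *ᵥ v) =
      (u - Θ.col i) ⬝ᵥ (G - Θ⁻¹) *ᵥ Θ.col j + (v - Θ.col j) ⬝ᵥ (G - Θ⁻¹) *ᵥ Θ.col i +
        (u - Θ.col i) ⬝ᵥ G *ᵥ (v - Θ.col j) := by
    have s : ∀ x y : Fin p → ℝ, x ⬝ᵥ G *ᵥ y = y ⬝ᵥ G *ᵥ x := fun x y => by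
      rw [dotProduct_mulVec, ← mulVec_transpose, hG, dotProduct_comm]
    rw [sub_mulVec, sub_mulVec, inv_mulVec_col hΘ, inv_mulVec_col hΘ]
    simp only [mulVec_sub, dotProduct_sub, sub_dotProduct, dotProduct_single, mul_one, col_apply,
      Pi.sub_apply]
    rw [s v, posDef_symm hΘ j i, s (Θ.col j) (Θ.col i)]
    ring
  rw [e]
  refine (abs_add_three _ _ _).trans ?_
  simp only [Pi.sub_apply, col_apply] at h1 h2
  exact add_le_add (add_le_add h1 h2) h3

/-! ### A crude bound, valid for every data set -/

theorem abs_gram_le_trace {p : ℕ} {G : Matrix (Fin p) (Fin p) ℝ} (hG : Gᵀ = G)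
    (hG0 : ∀ v : Fin p → ℝ, 0 ≤ v ⬝ᵥ G *ᵥ v) (k l : Fin p) : |G k l| ≤ ∑ m, G m m := by
  have hd : ∀ m, 0 ≤ G m m := fun m => by simpa using hG0 (Pi.single m 1)
  have h := abs_bilin_le hG hG0 (Pi.single k 1) (Pi.single l 1)
  have h1 := Finset.single_le_sum (f := fun m => G m m) (fun m _ => hd m) (Finset.mem_univ k)
  have h2 := Finset.single_le_sum (f := fun m => G m m) (fun m _ => hd m) (Finset.mem_univ l)
  simp only [mulVec_single_one, single_one_dotProduct, col_apply] at h h1 h2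
  linarith

/-- The noise estimate `τ̂²` cannot be small unless `Σ̂_jj` is: a small `τ̂²` forces a small penalty
term, hence small coefficients, and then the residual is close to the `j`-th variable itself. -/
theorem inv_tau_le {p : ℕ} {G : Matrix (Fin p) (Fin p) ℝ} (hG : Gᵀ = G)
    (hG0 : ∀ v : Fin p → ℝ, 0 ≤ v ⬝ᵥ G *ᵥ v) {j : Fin p} {θ : Fin p → ℝ} (hθ : θ j = 1)
    {lam ℓ t : ℝ} (hlam : 0 < lam ∨ lam = 0 ∧ Finset.univ.erase j = ∅) (hℓ : lam⁻¹ ≤ ℓ)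
    (ht : t = θ ⬝ᵥ G *ᵥ θ + lam * ∑ k ∈ Finset.univ.erase j, |θ k|) (hjj : 0 < G j j) :
    t⁻¹ ≤ 1 + (1 + (∑ m, G m m) * ℓ ^ 2) ^ 2 + (G j j)⁻¹ ^ 2 := by
  have hd : ∀ m, 0 ≤ G m m := fun m => by simpa using hG0 (Pi.single m 1)
  have htr : 0 ≤ ∑ m, G m m := Finset.sum_nonneg fun m _ => hd m
  have hQ0 := hG0 θ
  set P := ∑ k ∈ Finset.univ.erase j, |θ k| with hP
  have hP0 : 0 ≤ P := Finset.sum_nonneg fun _ _ => abs_nonneg _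
  have hlam0 : 0 ≤ lam := by rcases hlam with h | h <;> [exact h.le; exact h.1.ge]
  have hℓ0 : 0 ≤ ℓ := (inv_nonneg.2 hlam0).trans hℓ
  have ht0 : 0 ≤ t := by rw [ht]; positivity
  by_cases h1 : 1 ≤ t
  · have := inv_le_one_of_one_le₀ h1
    nlinarith [sq_nonneg (1 + (∑ m, G m m) * ℓ ^ 2), sq_nonneg (G j j)⁻¹]
  · push Not at h1
    have hPt : P ≤ t * ℓ := by
      rcases hlam with h | h
      · have : lam * P ≤ t := by rw [ht]; linarith
        have h2 : P ≤ t * lam⁻¹ := by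
          rw [← div_eq_mul_inv, le_div_iff₀ h]; linarith
        exact h2.trans (mul_le_mul_of_nonneg_left hℓ ht0)
      · have : P = 0 := by rw [hP, h.2]; simp
        rw [this]; positivity
    have hw : G j j ≤ 2 * (θ ⬝ᵥ G *ᵥ θ) + 2 * ((∑ m, G m m) * P ^ 2) := by
      have e1 := quadratic_add_le hG hG0 θ (Pi.single j 1 - θ)
      rw [add_sub_cancel] at e1
      have e2 := (abs_le.1 (abs_quadratic_le G (abs_gram_le_trace hG hG0) (Pi.single j 1 - θ))).2
      have e3 : ∑ k, |(Pi.single j 1 - θ : Fin p → ℝ) k| = P := by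
        rw [← Finset.add_sum_erase _ _ (Finset.mem_univ j)]
        simp only [Pi.sub_apply, Pi.single_eq_same, hθ, sub_self, abs_zero, zero_add, hP]
        refine Finset.sum_congr rfl fun k hk => ?_
        simp [Finset.ne_of_mem_erase hk]
      rw [e3] at e2
      simp only [mulVec_single_one, single_one_dotProduct, col_apply] at e1
      linarith
    have hQt : θ ⬝ᵥ G *ᵥ θ ≤ t := by rw [ht]; have := mul_nonneg hlam0 hP0; linarith
    have hP2 : P ^ 2 ≤ t * ℓ ^ 2 := by
      have e1 : P ^ 2 ≤ (t * ℓ) ^ 2 := pow_le_pow_left₀ hP0 hPt 2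
      have e2 : t ^ 2 * ℓ ^ 2 ≤ t * ℓ ^ 2 := mul_le_mul_of_nonneg_right (by nlinarith) (sq_nonneg _)
      nlinarith
    have hmain : G j j ≤ t * (2 * (1 + (∑ m, G m m) * ℓ ^ 2)) := by
      have := mul_le_mul_of_nonneg_left hP2 htr
      nlinarith
    have htpos : 0 < t := by
      rcases ht0.eq_or_lt with h | h
      · rw [← h] at hmain; linarith
      · exact h
    set B := 1 + (∑ m, G m m) * ℓ ^ 2 with hB
    have : t⁻¹ ≤ 2 * B * (G j j)⁻¹ := by
      rw [← div_eq_mul_inv, le_div_iff₀ hjj, inv_mul_le_iff₀ htpos]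
      exact hmain
    nlinarith [sq_nonneg (B - (G j j)⁻¹)]

/-- The de-sparsified estimator is bounded in terms of `1 / τ̂²` and of `1 / λ` alone, because the
penalty term and the quadratic form are both at most `τ̂²`. -/
theorem abs_desparsified_le {p : ℕ} {G : Matrix (Fin p) (Fin p) ℝ} (hG : Gᵀ = G)
    (hG0 : ∀ v : Fin p → ℝ, 0 ≤ v ⬝ᵥ G *ᵥ v) {i j : Fin p} {θi θj : Fin p → ℝ} (hi : θi i = 1)
    (hj : θj j = 1) {lami lamj ℓ ti tj : ℝ}
    (hlami : 0 < lami ∨ lami = 0 ∧ Finset.univ.erase i = ∅)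
    (hlamj : 0 < lamj ∨ lamj = 0 ∧ Finset.univ.erase j = ∅) (hℓi : lami⁻¹ ≤ ℓ) (hℓj : lamj⁻¹ ≤ ℓ)
    (hti : ti = θi ⬝ᵥ G *ᵥ θi + lami * ∑ k ∈ Finset.univ.erase i, |θi k|)
    (htj : tj = θj ⬝ᵥ G *ᵥ θj + lamj * ∑ k ∈ Finset.univ.erase j, |θj k|) :
    |ti⁻¹ * θi j + tj⁻¹ * θj i - (ti⁻¹ • θi) ⬝ᵥ G *ᵥ (tj⁻¹ • θj)| ≤
      2 * ti⁻¹ + 2 * tj⁻¹ + 2 * ℓ := by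
  have aux : ∀ (a b : Fin p) (θ : Fin p → ℝ) (lam t : ℝ), θ a = 1 →
      (0 < lam ∨ lam = 0 ∧ Finset.univ.erase a = ∅) → lam⁻¹ ≤ ℓ →
      t = θ ⬝ᵥ G *ᵥ θ + lam * ∑ k ∈ Finset.univ.erase a, |θ k| →
      0 ≤ t ∧ |t⁻¹ * θ b| ≤ t⁻¹ + ℓ ∧ (t⁻¹ • θ) ⬝ᵥ G *ᵥ (t⁻¹ • θ) ≤ t⁻¹ := by
    intro a b θ lam t ha hlam hℓ ht
    have hQ0 := hG0 θ
    have hP0 : 0 ≤ ∑ k ∈ Finset.univ.erase a, |θ k| := Finset.sum_nonneg fun _ _ => abs_nonneg _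
    have hlam0 : 0 ≤ lam := by rcases hlam with h | h <;> [exact h.le; exact h.1.ge]
    have hℓ0 : 0 ≤ ℓ := (inv_nonneg.2 hlam0).trans hℓ
    have hlP := mul_nonneg hlam0 hP0
    have ht0 : 0 ≤ t := by rw [ht]; positivity
    have hti0 := inv_nonneg.2 ht0
    refine ⟨ht0, ?_, ?_⟩
    · rw [abs_mul, abs_of_nonneg hti0]
      by_cases hab : b = a
      · rw [hab, ha]; simp [hℓ0]
      · rcases hlam with h | h
        · have h1 : |θ b| ≤ ∑ k ∈ Finset.univ.erase a, |θ k| :=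
            Finset.single_le_sum (f := fun k => |θ k|) (fun _ _ => abs_nonneg _) (by simp [hab])
          have h2 : lam * |θ b| ≤ t := by
            have := mul_le_mul_of_nonneg_left h1 hlam0
            rw [ht]; linarith
          have h3 : t⁻¹ * (lam * |θ b|) ≤ 1 :=
            (mul_le_mul_of_nonneg_left h2 hti0).trans (inv_mul_le_one)
          have h4 : t⁻¹ * |θ b| ≤ lam⁻¹ := by
            rw [← one_div lam, le_div_iff₀ h]; linarith
          linarith
        · have : b ∈ Finset.univ.erase a := by simp [hab]
          rw [h.2] at this; simp at this
    · rw [quadratic_smul, sq, mul_assoc]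
      have h1 : t⁻¹ * (θ ⬝ᵥ G *ᵥ θ) ≤ 1 :=
        (mul_le_mul_of_nonneg_left (by rw [ht]; linarith) hti0).trans (inv_mul_le_one (a := t))
      exact (mul_le_mul_of_nonneg_left h1 hti0).trans (mul_one _).le
  obtain ⟨a1, a2, a3⟩ := aux i j θi lami ti hi hlami hℓi hti
  obtain ⟨b1, b2, b3⟩ := aux j i θj lamj tj hj hlamj hℓj htj
  have h := abs_bilin_le hG hG0 (ti⁻¹ • θi) (tj⁻¹ • θj)
  have hti0 := inv_nonneg.2 a1
  have htj0 := inv_nonneg.2 b1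
  rw [abs_le] at a2 b2 h ⊢
  constructor <;> linarith

/-! ### One-dimensional Gaussian integrals -/

theorem integrable_pow_gaussian (k : ℕ) : Integrable (fun x : ℝ => x ^ k) (gaussianReal 0 1) := by
  have h := (memLp_id_gaussianReal (μ := 0) (v := 1) k).integrable_norm_pow'
  refine (integrable_norm_iff (by fun_prop)).1 ?_
  simpa [norm_pow] using h

theorem integrable_gaussian_iff {f : ℝ → ℝ} :
    Integrable f (gaussianReal 0 1) ↔ Integrable (fun x => Real.exp (-x ^ 2 / 2) * f x) := by
  rw [gaussianReal_of_var_ne_zero 0 one_ne_zero,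
    integrable_withDensity_iff_integrable_smul' (measurable_gaussianPDF 0 1)
      (ae_of_all _ fun _ => gaussianPDF_lt_top)]
  simp only [toReal_gaussianPDF, gaussianPDFReal, smul_eq_mul, sub_zero, NNReal.coe_one, mul_one,
    mul_assoc]
  rw [integrable_const_mul_iff]
  exact (inv_pos.2 (Real.sqrt_pos.2 (by positivity))).ne'.isUnit

theorem integral_gaussian (f : ℝ → ℝ) :
    ∫ x, f x ∂(gaussianReal 0 1) = (√(2 * Real.pi))⁻¹ * ∫ x, Real.exp (-x ^ 2 / 2) * f x := by
  rw [integral_gaussianReal_eq_integral_smul one_ne_zero, ← integral_const_mul]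
  simp [gaussianPDFReal, mul_assoc]

theorem integral_fourth_gaussian : ∫ x, x ^ 4 ∂(gaussianReal 0 1) = 3 := by
  rw [integral_gaussian]
  have h1 : ∫ x : ℝ, Real.exp (-x ^ 2 / 2) * x ^ 4 =
      2 * ∫ x in Set.Ioi (0 : ℝ), Real.exp (-x ^ 2 / 2) * x ^ 4 := by
    have := integral_comp_abs (f := fun x : ℝ => Real.exp (-x ^ 2 / 2) * x ^ 4)
    simpa [Even.pow_abs (show Even 4 by decide)] using this
  have h2 := integral_rpow_mul_exp_neg_mul_rpow (p := 2) (q := 4) (b := 1 / 2) (by norm_num)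
    (by norm_num) (by norm_num)
  have h3 : ∫ x in Set.Ioi (0 : ℝ), Real.exp (-x ^ 2 / 2) * x ^ 4 =
      ∫ x in Set.Ioi (0 : ℝ), x ^ (4 : ℝ) * Real.exp (-(1 / 2) * x ^ (2 : ℝ)) := by
    refine setIntegral_congr_fun measurableSet_Ioi fun x _ => ?_
    simp only [Real.rpow_ofNat]
    rw [mul_comm]; congr 2; ring
  have hg : Real.Gamma ((4 + 1) / 2) = 3 / 4 * √Real.pi := by
    rw [show ((4 : ℝ) + 1) / 2 = 3 / 2 + 1 by norm_num, Real.Gamma_add_one (by norm_num),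
      show (3 : ℝ) / 2 = 1 / 2 + 1 by norm_num, Real.Gamma_add_one (by norm_num),
      Real.Gamma_one_half_eq]; ring
  have hr : (1 / 2 : ℝ) ^ (-(4 + 1) / 2 : ℝ) = 4 * √2 := by
    rw [one_div, Real.inv_rpow (by norm_num), ← Real.rpow_neg (by norm_num),
      show -(-(4 + 1) / 2 : ℝ) = 2 + 1 / 2 by norm_num, Real.rpow_add (by norm_num),
      ← Real.sqrt_eq_rpow]
    norm_num
  rw [h1, h3, h2, hg, hr, Real.sqrt_mul (by norm_num)]
  have : √2 ≠ 0 := by positivity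
  have : √Real.pi ≠ 0 := by positivity
  field_simp

/-- The centred `χ²` variable is sub-exponential. -/
theorem exp_sq_gaussian {u : ℝ} (hu : |u| ≤ 1 / 4) :
    Integrable (fun x : ℝ => Real.exp (u * (x ^ 2 - 1))) (gaussianReal 0 1) ∧
      ∫ x, Real.exp (u * (x ^ 2 - 1)) ∂(gaussianReal 0 1) ≤ Real.exp (4 * u ^ 2) := by
  have hu' := abs_le.1 hu
  have hb : 0 < (1 - 2 * u) / 2 := by linarith
  have e : ∀ x : ℝ, Real.exp (-x ^ 2 / 2) * Real.exp (u * (x ^ 2 - 1)) =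
      Real.exp (-u) * Real.exp (-((1 - 2 * u) / 2) * x ^ 2) := fun x => by
    rw [← Real.exp_add, ← Real.exp_add]; congr 1; ring
  constructor
  · rw [integrable_gaussian_iff]
    simp only [e]
    exact (integrable_exp_neg_mul_sq hb).const_mul _
  · rw [integral_gaussian]
    simp only [e]
    rw [integral_const_mul, _root_.integral_gaussian]
    have h1 : (√(2 * Real.pi))⁻¹ * (Real.exp (-u) * √(Real.pi / ((1 - 2 * u) / 2))) =
        Real.exp (-u) * √((1 - 2 * u)⁻¹) := by
      have : Real.pi / ((1 - 2 * u) / 2) = (2 * Real.pi) * (1 - 2 * u)⁻¹ := by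
        have : (1 - 2 * u) ≠ 0 := by linarith
        field_simp
      rw [this, Real.sqrt_mul (by positivity : (0 : ℝ) ≤ 2 * Real.pi)]
      have : √(2 * Real.pi) ≠ 0 := by positivity
      generalize √(2 * Real.pi) = a at this
      rw [mul_left_comm, inv_mul_cancel_left₀ this]
    rw [h1]
    have hx : |2 * u| < 1 := by rw [abs_mul, abs_two]; linarith
    have hlog := Real.abs_log_sub_add_sum_range_le hx 1
    simp only [Finset.sum_range_one, zero_add, pow_one, CharP.cast_eq_zero, div_one] at hlog
    have h2 : |2 * u| ^ (1 + 1) / (1 - |2 * u|) ≤ 8 * u ^ 2 := by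
      rw [div_le_iff₀ (by linarith), abs_mul, abs_two, mul_pow, sq_abs]
      have h1 : (1 : ℝ) / 2 ≤ 1 - 2 * |u| := by linarith
      have := mul_le_mul_of_nonneg_left h1 (by positivity : 0 ≤ 8 * u ^ 2)
      norm_num
      linarith
    have h3 : -(2 * u) - 8 * u ^ 2 ≤ Real.log (1 - 2 * u) := by
      have := (abs_le.1 (hlog.trans h2)).1; linarith
    have h4 : (1 - 2 * u)⁻¹ ≤ Real.exp (u + 4 * u ^ 2) ^ 2 := by
      rw [← Real.exp_nat_mul, inv_le_comm₀ (by linarith) (Real.exp_pos _), ← Real.exp_neg,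
        ← Real.le_log_iff_exp_le (by linarith)]
      push_cast; linarith
    have h5 : √((1 - 2 * u)⁻¹) ≤ Real.exp (u + 4 * u ^ 2) := by
      rw [Real.sqrt_le_left (Real.exp_pos _).le]; exact h4
    calc _ ≤ Real.exp (-u) * Real.exp (u + 4 * u ^ 2) :=
          mul_le_mul_of_nonneg_left h5 (Real.exp_pos _).le
      _ = _ := by rw [← Real.exp_add]; congr 1; ring

theorem integrable_inv_sqrt_abs_gaussian :
    Integrable (fun x : ℝ => (√|x|)⁻¹) (gaussianReal 0 1) := by
  rw [integrable_gaussian_iff]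
  have h := integrable_rpow_mul_exp_neg_mul_sq (b := 1 / 2) (s := -1 / 2) (by norm_num)
    (by norm_num)
  have h' := (h.norm.add h.comp_neg.norm)
  refine h'.mono' (by fun_prop) (ae_of_all _ fun x => ?_)
  have hx : (√|x|)⁻¹ = |x| ^ (-1 / 2 : ℝ) := by
    rw [Real.sqrt_eq_rpow, ← Real.rpow_neg (abs_nonneg x)]; norm_num
  have e : Real.exp (-x ^ 2 / 2) = Real.exp (-(1 / 2) * x ^ 2) := by congr 1; ring
  rw [hx, Real.norm_eq_abs, abs_mul, Real.abs_exp, abs_of_nonneg (by positivity), e, mul_comm]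
  simp only [Pi.add_apply, norm_mul, Real.norm_eq_abs, Real.abs_exp, neg_sq]
  rw [← add_mul]
  refine mul_le_mul_of_nonneg_right ?_ (Real.exp_pos _).le
  rcases abs_choice x with h | h <;> rw [h]
  · exact (le_abs_self _).trans (le_add_of_nonneg_right (abs_nonneg _))
  · exact (le_abs_self _).trans (le_add_of_nonneg_left (abs_nonneg _))

/-! ### Linear functionals of a Gaussian vector -/

theorem measurable_lin {p : ℕ} (w : Fin p → ℝ) : Measurable (lin w) := by
  unfold lin; fun_prop

theorem map_lin {p : ℕ} {V : Matrix (Fin p) (Fin p) ℝ} (hV : V.PosSemidef) (w : Fin p → ℝ) :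
    (multivariateGaussian 0 V).map (lin w) =
      (gaussianReal 0 1).map (fun g => √(w ⬝ᵥ V *ᵥ w) * g) := by
  have h0 : 0 ≤ w ⬝ᵥ V *ᵥ w := by simpa using hV.dotProduct_mulVec_nonneg w
  have e : lin w = innerSL ℝ (WithLp.toLp 2 w) := by
    ext x
    rw [innerSL_apply_apply, EuclideanSpace.inner_eq_star_dotProduct]
    simp [lin, dotProduct, mul_comm]
  rw [gaussianReal_map_const_mul, e, IsGaussian.map_eq_gaussianReal]
  congr 1
  · rw [ContinuousLinearMap.integral_comp_id_comm]
    · simp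
    · exact IsGaussian.integrable_id
  · have : Var[innerSL ℝ (WithLp.toLp 2 w); multivariateGaussian 0 V] = w ⬝ᵥ V *ᵥ w := by
      rw [← covariance_self (by fun_prop)]
      have := covarianceBilin_apply_eq_cov (μ := multivariateGaussian 0 V)
        IsGaussian.memLp_two_id (WithLp.toLp 2 w) (WithLp.toLp 2 w)
      rw [covarianceBilin_multivariateGaussian hV] at this
      exact this.symm
    rw [this]
    ext
    simp [Real.sq_sqrt h0, h0]

theorem integral_comp_lin {p : ℕ} {V : Matrix (Fin p) (Fin p) ℝ} (hV : V.PosSemidef)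
    (w : Fin p → ℝ) {f : ℝ → ℝ} (hf : Measurable f) :
    ∫ x, f (lin w x) ∂(multivariateGaussian 0 V) =
      ∫ g, f (√(w ⬝ᵥ V *ᵥ w) * g) ∂(gaussianReal 0 1) := by
  rw [← integral_map (f := f) (φ := lin w) (measurable_lin w).aemeasurable
    hf.aestronglyMeasurable, map_lin hV,
    integral_map (by fun_prop) hf.aestronglyMeasurable]

theorem integrable_comp_lin {p : ℕ} {V : Matrix (Fin p) (Fin p) ℝ} (hV : V.PosSemidef)
    (w : Fin p → ℝ) {f : ℝ → ℝ} (hf : Measurable f) :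
    Integrable (fun x => f (lin w x)) (multivariateGaussian 0 V) ↔
      Integrable (fun g => f (√(w ⬝ᵥ V *ᵥ w) * g)) (gaussianReal 0 1) := by
  have h1 := integrable_map_measure (f := lin w) (g := f) (μ := multivariateGaussian 0 V)
    hf.aestronglyMeasurable (measurable_lin w).aemeasurable
  rw [map_lin hV, integrable_map_measure hf.aestronglyMeasurable (by fun_prop)] at h1
  exact h1.symm

/-! ### Concentration of the Gram matrix -/

instance {n p : ℕ} (Θ : Matrix (Fin p) (Fin p) ℝ) : IsProbabilityMeasure (dataLaw n Θ) := by
  unfold dataLaw; infer_instance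

theorem measurable_gram {n p : ℕ} (v w : Fin p → ℝ) :
    Measurable fun X : Data n p => v ⬝ᵥ gram X *ᵥ w := by
  simp only [dotProduct_gram]
  refine (Finset.measurable_sum _ fun r _ => ?_).div_const _
  exact ((measurable_lin v).comp (measurable_pi_apply r)).mul
    ((measurable_lin w).comp (measurable_pi_apply r))

theorem exp_quadratic_le {n p : ℕ} {Θ : Matrix (Fin p) (Fin p) ℝ} (hΘ : Θ.PosDef)
    (w : Fin p → ℝ) {B u : ℝ} (hB : w ⬝ᵥ Θ⁻¹ *ᵥ w ≤ B) (hu : |u| * B ≤ 1 / 4) :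
    Integrable (fun X => Real.exp (u * ∑ r, (lin w (X r) ^ 2 - w ⬝ᵥ Θ⁻¹ *ᵥ w))) (dataLaw n Θ) ∧
      ∫ X, Real.exp (u * ∑ r, (lin w (X r) ^ 2 - w ⬝ᵥ Θ⁻¹ *ᵥ w)) ∂(dataLaw n Θ) ≤
        Real.exp (4 * u ^ 2 * B ^ 2 * n) := by
  have hV := hΘ.inv.posSemidef
  set v := w ⬝ᵥ Θ⁻¹ *ᵥ w with hv
  have hv0 : 0 ≤ v := by simpa using hV.dotProduct_mulVec_nonneg w
  have huv : |u * v| ≤ 1 / 4 := by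
    rw [abs_mul, abs_of_nonneg hv0]
    exact (mul_le_mul_of_nonneg_left hB (abs_nonneg u)).trans hu
  have hf : Measurable fun y : ℝ => Real.exp (u * (y ^ 2 - v)) := by fun_prop
  have e : ∀ g : ℝ, Real.exp (u * ((√v * g) ^ 2 - v))
      = Real.exp (u * v * (g ^ 2 - 1)) := fun g => by
    rw [mul_pow, Real.sq_sqrt hv0]; congr 1; ring
  have h1 := exp_sq_gaussian huv
  have hint : Integrable (fun x => Real.exp (u * (lin w x ^ 2 - v)))
      (multivariateGaussian 0 Θ⁻¹) := by
    rw [integrable_comp_lin hV w hf]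
    simpa only [← hv, e] using h1.1
  have hle : ∫ x, Real.exp (u * (lin w x ^ 2 - v)) ∂(multivariateGaussian 0 Θ⁻¹) ≤
      Real.exp (4 * (u * v) ^ 2) := by
    rw [integral_comp_lin hV w hf]
    simpa only [← hv, e] using h1.2
  simp only [Finset.mul_sum, Real.exp_sum]
  refine ⟨Integrable.fintype_prod fun _ => hint, ?_⟩
  rw [dataLaw, integral_fintype_prod_eq_prod
    (f := fun _ x => Real.exp (u * (lin w x ^ 2 - v)))]
  simp only [Finset.prod_const, Finset.card_univ, Fintype.card_fin]
  refine (pow_le_pow_left₀ (integral_nonneg fun _ => (Real.exp_pos _).le) hle n).trans ?_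
  rw [← Real.exp_nat_mul, Real.exp_le_exp]
  have : (u * v) ^ 2 ≤ u ^ 2 * B ^ 2 := by
    rw [mul_pow]; exact mul_le_mul_of_nonneg_left (pow_le_pow_left₀ hv0 hB 2) (sq_nonneg u)
  have hn : (0 : ℝ) ≤ n := Nat.cast_nonneg n
  nlinarith [mul_le_mul_of_nonneg_left this hn]

/-- Chernoff bound for a quadratic form of the centred Gram matrix. -/
theorem quadratic_tail {n p : ℕ} (hn : 0 < n) {Θ : Matrix (Fin p) (Fin p) ℝ} (hΘ : Θ.PosDef)
    (w : Fin p → ℝ) {B ρ : ℝ} (hB0 : 0 < B) (hB : w ⬝ᵥ Θ⁻¹ *ᵥ w ≤ B) (hρ : 0 ≤ ρ)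
    (hρB : ρ ≤ 2 * B) :
    (dataLaw n Θ).real {X | ρ ≤ |w ⬝ᵥ (gram X - Θ⁻¹) *ᵥ w|} ≤
      2 * Real.exp (-(n * ρ ^ 2 / (16 * B ^ 2))) := by
  have hn' : (0 : ℝ) < n := Nat.cast_pos.2 hn
  set v := w ⬝ᵥ Θ⁻¹ *ᵥ w with hv
  set Y : Data n p → ℝ := fun X => ∑ r, (lin w (X r) ^ 2 - v) with hY
  have hYe : ∀ X, w ⬝ᵥ (gram X - Θ⁻¹) *ᵥ w = Y X / n := fun X => by
    rw [sub_mulVec, dotProduct_sub, dotProduct_gram, hY]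
    simp only [Finset.sum_sub_distrib, ← sq]
    simp [sub_div, hn'.ne', hv]
  set u := ρ / (8 * B ^ 2) with hu
  have hu0 : 0 ≤ u := by positivity
  have huB : u * B ≤ 1 / 4 := by
    rw [hu, div_mul_eq_mul_div, div_le_iff₀ (by positivity)]; nlinarith
  have hexp : Real.exp (-u * (n * ρ)) * Real.exp (4 * u ^ 2 * B ^ 2 * n) =
      Real.exp (-(n * ρ ^ 2 / (16 * B ^ 2))) := by
    rw [← Real.exp_add]; congr 1; rw [hu]; field_simp; ring
  have t1 : (dataLaw n Θ).real {X | n * ρ ≤ Y X} ≤ Real.exp (-(n * ρ ^ 2 / (16 * B ^ 2))) := by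
    obtain ⟨i1, i2⟩ := exp_quadratic_le (n := n) hΘ w (u := u) hB (by rwa [abs_of_nonneg hu0])
    refine (measure_ge_le_exp_mul_mgf _ hu0 i1).trans ?_
    rw [← hexp]
    exact mul_le_mul_of_nonneg_left i2 (Real.exp_pos _).le
  have t2 : (dataLaw n Θ).real {X | n * ρ ≤ -Y X} ≤ Real.exp (-(n * ρ ^ 2 / (16 * B ^ 2))) := by
    obtain ⟨i1, i2⟩ := exp_quadratic_le (n := n) hΘ w (u := -u) hB
      (by rwa [abs_neg, abs_of_nonneg hu0])
    have e : ∀ X, u * (-Y X) = -u * Y X := fun X => by ring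
    refine (measure_ge_le_exp_mul_mgf _ hu0 (by simpa only [e] using i1)).trans ?_
    rw [← hexp]
    refine mul_le_mul_of_nonneg_left ?_ (Real.exp_pos _).le
    rw [mgf]
    simpa only [e, neg_sq] using i2
  have hsub : {X : Data n p | ρ ≤ |w ⬝ᵥ (gram X - Θ⁻¹) *ᵥ w|} ⊆
      {X | n * ρ ≤ Y X} ∪ {X | n * ρ ≤ -Y X} := by
    intro X hX
    simp only [Set.mem_ofPred_eq, hYe, le_abs] at hX
    rcases hX with h | h
    · left; rw [le_div_iff₀ hn'] at h; simpa [mul_comm] using h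
    · right; rw [← neg_div, le_div_iff₀ hn'] at h; simpa [mul_comm] using h
  calc _ ≤ _ := measureReal_mono hsub
    _ ≤ _ := measureReal_union_le _ _
    _ ≤ _ := by linarith

/-- Bilinear forms of the centred Gram matrix are handled by polarisation. -/
theorem bilinear_tail {n p : ℕ} (hn : 0 < n) {C₂ C₃ : ℝ} (hC₂ : 0 < C₂)
    {Θ : Matrix (Fin p) (Fin p) ℝ} (hΘ : IsRegular C₂ C₃ Θ)
    (x y : Fin p → ℝ) {B ρ : ℝ} (hB0 : 0 < B) (hB : 2 * C₂ * (x ⬝ᵥ x + y ⬝ᵥ y) ≤ B) (hρ : 0 ≤ ρ)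
    (hρB : ρ ≤ B) :
    (dataLaw n Θ).real {X | ρ ≤ |x ⬝ᵥ (gram X - Θ⁻¹) *ᵥ y|} ≤
      4 * Real.exp (-(n * ρ ^ 2 / (4 * B ^ 2))) := by
  have hsymm : ∀ X : Data n p, (gram X - Θ⁻¹)ᵀ = gram X - Θ⁻¹ := fun X => by
    rw [transpose_sub, gram_transpose]
    have := hΘ.posDef.inv.isHermitian
    rw [Matrix.IsHermitian, conjTranspose_eq_transpose_of_trivial] at this
    rw [this]
  have hup : ∀ z : Fin p → ℝ, z = y ∨ z = -y → (x + z) ⬝ᵥ Θ⁻¹ *ᵥ (x + z) ≤ B := by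
    intro z hz
    refine (hΘ.upper _).trans ?_
    have h1 : (x + z) ⬝ᵥ (x + z) ≤ 2 * (x ⬝ᵥ x + y ⬝ᵥ y) := by
      have := quadratic_add_le (G := (1 : Matrix (Fin p) (Fin p) ℝ)) (by simp)
        (fun v => by rw [one_mulVec]; exact Finset.sum_nonneg fun _ _ => mul_self_nonneg _) x z
      simp only [one_mulVec] at this
      rcases hz with h | h <;> subst h
      · linarith
      · simp only [neg_dotProduct, dotProduct_neg, neg_neg] at this; linarith
    have := mul_le_mul_of_nonneg_left h1 hC₂.le
    linarith
  have h1 := quadratic_tail hn hΘ.posDef (x + y) hB0 (hup y (Or.inl rfl))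
    (by positivity : 0 ≤ 2 * ρ) (by linarith)
  have h2 := quadratic_tail hn hΘ.posDef (x + -y) hB0 (hup (-y) (Or.inr rfl))
    (by positivity : 0 ≤ 2 * ρ) (by linarith)
  have he : (n : ℝ) * (2 * ρ) ^ 2 / (16 * B ^ 2) = n * ρ ^ 2 / (4 * B ^ 2) := by
    field_simp; ring
  rw [he] at h1 h2
  have hsub : {X : Data n p | ρ ≤ |x ⬝ᵥ (gram X - Θ⁻¹) *ᵥ y|} ⊆
      {X | 2 * ρ ≤ |(x + y) ⬝ᵥ (gram X - Θ⁻¹) *ᵥ (x + y)|} ∪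
        {X | 2 * ρ ≤ |(x + -y) ⬝ᵥ (gram X - Θ⁻¹) *ᵥ (x + -y)|} := by
    intro X hX
    by_contra hc
    simp only [Set.mem_union, Set.mem_ofPred_eq, not_or, not_le] at hc hX
    have e1 := quadratic_add (hsymm X) y x
    have e2 := quadratic_add (hsymm X) (-y) x
    rw [add_comm y x] at e1
    rw [add_comm (-y) x] at e2
    simp only [mulVec_neg, neg_dotProduct, dotProduct_neg, neg_neg] at e2
    rw [abs_lt, abs_lt] at hc
    rcases le_abs.1 hX with h | h <;> linarith [hc.1.1, hc.1.2, hc.2.1, hc.2.2]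
  calc _ ≤ _ := measureReal_mono hsub
    _ ≤ _ := measureReal_union_le _ _
    _ ≤ _ := by linarith

/-- The data sets for which the Gram matrix deviates from `Θ⁻¹` by at most `μ`, entrywise and in
the directions of the columns `Θ_i` and `Θ_j`. -/
def goodSet {n p : ℕ} (Θ : Matrix (Fin p) (Fin p) ℝ) (i j : Fin p) (μ : ℝ) : Set (Data n p) :=
  {X | (∀ k l, |(gram X - Θ⁻¹) k l| ≤ μ) ∧ (∀ k, |((gram X - Θ⁻¹) *ᵥ Θ.col i) k| ≤ μ) ∧
    ∀ k, |((gram X - Θ⁻¹) *ᵥ Θ.col j) k| ≤ μ}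

theorem measurableSet_goodSet {n p : ℕ} (Θ : Matrix (Fin p) (Fin p) ℝ) (i j : Fin p) (μ : ℝ) :
    MeasurableSet (goodSet (n := n) Θ i j μ) := by
  have h : ∀ x y : Fin p → ℝ, MeasurableSet {X : Data n p | |x ⬝ᵥ (gram X - Θ⁻¹) *ᵥ y| ≤ μ} := by
    intro x y
    refine measurableSet_le ?_ measurable_const
    simp only [sub_mulVec, dotProduct_sub]
    exact ((measurable_gram x y).sub_const _).abs
  have e : goodSet (n := n) Θ i j μ =
      (⋂ k, ⋂ l, {X | |(Pi.single k 1 : Fin p → ℝ) ⬝ᵥ (gram X - Θ⁻¹) *ᵥ Pi.single l 1| ≤ μ}) ∩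
      ((⋂ k, {X | |(Pi.single k 1 : Fin p → ℝ) ⬝ᵥ (gram X - Θ⁻¹) *ᵥ Θ.col i| ≤ μ}) ∩
      ⋂ k, {X | |(Pi.single k 1 : Fin p → ℝ) ⬝ᵥ (gram X - Θ⁻¹) *ᵥ Θ.col j| ≤ μ}) := by
    ext X
    simp [goodSet]
  rw [e]
  exact (MeasurableSet.iInter fun k => MeasurableSet.iInter fun l => h _ _).inter
    ((MeasurableSet.iInter fun k => h _ _).inter (MeasurableSet.iInter fun k => h _ _))

theorem measure_compl_goodSet_le {n p : ℕ} (hn : 0 < n) {C₂ C₃ : ℝ} (hC₂ : 0 < C₂)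
    {Θ : Matrix (Fin p) (Fin p) ℝ} (hΘ : IsRegular C₂ C₃ Θ) (i j : Fin p) {μ : ℝ} (hμ : 0 ≤ μ)
    (hμB : μ ≤ 4 * C₂ * (1 + C₃ ^ 2)) :
    (dataLaw n Θ).real (goodSet Θ i j μ)ᶜ ≤
      12 * (p : ℝ) ^ 2 * Real.exp (-(n * μ ^ 2 / (4 * (4 * C₂ * (1 + C₃ ^ 2)) ^ 2))) := by
  set B := 4 * C₂ * (1 + C₃ ^ 2) with hB
  have hB0 : 0 < B := by positivity
  set e := Real.exp (-(n * μ ^ 2 / (4 * B ^ 2))) with he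
  set bad : (Fin p → ℝ) → (Fin p → ℝ) → Set (Data n p) :=
    fun x y => {X | μ ≤ |x ⬝ᵥ (gram X - Θ⁻¹) *ᵥ y|} with hbad
  have hsub : (goodSet Θ i j μ)ᶜ ⊆
      (⋃ k : Fin p, ⋃ l : Fin p, bad (Pi.single k 1) (Pi.single l 1)) ∪
        ((⋃ k : Fin p, bad (Pi.single k 1) (Θ.col i)) ∪
          ⋃ k : Fin p, bad (Pi.single k 1) (Θ.col j)) := by
    intro X hX
    by_contra hc
    simp only [Set.mem_union, Set.mem_iUnion, not_or, not_exists, hbad, Set.mem_ofPred_eq,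
      not_le] at hc
    refine hX ⟨fun k l => ?_, fun k => ?_, fun k => ?_⟩
    · simpa using (hc.1 k l).le
    · simpa using (hc.2.1 k).le
    · simpa using (hc.2.2 k).le
  have h1 : ∀ k l : Fin p, (dataLaw n Θ).real (bad (Pi.single k 1) (Pi.single l 1)) ≤ 4 * e :=
    fun k l => bilinear_tail hn hC₂ hΘ _ _ hB0 (by simp [hB]; nlinarith [sq_nonneg C₃]) hμ hμB
  have h2 : ∀ k l : Fin p, (dataLaw n Θ).real (bad (Pi.single k 1) (Θ.col l)) ≤ 4 * e :=
    fun k l => bilinear_tail hn hC₂ hΘ _ _ hB0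
      (by have := mul_le_mul_of_nonneg_left (hΘ.col_sq l) hC₂.le
          have := mul_nonneg hC₂.le (sq_nonneg C₃)
          simp only [single_one_dotProduct, Pi.single_eq_same, hB]; linarith) hμ hμB
  have h3 : ∀ l : Fin p, (dataLaw n Θ).real (⋃ k : Fin p, bad (Pi.single k 1) (Θ.col l)) ≤
      p * (4 * e) := fun l => by
    refine (measureReal_iUnion_fintype_le _).trans ((Finset.sum_le_sum fun k _ => h2 k l).trans ?_)
    simp
  have h4 : (dataLaw n Θ).real (⋃ k : Fin p, ⋃ l : Fin p, bad (Pi.single k 1) (Pi.single l 1)) ≤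
      p * (p * (4 * e)) := by
    refine (measureReal_iUnion_fintype_le _).trans ((Finset.sum_le_sum fun k _ =>
      (measureReal_iUnion_fintype_le _).trans (Finset.sum_le_sum fun l _ => h1 k l)).trans ?_)
    simp
  have hp : (1 : ℝ) ≤ p := by exact_mod_cast i.pos
  have he0 : 0 < e := Real.exp_pos _
  calc _ ≤ _ := measureReal_mono hsub
    _ ≤ _ := measureReal_union_le _ _
    _ ≤ p * (p * (4 * e)) + (p * (4 * e) + p * (4 * e)) :=
      add_le_add h4 ((measureReal_union_le _ _).trans (add_le_add (h3 i) (h3 j)))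
    _ ≤ _ := by nlinarith [mul_pos (by linarith : (0 : ℝ) < p) he0]

/-! ### Moments of the Gram matrix -/

/-- The `2k`-th moment of the standard normal distribution. -/
noncomputable def gaussMoment (k : ℕ) : ℝ := ∫ x, x ^ (2 * k) ∂(gaussianReal 0 1)

theorem gaussMoment_one : gaussMoment 1 = 1 := by
  have h := variance_fun_id_gaussianReal (μ := 0) (v := 1)
  rw [variance_of_integral_eq_zero (by fun_prop) (by simp)] at h
  simpa [gaussMoment] using h

theorem gaussMoment_two : gaussMoment 2 = 3 := integral_fourth_gaussian

theorem lin_pow_moment {p : ℕ} {Θ : Matrix (Fin p) (Fin p) ℝ} (hΘ : Θ.PosDef) (w : Fin p → ℝ)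
    (k : ℕ) :
    Integrable (fun x => lin w x ^ (2 * k)) (multivariateGaussian 0 Θ⁻¹) ∧
      ∫ x, lin w x ^ (2 * k) ∂(multivariateGaussian 0 Θ⁻¹) =
        (w ⬝ᵥ Θ⁻¹ *ᵥ w) ^ k * gaussMoment k := by
  have hV := hΘ.inv.posSemidef
  have hv0 : 0 ≤ w ⬝ᵥ Θ⁻¹ *ᵥ w := by simpa using hV.dotProduct_mulVec_nonneg w
  have hf : Measurable fun y : ℝ => y ^ (2 * k) := by fun_prop
  have e : ∀ g : ℝ, (√(w ⬝ᵥ Θ⁻¹ *ᵥ w) * g) ^ (2 * k) = (w ⬝ᵥ Θ⁻¹ *ᵥ w) ^ k * g ^ (2 * k) :=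
    fun g => by rw [mul_pow, pow_mul, Real.sq_sqrt hv0]
  constructor
  · rw [integrable_comp_lin hV w hf]
    simp only [e]
    exact (integrable_pow_gaussian _).const_mul _
  · rw [integral_comp_lin hV w hf]
    simp only [e]
    rw [integral_const_mul, gaussMoment]

theorem integral_comp_row {n p : ℕ} (Θ : Matrix (Fin p) (Fin p) ℝ) (r : Fin n)
    {f : EuclideanSpace ℝ (Fin p) → ℝ} (hf : Integrable f (multivariateGaussian 0 Θ⁻¹)) :
    Integrable (fun X : Data n p => f (X r)) (dataLaw n Θ) ∧
      ∫ X : Data n p, f (X r) ∂(dataLaw n Θ) = ∫ x, f x ∂(multivariateGaussian 0 Θ⁻¹) := by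
  have h := measurePreserving_eval (fun _ : Fin n => multivariateGaussian 0 Θ⁻¹) r
  have h' : Integrable f ((dataLaw n Θ).map (Function.eval r)) := by
    rw [dataLaw, h.map_eq]; exact hf
  refine ⟨h'.comp_measurable h.measurable, ?_⟩
  have h2 := integral_map (φ := Function.eval r) (μ := dataLaw n Θ) h.measurable.aemeasurable
    h'.aestronglyMeasurable
  rw [dataLaw, h.map_eq] at h2
  exact h2.symm

/-- Powers of the quadratic form of the Gram matrix are dominated by an average of even powers of
Gaussian variables, whose expectation is explicit. -/
theorem gram_pow_moment {n p : ℕ} (hn : 0 < n) {Θ : Matrix (Fin p) (Fin p) ℝ} (hΘ : Θ.PosDef)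
    (w : Fin p → ℝ) (k : ℕ) :
    Integrable (fun X => (w ⬝ᵥ gram X *ᵥ w) ^ (k + 1)) (dataLaw n Θ) ∧
      ∫ X, (w ⬝ᵥ gram X *ᵥ w) ^ (k + 1) ∂(dataLaw n Θ) ≤
        (w ⬝ᵥ Θ⁻¹ *ᵥ w) ^ (k + 1) * gaussMoment (k + 1) := by
  have hn' : (0 : ℝ) < n := Nat.cast_pos.2 hn
  have hle : ∀ X : Data n p, (w ⬝ᵥ gram X *ᵥ w) ^ (k + 1) ≤
      (∑ r, lin w (X r) ^ (2 * (k + 1))) / n := by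
    intro X
    have h := pow_sum_div_card_le_sum_pow (s := Finset.univ)
      (f := fun r : Fin n => lin w (X r) ^ 2) (fun _ _ => sq_nonneg _) k
    simp only [Finset.card_univ, Fintype.card_fin, ← pow_mul] at h
    rw [dotProduct_gram, div_pow, pow_succ (n : ℝ) k, ← div_div]
    simp only [← sq]
    exact div_le_div_of_nonneg_right h hn'.le
  have hm := lin_pow_moment hΘ w (k + 1)
  have hint : Integrable (fun X : Data n p => (∑ r, lin w (X r) ^ (2 * (k + 1))) / n)
      (dataLaw n Θ) :=
    (integrable_finsetSum _ fun r _ => (integral_comp_row Θ r hm.1).1).div_const _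
  have hnn : ∀ X : Data n p, 0 ≤ (w ⬝ᵥ gram X *ᵥ w) ^ (k + 1) :=
    fun X => pow_nonneg (gram_nonneg X w) _
  have hI : Integrable (fun X => (w ⬝ᵥ gram X *ᵥ w) ^ (k + 1)) (dataLaw n Θ) := by
    refine hint.mono' ((measurable_gram w w).pow_const _).aestronglyMeasurable
      (ae_of_all _ fun X => ?_)
    rw [Real.norm_of_nonneg (hnn X)]; exact hle X
  refine ⟨hI, (integral_mono hI hint hle).trans ?_⟩
  rw [integral_div, integral_finsetSum _ fun r _ => (integral_comp_row Θ r hm.1).1]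
  simp only [(integral_comp_row Θ _ hm.1).2, hm.2]
  simp [hn'.ne']

theorem gaussMoment_nonneg (k : ℕ) : 0 ≤ gaussMoment k :=
  integral_nonneg fun x => by simp only [Pi.zero_apply, pow_mul]; positivity

theorem gram_trace_pow_moment {n p : ℕ} (hn : 0 < n) {C₂ C₃ : ℝ}
    {Θ : Matrix (Fin p) (Fin p) ℝ} (hΘ : IsRegular C₂ C₃ Θ) (k : ℕ) :
    Integrable (fun X => (∑ m, gram X m m) ^ (k + 1)) (dataLaw n Θ) ∧
      ∫ X, (∑ m, gram X m m) ^ (k + 1) ∂(dataLaw n Θ) ≤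
        (p : ℝ) ^ (k + 1) * (C₂ ^ (k + 1) * gaussMoment (k + 1)) := by
  have hd : ∀ (X : Data n p) m, gram X m m =
      (Pi.single m 1 : Fin p → ℝ) ⬝ᵥ gram X *ᵥ Pi.single m 1 := fun X m => by simp
  have hd0 : ∀ (X : Data n p) m, 0 ≤ gram X m m := fun X m => by rw [hd]; exact gram_nonneg X _
  have hle : ∀ X : Data n p, (∑ m, gram X m m) ^ (k + 1) ≤
      (p : ℝ) ^ k * ∑ m, gram X m m ^ (k + 1) := by
    intro X
    rcases Nat.eq_zero_or_pos p with hp | hp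
    · subst hp; simp
    have hp' : (0 : ℝ) < p := Nat.cast_pos.2 hp
    have h := pow_sum_div_card_le_sum_pow (s := Finset.univ)
      (f := fun m : Fin p => gram X m m) (fun m _ => hd0 X m) k
    simp only [Finset.card_univ, Fintype.card_fin] at h
    rwa [div_le_iff₀ (by positivity), mul_comm] at h
  have hm := fun m : Fin p => gram_pow_moment hn hΘ.posDef (Pi.single m 1) k
  simp only [← hd] at hm
  have hint : Integrable (fun X : Data n p => (p : ℝ) ^ k * ∑ m, gram X m m ^ (k + 1))
      (dataLaw n Θ) := (integrable_finsetSum _ fun m _ => (hm m).1).const_mul _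
  have hmeas : Measurable fun X : Data n p => ∑ m, gram X m m :=
    Finset.measurable_sum _ fun m _ => by simp only [hd]; exact measurable_gram _ _
  have hI : Integrable (fun X => (∑ m, gram X m m) ^ (k + 1)) (dataLaw n Θ) := by
    refine hint.mono' (hmeas.pow_const _).aestronglyMeasurable (ae_of_all _ fun X => ?_)
    rw [Real.norm_of_nonneg (pow_nonneg (Finset.sum_nonneg fun m _ => hd0 X m) _)]
    exact hle X
  refine ⟨hI, (integral_mono hI hint hle).trans ?_⟩
  rw [integral_const_mul, integral_finsetSum _ fun m _ => (hm m).1, pow_succ (p : ℝ) k, mul_assoc]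
  refine mul_le_mul_of_nonneg_left ?_ (by positivity)
  have : ∀ m ∈ Finset.univ, ∫ X, gram X m m ^ (k + 1) ∂(dataLaw n Θ) ≤
      C₂ ^ (k + 1) * gaussMoment (k + 1) := fun m _ => by
    refine (hm m).2.trans (mul_le_mul_of_nonneg_right ?_ (gaussMoment_nonneg _))
    refine pow_le_pow_left₀ ?_ ?_ _
    · simpa using hΘ.posDef.inv.posSemidef.dotProduct_mulVec_nonneg (Pi.single m 1)
    · have := hΘ.upper (Pi.single m 1)
      simpa using this
  exact (Finset.sum_le_sum this).trans (by simp)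

theorem ae_row_ne_zero {n p : ℕ} {Θ : Matrix (Fin p) (Fin p) ℝ} (hΘ : Θ.PosDef) (j : Fin p) :
    ∀ᵐ X ∂(dataLaw n Θ), ∀ r, X r j ≠ 0 := by
  rw [ae_all_iff]
  intro r
  have h1 := measurePreserving_eval (fun _ : Fin n => multivariateGaussian 0 Θ⁻¹) r
  have h2 := measurePreserving_eval_multivariateGaussian (μ := (0 : EuclideanSpace ℝ (Fin p)))
    hΘ.inv.posSemidef (i := j)
  have hne : (Θ⁻¹ j j).toNNReal ≠ 0 := by
    simpa using hΘ.inv.diag_pos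
  have := nullSingletonClass_gaussianReal (μ := (0 : EuclideanSpace ℝ (Fin p)) j) hne
  have h3 : ∀ᵐ y ∂(gaussianReal ((0 : EuclideanSpace ℝ (Fin p)) j) (Θ⁻¹ j j).toNNReal), y ≠ 0 := by
    rw [ae_iff]; simp only [ne_eq, not_not]; exact measure_singleton _
  exact h1.quasiMeasurePreserving.ae (h2.quasiMeasurePreserving.ae h3)

/-- The expectation of `|N(0,1)|^(-1/2)`. -/
noncomputable def gaussInvSqrt : ℝ := ∫ x : ℝ, (√|x|)⁻¹ ∂(gaussianReal 0 1)

/-- Negative moments of a diagonal entry of the Gram matrix: `(∑ᵣ yᵣ²)⁻⁸` is dominated by a product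
of the integrable variables `|yᵣ|^(-1/2)` over any `32` of the observations. -/
theorem gram_inv_moment {n p : ℕ} (hn : 32 ≤ n) {C₂ C₃ : ℝ}
    {Θ : Matrix (Fin p) (Fin p) ℝ} (hΘ : IsRegular C₂ C₃ Θ) (j : Fin p) :
    Integrable (fun X => (gram X j j)⁻¹ ^ 8) (dataLaw n Θ) ∧
      ∫ X, (gram X j j)⁻¹ ^ 8 ∂(dataLaw n Θ) ≤ (n : ℝ) ^ 8 * (C₃ ^ 8 * gaussInvSqrt ^ 32) := by
  have hV := hΘ.posDef.inv.posSemidef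
  have hn' : (0 : ℝ) < n := by exact_mod_cast (by omega : 0 < n)
  set v := Θ⁻¹ j j with hv
  have hvpos : 0 < v := hΘ.posDef.inv.diag_pos
  have hve : (Pi.single j 1 : Fin p → ℝ) ⬝ᵥ Θ⁻¹ *ᵥ Pi.single j 1 = v := by simp [hv]
  set S : Finset (Fin n) := Finset.univ.map (Fin.castLEEmb hn) with hS
  have hcard : S.card = 32 := by simp [hS]
  set h : Fin n → EuclideanSpace ℝ (Fin p) → ℝ :=
    fun r x => if r ∈ S then (√|lin (Pi.single j 1) x|)⁻¹ else 1 with hh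
  have hlin : ∀ x : EuclideanSpace ℝ (Fin p), lin (Pi.single j 1) x = x j := fun x => by
    simp [lin, Pi.single_apply]
  have hf : Measurable fun y : ℝ => (√|y|)⁻¹ := by fun_prop
  have e : ∀ g : ℝ, (√|√v * g|)⁻¹ = (√√v)⁻¹ * (√|g|)⁻¹ := fun g => by
    rw [abs_mul, abs_of_nonneg (Real.sqrt_nonneg v), Real.sqrt_mul (Real.sqrt_nonneg v), mul_inv]
  have hint : ∀ r, Integrable (h r) (multivariateGaussian 0 Θ⁻¹) := by
    intro r
    by_cases hr : r ∈ S
    · simp only [hh, hr, if_true]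
      rw [integrable_comp_lin hV _ hf]
      simp only [hve, e]
      exact integrable_inv_sqrt_abs_gaussian.const_mul _
    · simp only [hh, hr, if_false]; exact integrable_const _
  have hval : ∀ r, ∫ x, h r x ∂(multivariateGaussian 0 Θ⁻¹) =
      if r ∈ S then (√√v)⁻¹ * gaussInvSqrt else 1 := by
    intro r
    by_cases hr : r ∈ S
    · simp only [hh, hr, if_true]
      rw [integral_comp_lin hV _ hf]
      simp only [hve, e]
      rw [integral_const_mul, gaussInvSqrt]
    · simp [hh, hr]
  have hI : Integrable (fun X : Data n p => (n : ℝ) ^ 8 * ∏ r, h r (X r)) (dataLaw n Θ) :=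
    (Integrable.fintype_prod hint).const_mul _
  have hle : ∀ᵐ X ∂(dataLaw n Θ), (gram X j j)⁻¹ ^ 8 ≤ (n : ℝ) ^ 8 * ∏ r, h r (X r) := by
    filter_upwards [ae_row_ne_zero (n := n) hΘ.posDef j] with X hX
    set s := ∑ r, X r j * X r j with hs
    have hspos : 0 < s := by
      refine Finset.sum_pos (fun r _ => mul_self_pos.2 (hX r)) ⟨⟨0, by omega⟩, Finset.mem_univ _⟩
    have hg : gram X j j = s / n := by simp [gram, hs]
    have hprod : s⁻¹ ^ 8 ≤ ∏ r, h r (X r) := by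
      have h1 : ∏ r, h r (X r) = ∏ r ∈ S, (√|X r j|)⁻¹ := by
        simp only [hh, hlin]
        rw [Finset.prod_ite_mem, Finset.univ_inter]
      have h2 : s⁻¹ ^ 8 = ∏ _r ∈ S, (√√s)⁻¹ := by
        rw [Finset.prod_const, hcard, show 32 = 2 * (2 * 8) by rfl, pow_mul, inv_pow (√√s),
          Real.sq_sqrt (Real.sqrt_nonneg s), pow_mul, inv_pow (√s), Real.sq_sqrt hspos.le]
      rw [h1, h2]
      refine Finset.prod_le_prod (fun _ _ => by positivity) fun r _ => ?_
      have h3 : |X r j| ≤ √s := by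
        refine Real.abs_le_sqrt ?_
        rw [sq]
        exact Finset.single_le_sum (f := fun r => X r j * X r j) (fun r _ => mul_self_nonneg _)
          (Finset.mem_univ r)
      exact inv_anti₀ (Real.sqrt_pos.2 (abs_pos.2 (hX r))) (Real.sqrt_le_sqrt h3)
    rw [hg, inv_div, div_pow, div_eq_mul_inv, ← inv_pow]
    exact mul_le_mul_of_nonneg_left hprod (by positivity)
  have hmeas : Measurable fun X : Data n p => (gram X j j)⁻¹ ^ 8 := by
    have := measurable_gram (n := n) (Pi.single j 1 : Fin p → ℝ) (Pi.single j 1)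
    simp only [mulVec_single_one, single_one_dotProduct, col_apply] at this
    exact this.inv.pow_const _
  have hI8 : Integrable (fun X => (gram X j j)⁻¹ ^ 8) (dataLaw n Θ) := by
    refine hI.mono' hmeas.aestronglyMeasurable (hle.mono fun X hX => ?_)
    rw [Real.norm_of_nonneg (by positivity)]; exact hX
  refine ⟨hI8, (integral_mono_ae hI8 hI hle).trans ?_⟩
  rw [integral_const_mul, dataLaw, integral_fintype_prod_eq_prod]
  refine mul_le_mul_of_nonneg_left ?_ (by positivity)
  simp only [hval]
  rw [Finset.prod_ite_mem, Finset.univ_inter, Finset.prod_const, hcard, mul_pow]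
  refine mul_le_mul_of_nonneg_right ?_ ?_
  · rw [show 32 = 2 * (2 * 8) by rfl, pow_mul, inv_pow, Real.sq_sqrt (Real.sqrt_nonneg v), pow_mul,
      inv_pow, Real.sq_sqrt hvpos.le]
    refine pow_le_pow_left₀ (inv_pos.2 hvpos).le ?_ 8
    rw [inv_le_iff_one_le_mul₀ hvpos]
    have := hΘ.lower (Pi.single j 1)
    rw [hve] at this
    simpa using this
  · exact Even.pow_nonneg (by decide) _

/-! ### The linear part -/

theorem lin_add {p : ℕ} (a b : Fin p → ℝ) (x : EuclideanSpace ℝ (Fin p)) :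
    lin (a + b) x = lin a x + lin b x := by
  simp [lin, add_mul, Finset.sum_add_distrib]

theorem lin_sub {p : ℕ} (a b : Fin p → ℝ) (x : EuclideanSpace ℝ (Fin p)) :
    lin (a - b) x = lin a x - lin b x := by
  simp [lin, sub_mul, Finset.sum_sub_distrib]

/-- Mean and variance of a bilinear form in one Gaussian observation, by polarisation. -/
theorem bilinear_moments {p : ℕ} {Θ : Matrix (Fin p) (Fin p) ℝ} (hΘ : Θ.PosDef)
    (a b : Fin p → ℝ) :
    MemLp (fun x => lin a x * lin b x) 2 (multivariateGaussian 0 Θ⁻¹) ∧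
      ∫ x, lin a x * lin b x ∂(multivariateGaussian 0 Θ⁻¹) = a ⬝ᵥ Θ⁻¹ *ᵥ b ∧
      variance (fun x => lin a x * lin b x) (multivariateGaussian 0 Θ⁻¹) =
        (a ⬝ᵥ Θ⁻¹ *ᵥ a) * (b ⬝ᵥ Θ⁻¹ *ᵥ b) + (a ⬝ᵥ Θ⁻¹ *ᵥ b) ^ 2 := by
  have hsymm : (Θ⁻¹)ᵀ = Θ⁻¹ := by
    have := hΘ.inv.isHermitian
    rwa [Matrix.IsHermitian, conjTranspose_eq_transpose_of_trivial] at this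
  have q1 := quadratic_add hsymm b a
  have q2 := quadratic_add hsymm b (-a)
  simp only [mulVec_neg, neg_dotProduct, dotProduct_neg, neg_neg] at q2
  rw [add_comm b a] at q1
  rw [show b + -a = -(a - b) by abel] at q2
  simp only [mulVec_neg, neg_dotProduct, dotProduct_neg, neg_neg] at q2
  have m := lin_pow_moment hΘ
  set P := multivariateGaussian (0 : EuclideanSpace ℝ (Fin p)) Θ⁻¹ with hP
  have hmeas : Measurable fun x => lin a x * lin b x := (measurable_lin a).mul (measurable_lin b)
  have e2 : (fun x => lin a x * lin b x) =
      fun x => (1 / 4 : ℝ) * (lin (a + b) x ^ (2 * 1) - lin (a - b) x ^ (2 * 1)) := by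
    ext x; rw [lin_add, lin_sub]; ring
  have e4 : (fun x => (lin a x * lin b x) ^ 2) =
      fun x => (1 / 12 : ℝ) * ((lin (a + b) x ^ (2 * 2) + lin (a - b) x ^ (2 * 2)) -
        (2 * lin a x ^ (2 * 2) + 2 * lin b x ^ (2 * 2))) := by
    ext x; rw [lin_add, lin_sub]; ring
  have i4 : Integrable (fun x => (lin a x * lin b x) ^ 2) P := by
    rw [e4]
    exact ((((m (a + b) 2).1.add (m (a - b) 2).1).sub
      (((m a 2).1.const_mul 2).add ((m b 2).1.const_mul 2))).const_mul _)
  have hL : MemLp (fun x => lin a x * lin b x) 2 P :=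
    (memLp_two_iff_integrable_sq hmeas.aestronglyMeasurable).2 i4
  have hmean : ∫ x, lin a x * lin b x ∂P = a ⬝ᵥ Θ⁻¹ *ᵥ b := by
    rw [e2, integral_const_mul, integral_sub (m _ 1).1 (m _ 1).1, (m _ 1).2, (m _ 1).2, q1, q2,
      gaussMoment_one]
    ring
  refine ⟨hL, hmean, ?_⟩
  rw [variance_eq_sub hL, hmean]
  have : ∫ x, ((fun x => lin a x * lin b x) ^ 2) x ∂P =
      (a ⬝ᵥ Θ⁻¹ *ᵥ a) * (b ⬝ᵥ Θ⁻¹ *ᵥ b) + 2 * (a ⬝ᵥ Θ⁻¹ *ᵥ b) ^ 2 := by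
    simp only [Pi.pow_apply]
    have s1 := integral_sub ((m (a + b) 2).1.add (m (a - b) 2).1)
      (((m a 2).1.const_mul 2).add ((m b 2).1.const_mul 2))
    simp only [Pi.add_apply] at s1
    rw [e4, integral_const_mul, s1, integral_add (m _ 2).1 (m _ 2).1,
      integral_add ((m a 2).1.const_mul 2) ((m b 2).1.const_mul 2),
      integral_const_mul, integral_const_mul, (m _ 2).2, (m _ 2).2,
      (m _ 2).2, (m _ 2).2, q1, q2, gaussMoment_two]
    ring
  rw [this]; ring

/-- The linear part of the de-sparsified estimator is unbiased with variance exactly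
`(Θ_ii Θ_jj + Θ_ij²) / n`. -/
theorem linear_part_moments {n p : ℕ} (hn : 0 < n) {Θ : Matrix (Fin p) (Fin p) ℝ} (hΘ : Θ.PosDef)
    (i j : Fin p) :
    MemLp (fun X : Data n p => 2 * Θ i j - Θ.col i ⬝ᵥ gram X *ᵥ Θ.col j) 2 (dataLaw n Θ) ∧
      ∫ X : Data n p, (2 * Θ i j - Θ.col i ⬝ᵥ gram X *ᵥ Θ.col j) ∂(dataLaw n Θ) = Θ i j ∧
      variance (fun X : Data n p => 2 * Θ i j - Θ.col i ⬝ᵥ gram X *ᵥ Θ.col j) (dataLaw n Θ) =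
        sigmaSq Θ i j / n := by
  have hn' : (0 : ℝ) < n := Nat.cast_pos.2 hn
  obtain ⟨h1, h2, h3⟩ := bilinear_moments hΘ (Θ.col i) (Θ.col j)
  have hd : ∀ k l, Θ.col k ⬝ᵥ Θ⁻¹ *ᵥ Θ.col l = Θ k l := fun k l => by
    rw [inv_mulVec_col hΘ]; simp [posDef_symm hΘ l k]
  rw [hd] at h2
  rw [hd, hd, hd] at h3
  set f : EuclideanSpace ℝ (Fin p) → ℝ := fun x => lin (Θ.col i) x * lin (Θ.col j) x with hf
  set Y : Data n p → ℝ := ∑ r, fun X : Data n p => f (X r) with hY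
  have hZ : (fun X : Data n p => 2 * Θ i j - Θ.col i ⬝ᵥ gram X *ᵥ Θ.col j) =
      fun X => 2 * Θ i j - (n : ℝ)⁻¹ * Y X := by
    ext X; rw [dotProduct_gram, hY, div_eq_inv_mul]; simp [hf]
  have hrow : ∀ r : Fin n, MemLp (fun X : Data n p => f (X r)) 2 (dataLaw n Θ) := fun r =>
    h1.comp_measurePreserving
      (measurePreserving_eval (fun _ : Fin n => multivariateGaussian 0 Θ⁻¹) r)
  have hYL : MemLp Y 2 (dataLaw n Θ) := by
    have := memLp_finsetSum' (s := Finset.univ) (f := fun (r : Fin n) (X : Data n p) => f (X r))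
      (fun r _ => hrow r)
    exact this
  have hYL' : MemLp (fun X => (n : ℝ)⁻¹ * Y X) 2 (dataLaw n Θ) := hYL.const_mul _
  have hYi : ∫ X, Y X ∂(dataLaw n Θ) = n * Θ i j := by
    have hr := fun r : Fin n => integral_comp_row Θ r (h1.integrable one_le_two)
    simp only [hY, Finset.sum_apply]
    rw [integral_finsetSum _ fun r _ => (hr r).1]
    simp only [(hr _).2, h2]
    simp
  have hYv : variance Y (dataLaw n Θ) = n * sigmaSq Θ i j := by
    rw [hY, dataLaw, variance_sum_pi fun _ => h1]
    simp only [h3]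
    simp [sigmaSq, mul_add]
  rw [hZ]
  refine ⟨(memLp_const _).sub hYL', ?_, ?_⟩
  · rw [integral_sub (integrable_const _) (hYL'.integrable one_le_two),
      integral_const_mul (n : ℝ)⁻¹ Y, hYi, integral_const, probReal_univ, one_smul,
      inv_mul_cancel_left₀ hn'.ne']
    ring
  · rw [variance_const_sub hYL'.aestronglyMeasurable, variance_const_mul, hYv]
    field_simp

/-! ### Moments of the remainder -/

theorem measurable_gram_apply {n p : ℕ} (k l : Fin p) :
    Measurable fun X : Data n p => gram X k l := by
  have := measurable_gram (n := n) (Pi.single k 1 : Fin p → ℝ) (Pi.single l 1)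
  simpa only [mulVec_single_one, single_one_dotProduct, col_apply] using this

theorem measurable_dotProduct_gram {n p : ℕ} {f g : Data n p → Fin p → ℝ}
    (hf : ∀ k, Measurable fun X => f X k) (hg : ∀ k, Measurable fun X => g X k) :
    Measurable fun X => f X ⬝ᵥ gram X *ᵥ g X := by
  simp only [dotProduct, mulVec]
  exact Finset.measurable_sum _ fun k _ => (hf k).mul
    (Finset.measurable_sum _ fun l _ => (measurable_gram_apply k l).mul (hg l))

theorem measurable_coef {n p : ℕ} {j : Fin p} {γ : Data n p → {k : Fin p // k ≠ j} → ℝ}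
    (hγ : Measurable γ) (k : Fin p) : Measurable fun X => coef j (γ X) k := by
  by_cases h : k = j
  · simp [coef, h]
  · simp only [coef, h, dite_false]
    exact ((measurable_pi_apply _).comp hγ).neg

theorem measurable_tauSq {n p : ℕ} {j : Fin p} {γ : Data n p → {k : Fin p // k ≠ j} → ℝ}
    (hγ : Measurable γ) (lam : ℝ) : Measurable fun X => tauSq X j lam (γ X) := by
  simp only [tauSq_eq]
  exact (measurable_dotProduct_gram (measurable_coef hγ) (measurable_coef hγ)).add
    ((Finset.measurable_sum _ fun k _ => (measurable_coef hγ k).abs).const_mul _)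

theorem measurable_desparsified {n p : ℕ} {lam : Fin p → ℝ}
    {γ : Data n p → ∀ j : Fin p, {k : Fin p // k ≠ j} → ℝ} {i j : Fin p}
    (hi : Measurable fun X => γ X i) (hj : Measurable fun X => γ X j) :
    Measurable fun X => desparsified X lam (γ X) i j := by
  have h : ∀ k, Measurable (fun X => γ X k) → ∀ l,
      Measurable fun X => ((tauSq X k (lam k) (γ X k))⁻¹ • coef k (γ X k)) l := fun k hk l =>
    (measurable_tauSq hk _).inv.mul (measurable_coef hk l)
  simp only [desparsified_eq, nodewise_col]
  exact ((h i hi j).add (h j hj i)).sub (measurable_dotProduct_gram (h i hi) (h j hj))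

theorem pow_four_sum_six_le {x : ℝ} {a b c d e f : ℝ} (h : |x| ≤ a + b + c + d + e + f) :
    x ^ 4 ≤ 216 * (a ^ 4 + b ^ 4 + c ^ 4 + d ^ 4 + e ^ 4 + f ^ 4) := by
  have h1 : x ^ 4 ≤ (a + b + c + d + e + f) ^ 4 := by
    rw [← Even.pow_abs (by decide : Even 4)]
    exact pow_le_pow_left₀ (abs_nonneg _) h 4
  have h2 : (a + b + c + d + e + f) ^ 2 ≤ 6 * (a ^ 2 + b ^ 2 + c ^ 2 + d ^ 2 + e ^ 2 + f ^ 2) := by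
    have := sq_sum_le_card_mul_sum_sq (s := Finset.univ) (f := ![a, b, c, d, e, f])
    simpa [Fin.sum_univ_succ, add_assoc] using this
  have h3 : (a ^ 2 + b ^ 2 + c ^ 2 + d ^ 2 + e ^ 2 + f ^ 2) ^ 2 ≤
      6 * (a ^ 4 + b ^ 4 + c ^ 4 + d ^ 4 + e ^ 4 + f ^ 4) := by
    have := sq_sum_le_card_mul_sum_sq (s := Finset.univ)
      (f := ![a ^ 2, b ^ 2, c ^ 2, d ^ 2, e ^ 2, f ^ 2])
    simpa [Fin.sum_univ_succ, add_assoc, ← pow_mul] using this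
  have h4 : (a + b + c + d + e + f) ^ 4 ≤
      (6 * (a ^ 2 + b ^ 2 + c ^ 2 + d ^ 2 + e ^ 2 + f ^ 2)) ^ 2 := by
    rw [show (a + b + c + d + e + f) ^ 4 = ((a + b + c + d + e + f) ^ 2) ^ 2 by ring]
    exact pow_le_pow_left₀ (sq_nonneg _) h2 2
  linarith

/-- An explicit integrable bound for the fourth power of the remainder. It holds for almost every
data set and grows only polynomially in `n`, `p` and `1 / λ`. -/
noncomputable def crudeBound {n p : ℕ} (C₃ ℓ : ℝ) (Θ : Matrix (Fin p) (Fin p) ℝ) (i j : Fin p)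
    (X : Data n p) : ℝ :=
  216 * ((2 * C₃ + 4 + 2 * ℓ) ^ 4 + (Θ.col i ⬝ᵥ gram X *ᵥ Θ.col i) ^ 4 +
    (Θ.col j ⬝ᵥ gram X *ᵥ Θ.col j) ^ 4 + 32768 * (1 + ℓ ^ 16 * (∑ m, gram X m m) ^ 8) +
    16 * (gram X i i)⁻¹ ^ 8 + 16 * (gram X j j)⁻¹ ^ 8)

/-- The alternative in `hlam` is `p = 1`, where `λ = 0` is allowed: there is nothing to penalise. -/
theorem remainder_pow_four_le {n p : ℕ} {C₂ C₃ : ℝ} {Θ : Matrix (Fin p) (Fin p) ℝ}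
    (hΘ : IsRegular C₂ C₃ Θ) {i j : Fin p} {lam : Fin p → ℝ} {ℓ : ℝ}
    (hlam : ∀ k, k = i ∨ k = j → (0 < lam k ∨ lam k = 0 ∧ Finset.univ.erase k = ∅) ∧ (lam k)⁻¹ ≤ ℓ)
    {X : Data n p} (γ : ∀ j : Fin p, {k : Fin p // k ≠ j} → ℝ) (hi : 0 < gram X i i)
    (hj : 0 < gram X j j) :
    (2 * Θ i j - Θ.col i ⬝ᵥ gram X *ᵥ Θ.col j - desparsified X lam γ i j) ^ 4 ≤
      crudeBound C₃ ℓ Θ i j X := by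
  have hG := gram_transpose X
  have hG0 := gram_nonneg X
  obtain ⟨hli, hℓi⟩ := hlam i (Or.inl rfl)
  obtain ⟨hlj, hℓj⟩ := hlam j (Or.inr rfl)
  have hT := abs_desparsified_le hG hG0 (i := i) (j := j) (coef_self i (γ i)) (coef_self j (γ j))
    hli hlj hℓi hℓj (tauSq_eq X i (lam i) (γ i)) (tauSq_eq X j (lam j) (γ j))
  have hti := inv_tau_le hG hG0 (coef_self i (γ i)) hli hℓi (tauSq_eq X i (lam i) (γ i)) hi
  have htj := inv_tau_le hG hG0 (coef_self j (γ j)) hlj hℓj (tauSq_eq X j (lam j) (γ j)) hj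
  have hTe : desparsified X lam γ i j = (tauSq X i (lam i) (γ i))⁻¹ * coef i (γ i) j +
      (tauSq X j (lam j) (γ j))⁻¹ * coef j (γ j) i -
      ((tauSq X i (lam i) (γ i))⁻¹ • coef i (γ i)) ⬝ᵥ gram X *ᵥ
        ((tauSq X j (lam j) (γ j))⁻¹ • coef j (γ j)) := by
    rw [desparsified_eq, nodewise_col, nodewise_col]; simp
  rw [← hTe] at hT
  have hab := abs_bilin_le hG hG0 (Θ.col i) (Θ.col j)
  have hΘij : |Θ i j| ≤ C₃ := by
    have h1 := hΘ.col_sq j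
    have h2 : Θ i j ^ 2 ≤ Θ.col j ⬝ᵥ Θ.col j := by
      have := Finset.single_le_sum (f := fun l => Θ.col j l * Θ.col j l)
        (fun l _ => mul_self_nonneg _) (Finset.mem_univ i)
      simpa [dotProduct, sq] using this
    have h3 : 0 ≤ C₃ := (hΘ.posDef.diag_pos (i := j)).le.trans (hΘ.diag_upper j)
    exact abs_le_of_sq_le_sq (h2.trans h1) h3
  set B := 1 + (∑ m, gram X m m) * ℓ ^ 2 with hB
  have hR : |2 * Θ i j - Θ.col i ⬝ᵥ gram X *ᵥ Θ.col j - desparsified X lam γ i j| ≤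
      (2 * C₃ + 4 + 2 * ℓ) + (Θ.col i ⬝ᵥ gram X *ᵥ Θ.col i) / 2 +
        (Θ.col j ⬝ᵥ gram X *ᵥ Θ.col j) / 2 + 4 * B ^ 2 + 2 * (gram X i i)⁻¹ ^ 2 +
        2 * (gram X j j)⁻¹ ^ 2 := by
    rw [abs_le] at hab hT hΘij ⊢
    constructor <;> linarith
  refine (pow_four_sum_six_le hR).trans ?_
  rw [crudeBound]
  have h8 : B ^ 8 ≤ 128 * (1 + ℓ ^ 16 * (∑ m, gram X m m) ^ 8) := by
    have htr : 0 ≤ ∑ m, gram X m m := Finset.sum_nonneg fun m _ => by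
      have := hG0 (Pi.single m 1); simpa using this
    have := add_pow_le (zero_le_one' ℝ) (mul_nonneg htr (sq_nonneg ℓ)) 8
    calc B ^ 8 ≤ _ := this
      _ = _ := by ring
  have hh : ∀ x : ℝ, 0 ≤ x → (x / 2) ^ 4 ≤ x ^ 4 := fun x hx =>
    pow_le_pow_left₀ (by linarith) (by linarith) 4
  have h1 := hh _ (hG0 (Θ.col i))
  have h2 := hh _ (hG0 (Θ.col j))
  have h3 : (4 * B ^ 2) ^ 4 = 256 * B ^ 8 := by ring
  have h4 : ∀ x : ℝ, (2 * x ^ 2) ^ 4 = 16 * x ^ 8 := fun x => by ring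
  rw [h3, h4, h4]
  linarith

theorem crudeBound_nonneg {n p : ℕ} (C₃ ℓ : ℝ) (Θ : Matrix (Fin p) (Fin p) ℝ) (i j : Fin p)
    (X : Data n p) : 0 ≤ crudeBound C₃ ℓ Θ i j X := by
  have : 0 ≤ ∑ m, gram X m m := Finset.sum_nonneg fun m _ => by
    have := gram_nonneg X (Pi.single m 1); simpa using this
  have e1 : (gram X i i)⁻¹ ^ 8 = ((gram X i i)⁻¹ ^ 4) ^ 2 := by ring
  have e2 : (gram X j j)⁻¹ ^ 8 = ((gram X j j)⁻¹ ^ 4) ^ 2 := by ring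
  rw [crudeBound, e1, e2]
  positivity

theorem crudeBound_moment {C₂ C₃ : ℝ} (hC₂ : 0 < C₂) (hC₃ : 0 < C₃) :
    ∃ K : ℝ, 0 < K ∧ ∀ (n p : ℕ) (Θ : Matrix (Fin p) (Fin p) ℝ) (i j : Fin p) (ℓ : ℝ), 32 ≤ n →
      IsRegular C₂ C₃ Θ → 1 ≤ ℓ → Integrable (crudeBound (n := n) C₃ ℓ Θ i j) (dataLaw n Θ) ∧
        ∫ X, crudeBound C₃ ℓ Θ i j X ∂(dataLaw n Θ) ≤ K * (ℓ ^ 16 * p ^ 8 * n ^ 8) := by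
  have hg := gaussMoment_nonneg
  refine ⟨216 * ((2 * C₃ + 6) ^ 4 + C₃ ^ 4 * gaussMoment 4 + C₃ ^ 4 * gaussMoment 4 +
    32768 * (1 + C₂ ^ 8 * gaussMoment 8) + 16 * (C₃ ^ 8 * gaussInvSqrt ^ 32) +
    16 * (C₃ ^ 8 * gaussInvSqrt ^ 32)), ?_, ?_⟩
  · have := hg 4
    have := hg 8
    have : gaussInvSqrt ^ 32 = (gaussInvSqrt ^ 16) ^ 2 := by ring
    rw [this]
    positivity
  intro n p Θ i j ℓ hn hΘ hℓ
  have hn0 : 0 < n := by omega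
  obtain ⟨a1, a2⟩ := gram_pow_moment hn0 hΘ.posDef (Θ.col i) 3
  obtain ⟨b1, b2⟩ := gram_pow_moment hn0 hΘ.posDef (Θ.col j) 3
  obtain ⟨t1, t2⟩ := gram_trace_pow_moment hn0 hΘ 7
  obtain ⟨i1, i2⟩ := gram_inv_moment hn hΘ i
  obtain ⟨j1, j2⟩ := gram_inv_moment hn hΘ j
  norm_num only at a1 a2 b1 b2 t1 t2
  have c1 : Integrable (fun X : Data n p => 32768 * (1 + ℓ ^ 16 * (∑ m, gram X m m) ^ 8))
      (dataLaw n Θ) := ((integrable_const _).add (t1.const_mul _)).const_mul _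
  have s0 : Integrable (fun _ : Data n p => (2 * C₃ + 4 + 2 * ℓ) ^ 4) (dataLaw n Θ) :=
    integrable_const _
  have s1 := s0.add a1
  have s2 := s1.add b1
  have s3 := s2.add c1
  have s4 := s3.add (i1.const_mul 16)
  have s5 := s4.add (j1.const_mul 16)
  refine ⟨s5.const_mul 216, ?_⟩
  have hval : ∫ X, crudeBound C₃ ℓ Θ i j X ∂(dataLaw n Θ) = 216 * ((2 * C₃ + 4 + 2 * ℓ) ^ 4 +
      ∫ X, (Θ.col i ⬝ᵥ gram X *ᵥ Θ.col i) ^ 4 ∂(dataLaw n Θ) +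
      ∫ X, (Θ.col j ⬝ᵥ gram X *ᵥ Θ.col j) ^ 4 ∂(dataLaw n Θ) +
      32768 * (1 + ℓ ^ 16 * ∫ X, (∑ m, gram X m m) ^ 8 ∂(dataLaw n Θ)) +
      16 * ∫ X, (gram X i i)⁻¹ ^ 8 ∂(dataLaw n Θ) +
      16 * ∫ X, (gram X j j)⁻¹ ^ 8 ∂(dataLaw n Θ)) := by
    have e5 := integral_add s4 (j1.const_mul 16)
    have e4 := integral_add s3 (i1.const_mul 16)
    have e3 := integral_add s2 c1
    have e2 := integral_add s1 b1
    have e1 := integral_add s0 a1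
    have e0 := integral_add (integrable_const (1 : ℝ)) (t1.const_mul (ℓ ^ 16))
    simp only [Pi.add_apply, integral_const_mul, integral_const, probReal_univ, one_smul]
      at e0 e1 e2 e3 e4 e5
    simp only [crudeBound]
    rw [integral_const_mul, e5, e4, e3, e2, e1, e0]
  rw [hval]
  have hd : ∀ k, Θ.col k ⬝ᵥ Θ⁻¹ *ᵥ Θ.col k = Θ k k := fun k => by
    rw [inv_mulVec_col hΘ.posDef]; simp
  have hdk : ∀ k, (Θ.col k ⬝ᵥ Θ⁻¹ *ᵥ Θ.col k) ^ 4 * gaussMoment 4 ≤ C₃ ^ 4 * gaussMoment 4 :=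
    fun k => by
      rw [hd]
      exact mul_le_mul_of_nonneg_right (pow_le_pow_left₀ (hΘ.posDef.diag_pos).le
        (hΘ.diag_upper k) 4) (hg 4)
  have hp1 : (1 : ℝ) ≤ p := by exact_mod_cast i.pos
  have hn1 : (1 : ℝ) ≤ n := by exact_mod_cast hn0
  have hp8 : (1 : ℝ) ≤ (p : ℝ) ^ 8 := one_le_pow₀ hp1
  have hn8 : (1 : ℝ) ≤ (n : ℝ) ^ 8 := one_le_pow₀ hn1
  have hℓ16 : 1 ≤ ℓ ^ 16 := one_le_pow₀ hℓ
  have hpn : 1 ≤ (p : ℝ) ^ 8 * (n : ℝ) ^ 8 := one_le_mul_of_one_le_of_one_le hp8 hn8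
  set E := ℓ ^ 16 * (p : ℝ) ^ 8 * (n : ℝ) ^ 8 with hE
  have hE1 : 1 ≤ E := by
    rw [hE, mul_assoc]; exact one_le_mul_of_one_le_of_one_le hℓ16 hpn
  have hEℓ : ℓ ^ 16 ≤ E := by
    rw [hE, mul_assoc]; exact le_mul_of_one_le_right (by positivity) hpn
  have hEn : (n : ℝ) ^ 8 ≤ E := by
    rw [hE]; exact le_mul_of_one_le_left (by positivity) (one_le_mul_of_one_le_of_one_le hℓ16 hp8)
  have hEp : ℓ ^ 16 * (p : ℝ) ^ 8 ≤ E := le_mul_of_one_le_right (by positivity) hn8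
  have g0 : (2 * C₃ + 4 + 2 * ℓ) ^ 4 ≤ (2 * C₃ + 6) ^ 4 * E := by
    have : 2 * C₃ + 4 + 2 * ℓ ≤ (2 * C₃ + 6) * ℓ := by nlinarith
    calc _ ≤ ((2 * C₃ + 6) * ℓ) ^ 4 := pow_le_pow_left₀ (by positivity) this 4
      _ = (2 * C₃ + 6) ^ 4 * ℓ ^ 4 := by ring
      _ ≤ (2 * C₃ + 6) ^ 4 * ℓ ^ 16 :=
        mul_le_mul_of_nonneg_left (pow_le_pow_right₀ hℓ (by norm_num)) (by positivity)
      _ ≤ _ := mul_le_mul_of_nonneg_left hEℓ (by positivity)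
  have hM : ∀ x : ℝ, 0 ≤ x → x ≤ x * E := fun x hx => le_mul_of_one_le_right hx hE1
  have g1 := (a2.trans (hdk i)).trans (hM _ (mul_nonneg (by positivity) (hg 4)))
  have g2 := (b2.trans (hdk j)).trans (hM _ (mul_nonneg (by positivity) (hg 4)))
  have g3 : ℓ ^ 16 * ∫ X, (∑ m, gram X m m) ^ 8 ∂(dataLaw n Θ) ≤ C₂ ^ 8 * gaussMoment 8 * E := by
    have h1 := mul_le_mul_of_nonneg_left t2 (by positivity : 0 ≤ ℓ ^ 16)
    have h2 := mul_le_mul_of_nonneg_left hEp (mul_nonneg (by positivity : 0 ≤ C₂ ^ 8) (hg 8))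
    linarith
  have hI : 0 ≤ C₃ ^ 8 * gaussInvSqrt ^ 32 :=
    mul_nonneg (by positivity) (Even.pow_nonneg (by decide) _)
  have g4 := i2.trans (mul_le_mul_of_nonneg_right hEn hI)
  have g5 := j2.trans (mul_le_mul_of_nonneg_right hEn hI)
  linarith

/-- A second moment is controlled by a deterministic bound on an event `A` and, off `A`, by the
fourth moment and the probability of `Aᶜ`. -/
theorem second_moment_split {Ω : Type*} [MeasurableSpace Ω] {P : Measure Ω} [IsProbabilityMeasure P]
    {R W : Ω → ℝ} {A : Set Ω} (hA : MeasurableSet A) (hR : Measurable R) (hW : Integrable W P)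
    (hW0 : ∀ ω, 0 ≤ W ω) (hle : ∀ᵐ ω ∂P, R ω ^ 4 ≤ W ω) {b ζ : ℝ} (hb : ∀ ω ∈ A, |R ω| ≤ b)
    (hζ : 0 < ζ) :
    MemLp R 2 P ∧ ∫ ω, R ω ^ 2 ∂P ≤ b ^ 2 + (ζ * ∫ ω, W ω ∂P + ζ⁻¹ * P.real Aᶜ) / 2 := by
  set F : Ω → ℝ := fun ω => b ^ 2 + (ζ * W ω + ζ⁻¹ * Aᶜ.indicator (fun _ => (1 : ℝ)) ω) / 2 with hF
  have hind : Integrable (Aᶜ.indicator fun _ => (1 : ℝ)) P :=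
    (integrable_const _).indicator hA.compl
  have hFi : Integrable F P :=
    (integrable_const _).add (((hW.const_mul _).add (hind.const_mul _)).div_const _)
  have hRF : ∀ᵐ ω ∂P, R ω ^ 2 ≤ F ω := by
    filter_upwards [hle] with ω h
    have h1 : 0 ≤ ζ * W ω := mul_nonneg hζ.le (hW0 ω)
    by_cases hω : ω ∈ A
    · have h2 : R ω ^ 2 ≤ b ^ 2 := by
        rw [← sq_abs]; exact pow_le_pow_left₀ (abs_nonneg _) (hb ω hω) 2
      simp only [hF, Set.mem_compl_iff, hω, not_true, not_false_eq_true, Set.indicator_of_notMem,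
        mul_zero, add_zero]
      linarith
    · simp only [hF, Set.mem_compl_iff, hω, not_false_eq_true, Set.indicator_of_mem, mul_one]
      have h2 : R ω ^ 2 ≤ (ζ * R ω ^ 4 + ζ⁻¹) / 2 := by
        have h3 : ζ * R ω ^ 4 + ζ⁻¹ - 2 * R ω ^ 2 = ζ * (R ω ^ 2 - ζ⁻¹) ^ 2 := by
          field_simp; ring
        have := mul_nonneg hζ.le (sq_nonneg (R ω ^ 2 - ζ⁻¹))
        linarith
      have h3 := mul_le_mul_of_nonneg_left h hζ.le
      have := sq_nonneg b
      linarith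
  have hRi : Integrable (fun ω => R ω ^ 2) P := by
    refine hFi.mono' (hR.pow_const 2).aestronglyMeasurable (hRF.mono fun ω h => ?_)
    rwa [Real.norm_of_nonneg (sq_nonneg _)]
  refine ⟨(memLp_two_iff_integrable_sq hR.aestronglyMeasurable).2 hRi, ?_⟩
  refine (integral_mono_ae hRi hFi hRF).trans (le_of_eq ?_)
  have e1 := integral_add (integrable_const (b ^ 2))
    (((hW.const_mul ζ).add (hind.const_mul ζ⁻¹)).div_const 2)
  have e2 := integral_add (hW.const_mul ζ) (hind.const_mul ζ⁻¹)
  simp only [Pi.add_apply] at e1 e2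
  simp only [hF]
  rw [e1, integral_div, e2, integral_const_mul, integral_const_mul,
    integral_indicator_const _ hA.compl]
  simp

/-- On the good event, the remainder of the de-sparsified estimator is of order `s L / n`. -/
theorem abs_remainder_le_on_goodSet {C₂ C₃ : ℝ} (hC₂ : 0 < C₂) (hC₃ : 0 < C₃) :
    ∃ K ε : ℝ, 0 < K ∧ 0 < ε ∧ ∀ (n p : ℕ) (Θ : Matrix (Fin p) (Fin p) ℝ) (i j : Fin p)
      (lam : Fin p → ℝ) (s μ Λ : ℝ) (X : Data n p) (γ : ∀ j : Fin p, {k : Fin p // k ≠ j} → ℝ),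
      IsRegular C₂ C₃ Θ →
      (∀ k, k = i ∨ k = j → IsNodewiseLasso X k (lam k) (γ k) ∧ 0 ≤ lam k ∧ lam k ≤ Λ) →
      ((p : ℝ) ≤ s ∨ ∀ k, k = i ∨ k = j →
        (l0 (Θ.col k) : ℝ) ≤ s ∧ 2 * (C₂ * μ) ≤ lam k ∧ 0 < lam k) →
      C₂ * μ ≤ Λ → μ ≤ Λ → Λ * s ≤ ε → X ∈ goodSet Θ i j μ →
      |2 * Θ i j - Θ.col i ⬝ᵥ gram X *ᵥ Θ.col j - desparsified X lam γ i j| ≤ K * (Λ ^ 2 * s) := by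
  obtain ⟨K, ε, hK, hε, H⟩ := nodewise_column_error hC₂ hC₃
  refine ⟨3 * K, ε, by positivity, hε, ?_⟩
  intro n p Θ i j lam s μ Λ X γ hΘ hlam hreg hμΛ hμΛ' hsε hX
  obtain ⟨hW, hWi, hWj⟩ := hX
  have hWk : ∀ k, k = i ∨ k = j → ∀ l, |((gram X - Θ⁻¹) *ᵥ Θ.col k) l| ≤ μ := by
    rintro k (rfl | rfl) <;> assumption
  have hcol : ∀ k, k = i ∨ k = j →
      ∑ l, |(nodewise X lam γ).col k l - Θ l k| ≤ K * Λ * s ∧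
      ((nodewise X lam γ).col k - Θ.col k) ⬝ᵥ gram X *ᵥ ((nodewise X lam γ).col k - Θ.col k) ≤
        K * Λ ^ 2 * s := by
    intro k hk
    obtain ⟨hγ, hl0, hlΛ⟩ := hlam k hk
    have hθ1 : ((Θ k k)⁻¹ • Θ.col k) k = 1 := by
      simp [(hΘ.posDef.diag_pos (i := k)).ne']
    rw [nodewise_col]
    have hmin := hγ.coef_le hθ1
    rcases hreg with hp | hsp
    · exact H p Θ (gram X) k (coef k (γ k)) Finset.univ s μ (lam k) Λ _ hΘ (gram_transpose X)
        (gram_nonneg X) (coef_self k _) hmin (tauSq_eq X k (lam k) (γ k)) (by simp)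
        (by simpa using hp)
        (Or.inl rfl) hl0 hlΛ hμΛ hμΛ' hW (hWk k hk) hsε
    · classical
      obtain ⟨h1, h2, h3⟩ := hsp k hk
      refine H p Θ (gram X) k (coef k (γ k)) (Finset.univ.filter fun l => Θ l k ≠ 0) s μ (lam k)
        Λ _ hΘ
        (gram_transpose X) (gram_nonneg X) (coef_self k _) hmin (tauSq_eq X k (lam k) (γ k))
        (by simp) ?_ (Or.inr ⟨h2, h3⟩) hl0 hlΛ hμΛ hμΛ' hW (hWk k hk) hsε
      refine le_trans (le_of_eq ?_) h1
      rw [l0, ← Set.ncard_coe_finset]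
      congr 2
      ext l; simp
  obtain ⟨hi1, hi2⟩ := hcol i (Or.inl rfl)
  obtain ⟨hj1, hj2⟩ := hcol j (Or.inr rfl)
  have hmain := abs_remainder_le (i := i) (j := j) (u := (nodewise X lam γ).col i)
    (v := (nodewise X lam γ).col j) hΘ.posDef (gram_transpose X) (gram_nonneg X) hWi hWj
  rw [← desparsified_eq] at hmain
  refine hmain.trans ?_
  have hμ0 : 0 ≤ μ := (abs_nonneg _).trans (hWi i)
  have hΛ0 : 0 ≤ Λ := hμ0.trans hμΛ'
  have a1 := mul_le_mul hμΛ' hi1 (Finset.sum_nonneg fun _ _ => abs_nonneg _) hΛ0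
  have a2 := mul_le_mul hμΛ' hj1 (Finset.sum_nonneg fun _ _ => abs_nonneg _) hΛ0
  linarith

/-- The penalty is bounded below, unless `p = 1`, in which case it vanishes and there is nothing
to penalise. -/
theorem inv_penalty_le {n p : ℕ} (hn : 0 < n) {a c₁ l : ℝ} (ha : 0 < a) {k : Fin p}
    (h1 : a * √(Real.log p / n) ≤ l) (h2 : l ≤ c₁ * √(Real.log p / n)) :
    (0 < l ∨ l = 0 ∧ Finset.univ.erase k = ∅) ∧ l⁻¹ ≤ (1 + (a * √(Real.log 2))⁻¹) * n := by
  have hn' : (0 : ℝ) < n := Nat.cast_pos.2 hn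
  have hn1 : (1 : ℝ) ≤ n := by exact_mod_cast hn
  have hlog2 : 0 < Real.log 2 := Real.log_pos (by norm_num)
  rcases Nat.lt_or_ge p 2 with hp | hp
  · have hp' : p = 1 := by have := k.pos; omega
    have hl : Real.log p = 0 := by simp [hp']
    have h0 : l = 0 := by
      rw [hl] at h1 h2
      simp only [zero_div, Real.sqrt_zero, mul_zero] at h1 h2
      exact le_antisymm h2 h1
    refine ⟨Or.inr ⟨h0, ?_⟩, ?_⟩
    · subst hp'
      ext m; simp [Subsingleton.elim m k]
    · rw [h0, _root_.inv_zero]; positivity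
  · have hp2 : (2 : ℝ) ≤ p := by exact_mod_cast hp
    have hl2 : Real.log 2 ≤ Real.log p := Real.log_le_log (by norm_num) hp2
    have hlow : a * √(Real.log 2) / n ≤ l := by
      refine le_trans ?_ h1
      rw [mul_div_assoc]
      refine mul_le_mul_of_nonneg_left ?_ ha.le
      rw [Real.sqrt_div' _ hn'.le]
      refine div_le_div₀ (Real.sqrt_nonneg _) (Real.sqrt_le_sqrt hl2) (Real.sqrt_pos.2 hn') ?_
      rw [Real.sqrt_le_left hn'.le]; nlinarith
    have hd : 0 < a * √(Real.log 2) / n := by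
      have := Real.sqrt_pos.2 hlog2
      positivity
    refine ⟨Or.inl (hd.trans_le hlow), ?_⟩
    refine (inv_anti₀ hd hlow).trans ?_
    rw [inv_div, div_eq_mul_inv, mul_comm]
    exact mul_le_mul_of_nonneg_right (by linarith) hn'.le

/-- With `n, p ≤ e^(8 L)`, a polynomially large fourth moment and an event of probability
`e^(-324 L)` (up to polynomial factors) are balanced by the weight `e^(-272 L)`. -/
theorem tail_bookkeeping {n p L k₀ K I P : ℝ} (hn : 0 < n) (hp : 0 ≤ p) (hL : 1 ≤ L)
    (hpL : p ≤ Real.exp (8 * L)) (hnL : n ≤ Real.exp (8 * L)) (hk₀ : 1 ≤ k₀) (hK : 0 ≤ K)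
    (hI : I ≤ K * ((k₀ * n) ^ 16 * p ^ 8 * n ^ 8))
    (hP : P ≤ 12 * p ^ 2 * Real.exp (-(324 * L))) :
    (Real.exp (-(272 * L)) * I + (Real.exp (-(272 * L)))⁻¹ * P) / 2 ≤
      (K * k₀ ^ 16 + 12) * (1 / n ^ 2) := by
  have hpow : ∀ (x : ℝ) (k : ℕ), 0 ≤ x → x ≤ Real.exp (8 * L) → x ^ k ≤ Real.exp (k * (8 * L)) :=
    fun x k h0 h => (pow_le_pow_left₀ h0 h k).trans (le_of_eq (Real.exp_nat_mul _ _).symm)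
  have hp8 := hpow p 8 hp hpL
  have hn24 := hpow n 24 hn.le hnL
  have hp2 := hpow p 2 hp hpL
  have hn2 := hpow n 2 hn.le hnL
  push_cast at hp8 hn24 hp2 hn2
  set E := Real.exp (-(16 * L)) with hE
  have hfin : E ≤ 1 / n ^ 2 := by
    rw [hE, Real.exp_neg, ← one_div]
    refine one_div_le_one_div_of_le (by positivity) (hn2.trans (Real.exp_le_exp.2 ?_))
    linarith
  have t1 : Real.exp (-(272 * L)) * I ≤ K * k₀ ^ 16 * E := by
    have h1 : (k₀ * n) ^ 16 * p ^ 8 * n ^ 8 ≤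
        k₀ ^ 16 * (Real.exp (8 * (8 * L)) * Real.exp (24 * (8 * L))) := by
      have e : (k₀ * n) ^ 16 * p ^ 8 * n ^ 8 = k₀ ^ 16 * (p ^ 8 * n ^ 24) := by ring
      rw [e]
      exact mul_le_mul_of_nonneg_left (mul_le_mul hp8 hn24 (by positivity) (Real.exp_pos _).le)
        (by positivity)
    have h2 := hI.trans (mul_le_mul_of_nonneg_left h1 hK)
    refine (mul_le_mul_of_nonneg_left h2 (Real.exp_pos _).le).trans (le_of_eq ?_)
    have h3 : E = Real.exp (-(272 * L)) * (Real.exp (8 * (8 * L)) * Real.exp (24 * (8 * L))) := by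
      rw [hE, ← Real.exp_add, ← Real.exp_add]; congr 1; ring
    rw [h3]; ring
  have t2 : (Real.exp (-(272 * L)))⁻¹ * P ≤ 12 * E := by
    rw [← Real.exp_neg, neg_neg]
    have h1 : 12 * p ^ 2 * Real.exp (-(324 * L)) ≤
        12 * Real.exp (2 * (8 * L)) * Real.exp (-(324 * L)) :=
      mul_le_mul_of_nonneg_right (by linarith) (Real.exp_pos _).le
    refine (mul_le_mul_of_nonneg_left (hP.trans h1) (Real.exp_pos _).le).trans ?_
    have h3 : Real.exp (272 * L) * (12 * Real.exp (2 * (8 * L)) * Real.exp (-(324 * L))) =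
        12 * Real.exp (-(36 * L)) := by
      have : Real.exp (-(36 * L)) =
          Real.exp (272 * L) * (Real.exp (2 * (8 * L)) * Real.exp (-(324 * L))) := by
        rw [← Real.exp_add, ← Real.exp_add]; congr 1; ring
      rw [this]; ring
    rw [h3]
    have : Real.exp (-(36 * L)) ≤ E := Real.exp_le_exp.2 (by linarith)
    linarith
  have t4 := mul_le_mul_of_nonneg_left hfin (by positivity : 0 ≤ K * k₀ ^ 16 + 12)
  have p3 : 0 ≤ (K * k₀ ^ 16 + 12) * E := by positivity
  linarith

/-- The second moment of the remainder, non-asymptotically. Either the whole vector counts as the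
support (`p ≤ s`), or `L = log p` and the columns are `s`-sparse; in both cases `L` dominates
`log n` and `log p` up to a constant. -/
theorem remainder_second_moment {C₂ C₃ : ℝ} (hC₂ : 0 < C₂) (hC₃ : 0 < C₃) :
    ∃ c₀ : ℝ, 0 < c₀ ∧ ∀ c₁ : ℝ, ∃ K ε : ℝ, 0 < K ∧ 0 < ε ∧
      ∀ (n p : ℕ) (Θ : Matrix (Fin p) (Fin p) ℝ) (i j : Fin p) (lam : Fin p → ℝ) (s L : ℝ)
        (γ : Data n p → ∀ j : Fin p, {k : Fin p // k ≠ j} → ℝ), 32 ≤ n → IsRegular C₂ C₃ Θ →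
      1 ≤ L → (p : ℝ) ≤ Real.exp (8 * L) → (n : ℝ) ≤ Real.exp (8 * L) → Real.log p ≤ L → 1 ≤ s →
      ((p : ℝ) ≤ s ∨ L = Real.log p ∧ ∀ k, k = i ∨ k = j → (l0 (Θ.col k) : ℝ) ≤ s) →
      (∀ k, k = i ∨ k = j → c₀ * √(Real.log p / n) ≤ lam k ∧ lam k ≤ c₁ * √(Real.log p / n)) →
      (∀ k, k = i ∨ k = j → Measurable (fun X => γ X k) ∧
        ∀ X, IsNodewiseLasso X k (lam k) (γ X k)) →
      √(L / n) * s ≤ ε →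
      MemLp (fun X => 2 * Θ i j - Θ.col i ⬝ᵥ gram X *ᵥ Θ.col j - desparsified X lam (γ X) i j) 2
        (dataLaw n Θ) ∧
      ∫ X, (2 * Θ i j - Θ.col i ⬝ᵥ gram X *ᵥ Θ.col j - desparsified X lam (γ X) i j) ^ 2
        ∂(dataLaw n Θ) ≤ K * ((L / n * s) ^ 2 + 1 / (n : ℝ) ^ 2) := by
  obtain ⟨K₁, ε₁, hK₁, hε₁, H₁⟩ := abs_remainder_le_on_goodSet hC₂ hC₃
  obtain ⟨K₂, hK₂, H₂⟩ := crudeBound_moment hC₂ hC₃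
  set B := 4 * C₂ * (1 + C₃ ^ 2) with hB
  have hB0 : 0 < B := by positivity
  -- the level `36 B √(L / n)` of the good event makes its complement have probability `e^(-324 L)`
  set A := 36 * B with hA
  have hA0 : 0 < A := by positivity
  refine ⟨2 * (C₂ * A), by positivity, fun c₁ => ?_⟩
  set κ := |c₁| + A * (1 + C₂) with hκ
  have hκ0 : 0 < κ := by positivity
  have hlog2 : 0 < Real.log 2 := Real.log_pos (by norm_num)
  set k₀ := 1 + (2 * (C₂ * A) * √(Real.log 2))⁻¹ with hk₀
  have hk₀1 : 1 ≤ k₀ := by rw [hk₀]; have : 0 ≤ (2 * (C₂ * A) * √(Real.log 2))⁻¹ := by positivity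
                           linarith
  refine ⟨(K₁ * κ ^ 2) ^ 2 + (K₂ * k₀ ^ 16 + 12), min (1 / 36) (ε₁ / κ), by positivity,
    by positivity, ?_⟩
  intro n p Θ i j lam s L γ hn hΘ hL hpL hnL hlogL hs1 hreg hlam hγ hε
  have hn0 : 0 < n := by omega
  have hn' : (0 : ℝ) < n := Nat.cast_pos.2 hn0
  have hn1 : (1 : ℝ) ≤ n := by exact_mod_cast hn0
  have hp1 : (1 : ℝ) ≤ p := by exact_mod_cast i.pos
  have hlogp : 0 ≤ Real.log p := Real.log_nonneg hp1
  set q := √(L / n) with hq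
  have hq0 : 0 ≤ q := Real.sqrt_nonneg _
  have hqq : q ^ 2 = L / n := Real.sq_sqrt (by positivity)
  have hqp : √(Real.log p / n) ≤ q := Real.sqrt_le_sqrt (div_le_div_of_nonneg_right hlogL hn'.le)
  have hqs : q ≤ q * s := le_mul_of_one_le_right hq0 hs1
  have hq36 : 36 * q ≤ 1 := by
    have := (hqs.trans hε).trans (min_le_left _ _); linarith
  set μ := A * q with hμ
  have hμ0 : 0 ≤ μ := by positivity
  have hμB : μ ≤ B := by rw [hμ, hA]; nlinarith
  set Λ := κ * q with hΛ
  have hlam0 : ∀ k, k = i ∨ k = j → 0 ≤ lam k := fun k hk =>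
    (by positivity : 0 ≤ 2 * (C₂ * A) * √(Real.log p / n)).trans (hlam k hk).1
  have hlamΛ : ∀ k, k = i ∨ k = j → lam k ≤ Λ := fun k hk => by
    calc lam k ≤ c₁ * √(Real.log p / n) := (hlam k hk).2
      _ ≤ |c₁| * √(Real.log p / n) :=
        mul_le_mul_of_nonneg_right (le_abs_self _) (Real.sqrt_nonneg _)
      _ ≤ |c₁| * q := mul_le_mul_of_nonneg_left hqp (abs_nonneg _)
      _ ≤ κ * q := mul_le_mul_of_nonneg_right
        (by rw [hκ]; have : 0 ≤ A * (1 + C₂) := by positivity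
            linarith) hq0
  have hμΛ : μ ≤ Λ := mul_le_mul_of_nonneg_right
    (by rw [hκ]; have := abs_nonneg c₁; have := mul_pos hA0 hC₂; linarith) hq0
  have hμΛ' : C₂ * μ ≤ Λ := by
    rw [hμ, hΛ, ← mul_assoc]
    exact mul_le_mul_of_nonneg_right (by rw [hκ]; have := abs_nonneg c₁; linarith) hq0
  have hΛs : Λ * s ≤ ε₁ := by
    have := hε.trans (min_le_right _ _)
    rw [le_div_iff₀ hκ0] at this
    rw [hΛ]; linarith
  have hpos_of_L : L = Real.log p → ∀ k, k = i ∨ k = j → 2 * (C₂ * μ) ≤ lam k ∧ 0 < lam k := by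
    intro hLp k hk
    have h1 := (hlam k hk).1
    rw [← hLp] at h1
    have h2 : 2 * (C₂ * μ) ≤ lam k := by rw [hμ]; linarith
    have hq' : 0 < q := Real.sqrt_pos.2 (by positivity)
    exact ⟨h2, lt_of_lt_of_le (by positivity) h2⟩
  have hcrude : ∀ k, k = i ∨ k = j →
      (0 < lam k ∨ lam k = 0 ∧ Finset.univ.erase k = ∅) ∧ (lam k)⁻¹ ≤ k₀ * n := fun k hk =>
    inv_penalty_le hn0 (by positivity) (hlam k hk).1 (hlam k hk).2
  set T : Data n p → ℝ := fun X => desparsified X lam (γ X) i j with hT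
  have hmeas : Measurable fun X => 2 * Θ i j - Θ.col i ⬝ᵥ gram X *ᵥ Θ.col j - T X :=
    ((measurable_gram _ _).const_sub _).sub
      (measurable_desparsified (hγ i (Or.inl rfl)).1 (hγ j (Or.inr rfl)).1)
  obtain ⟨hWi, hWle⟩ := H₂ n p Θ i j (k₀ * n) hn hΘ (one_le_mul_of_one_le_of_one_le hk₀1 hn1)
  have hae : ∀ᵐ X ∂(dataLaw n Θ),
      (2 * Θ i j - Θ.col i ⬝ᵥ gram X *ᵥ Θ.col j - T X) ^ 4 ≤ crudeBound C₃ (k₀ * n) Θ i j X := by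
    filter_upwards [ae_row_ne_zero (n := n) hΘ.posDef i, ae_row_ne_zero (n := n) hΘ.posDef j]
      with X h1 h2
    have hpos : ∀ k : Fin p, (∀ r, X r k ≠ 0) → 0 < gram X k k := fun k hk => by
      simp only [gram, of_apply]
      exact div_pos (Finset.sum_pos (fun r _ => mul_self_pos.2 (hk r))
        ⟨⟨0, hn0⟩, Finset.mem_univ _⟩) hn'
    exact remainder_pow_four_le hΘ hcrude (γ X) (hpos i h1) (hpos j h2)
  have hgood : ∀ X ∈ goodSet (n := n) Θ i j μ,
      |2 * Θ i j - Θ.col i ⬝ᵥ gram X *ᵥ Θ.col j - T X| ≤ K₁ * (Λ ^ 2 * s) := by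
    intro X hX
    refine H₁ n p Θ i j lam s μ Λ X (γ X) hΘ
      (fun k hk => ⟨(hγ k hk).2 X, hlam0 k hk, hlamΛ k hk⟩) ?_ hμΛ' hμΛ hΛs hX
    rcases hreg with h | ⟨h1, h2⟩
    · exact Or.inl h
    · exact Or.inr fun k hk => ⟨h2 k hk, hpos_of_L h1 k hk⟩
  obtain ⟨hM, hI⟩ := second_moment_split (measurableSet_goodSet Θ i j μ) hmeas hWi
    (crudeBound_nonneg _ _ _ _ _) hae hgood (Real.exp_pos (-(272 * L)))
  refine ⟨hM, hI.trans ?_⟩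
  have hbad := measure_compl_goodSet_le hn0 hC₂ hΘ i j hμ0 hμB
  have hexpo : (n : ℝ) * μ ^ 2 / (4 * B ^ 2) = 324 * L := by
    rw [hμ, mul_pow, hqq, hA]; field_simp; ring
  rw [← hB, hexpo] at hbad
  have hsplit := tail_bookkeeping hn' (by linarith : (0 : ℝ) ≤ p) hL hpL hnL hk₀1 hK₂.le hWle hbad
  have t3 : (K₁ * (Λ ^ 2 * s)) ^ 2 = (K₁ * κ ^ 2) ^ 2 * (L / n * s) ^ 2 := by
    rw [hΛ, mul_pow κ q, hqq]; ring
  rw [t3]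
  have p1 : 0 ≤ (K₁ * κ ^ 2) ^ 2 * (1 / (n : ℝ) ^ 2) := by positivity
  have p2 : 0 ≤ (K₂ * k₀ ^ 16 + 12) * (L / n * s) ^ 2 := by positivity
  linarith

/-! ### From the remainder to bias and variance -/

/-- Cauchy–Schwarz for integrals. -/
theorem sq_integral_mul_le {Ω : Type*} [MeasurableSpace Ω] {P : Measure Ω} {f g : Ω → ℝ}
    (hf : MemLp f 2 P) (hg : MemLp g 2 P) :
    (∫ ω, f ω * g ω ∂P) ^ 2 ≤ (∫ ω, f ω ^ 2 ∂P) * ∫ ω, g ω ^ 2 ∂P := by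
  have hfg : Integrable (fun ω => f ω * g ω) P := hf.integrable_mul hg
  have h : ∀ t : ℝ, 0 ≤ (∫ ω, g ω ^ 2 ∂P) * (t * t) + 2 * (∫ ω, f ω * g ω ∂P) * t +
      ∫ ω, f ω ^ 2 ∂P := by
    intro t
    have e : ∫ ω, (f ω + t * g ω) ^ 2 ∂P = (∫ ω, g ω ^ 2 ∂P) * (t * t) +
        2 * (∫ ω, f ω * g ω ∂P) * t + ∫ ω, f ω ^ 2 ∂P := by
      have e1 : ∀ ω, (f ω + t * g ω) ^ 2 = t * t * g ω ^ 2 + 2 * t * (f ω * g ω) + f ω ^ 2 :=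
        fun ω => by ring
      have e2 := integral_add ((hg.integrable_sq.const_mul (t * t)).add (hfg.const_mul (2 * t)))
        hf.integrable_sq
      have e3 := integral_add (hg.integrable_sq.const_mul (t * t)) (hfg.const_mul (2 * t))
      simp only [Pi.add_apply] at e2 e3
      simp only [e1]
      rw [e2, e3, integral_const_mul, integral_const_mul]; ring
    rw [← e]; exact integral_nonneg fun ω => sq_nonneg _
  have := discrim_le_zero h
  rw [discrim] at this
  linarith

theorem abs_integral_le_sqrt {Ω : Type*} [MeasurableSpace Ω] {P : Measure Ω}
    [IsProbabilityMeasure P] {R : Ω → ℝ} (hR : MemLp R 2 P) {q : ℝ}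
    (hq : ∫ ω, R ω ^ 2 ∂P ≤ q) : |∫ ω, R ω ∂P| ≤ √q := by
  have h := sq_integral_mul_le hR (memLp_const (1 : ℝ))
  simp only [mul_one, one_pow, integral_const, probReal_univ, one_smul] at h
  exact Real.abs_le_sqrt (h.trans hq)

theorem abs_variance_sub_le {Ω : Type*} [MeasurableSpace Ω] {P : Measure Ω}
    [IsProbabilityMeasure P] {Z R : Ω → ℝ} (hZ : MemLp Z 2 P) (hR : MemLp R 2 P) {q : ℝ}
    (hq : ∫ ω, R ω ^ 2 ∂P ≤ q) :
    |variance (fun ω => Z ω - R ω) P - variance Z P| ≤ q + 2 * √(variance Z P * q) := by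
  have hZ' : MemLp (fun ω => Z ω - ∫ x, Z x ∂P) 2 P := hZ.sub (memLp_const _)
  have hR' : MemLp (fun ω => R ω - ∫ x, R x ∂P) 2 P := hR.sub (memLp_const _)
  have hT : MemLp (fun ω => Z ω - R ω) 2 P := hZ.sub hR
  have vZ := variance_eq_integral hZ.aemeasurable
  have vR := variance_eq_integral hR.aemeasurable
  have vT := variance_eq_integral hT.aemeasurable
  set c := ∫ ω, (Z ω - ∫ x, Z x ∂P) * (R ω - ∫ x, R x ∂P) ∂P with hc
  have hcs := sq_integral_mul_le hZ' hR'
  rw [← vZ, ← vR, ← hc] at hcs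
  have hexp : variance (fun ω => Z ω - R ω) P = variance Z P + variance R P - 2 * c := by
    rw [vT, vZ, vR, integral_sub (hZ.integrable one_le_two) (hR.integrable one_le_two), hc]
    have e : ∀ ω, (Z ω - R ω - ((∫ x, Z x ∂P) - ∫ x, R x ∂P)) ^ 2 =
        (Z ω - ∫ x, Z x ∂P) ^ 2 + (R ω - ∫ x, R x ∂P) ^ 2 -
          2 * ((Z ω - ∫ x, Z x ∂P) * (R ω - ∫ x, R x ∂P)) := fun ω => by ring
    simp only [e]
    have e1 := integral_sub (hZ'.integrable_sq.add hR'.integrable_sq)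
      ((hZ'.integrable_mul hR').const_mul 2)
    have e2 := integral_add hZ'.integrable_sq hR'.integrable_sq
    simp only [Pi.add_apply, Pi.mul_apply] at e1 e2
    rw [e1, e2, integral_const_mul]
  have hvR : variance R P ≤ q := (variance_le_expectation_sq hR.aestronglyMeasurable).trans hq
  have hvR0 := variance_nonneg R P
  have hvZ0 := variance_nonneg Z P
  have hcabs : |c| ≤ √(variance Z P * q) :=
    Real.abs_le_sqrt (hcs.trans (mul_le_mul_of_nonneg_left hvR hvZ0))
  rw [hexp]
  rw [abs_le] at hcabs ⊢
  constructor <;> linarith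

/-! ### The two asymptotic regimes -/

/-- The logarithmic scale: `log n` in the low-dimensional regime `p⁸ ≤ n`, `log p` otherwise. -/
noncomputable def logScale (n p : ℕ) : ℝ := if p ^ 8 ≤ n then Real.log n else Real.log p

/-- The effective sparsity: `p` in the low-dimensional regime `p⁸ ≤ n`, and `s` otherwise. -/
noncomputable def effSparsity (n p : ℕ) (s : ℝ) : ℝ := if p ^ 8 ≤ n then (p : ℝ) else s

/-- In both regimes `n` and `p` are polynomially bounded in `exp (logScale n p)`. -/
theorem logScale_properties {n p : ℕ} (hn : 8 ≤ Real.log n) (hp : 0 < p) :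
    1 ≤ logScale n p ∧ (p : ℝ) ≤ Real.exp (8 * logScale n p) ∧
      (n : ℝ) ≤ Real.exp (8 * logScale n p) ∧ Real.log p ≤ logScale n p := by
  have hn0 : 0 < n := by
    rcases Nat.eq_zero_or_pos n with h | h
    · simp [h] at hn; linarith
    · exact h
  have hn' : (0 : ℝ) < n := Nat.cast_pos.2 hn0
  have hp' : (0 : ℝ) < p := Nat.cast_pos.2 hp
  have hlogp : 0 ≤ Real.log p := Real.log_nonneg (by exact_mod_cast hp)
  have h8 : Real.log ((p : ℝ) ^ 8) = 8 * Real.log p := by rw [Real.log_pow]; norm_num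
  unfold logScale
  split_ifs with h
  · have hle : 8 * Real.log p ≤ Real.log n := by
      rw [← h8]; exact Real.log_le_log (by positivity) (by exact_mod_cast h)
    refine ⟨by linarith, ?_, ?_, by linarith⟩
    · rw [← Real.log_le_iff_le_exp hp']; linarith
    · rw [← Real.log_le_iff_le_exp hn']; linarith
  · push Not at h
    have hle : Real.log n ≤ 8 * Real.log p := by
      rw [← h8]; exact Real.log_le_log hn' (by exact_mod_cast h.le)
    refine ⟨by linarith, ?_, ?_, le_rfl⟩
    · rw [← Real.log_le_iff_le_exp hp']; linarith
    · rw [← Real.log_le_iff_le_exp hn']; linarith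

/-- In the low-dimensional regime `p log n ≤ n^(1/8) log n = o(√n)`, so that no sparsity is
needed. -/
theorem tendsto_scale {p : ℕ → ℕ} {s : ℕ → ℝ} (hs : ∀ n, 0 ≤ s n)
    (h : Tendsto (fun n => s n * Real.log (p n) / √(n : ℝ)) atTop (𝓝 0)) :
    Tendsto (fun n => logScale n (p n) * effSparsity n (p n) (s n) / √(n : ℝ)) atTop (𝓝 0) := by
  have hlog : Tendsto (fun n : ℕ => Real.log n / (n : ℝ) ^ (3 / 8 : ℝ)) atTop (𝓝 0) :=
    ((isLittleO_log_rpow_atTop (by norm_num : (0 : ℝ) < 3 / 8)).tendsto_div_nhds_zero).comp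
      tendsto_natCast_atTop_atTop
  have hsum := hlog.add h
  rw [add_zero] at hsum
  refine squeeze_zero' ?_ ?_ hsum
  · filter_upwards with n
    unfold logScale effSparsity
    have h1 : 0 ≤ Real.log n := Real.log_natCast_nonneg n
    have h2 : 0 ≤ Real.log (p n) := Real.log_natCast_nonneg _
    have := hs n
    split_ifs <;> positivity
  · filter_upwards [eventually_gt_atTop 0] with n hn
    have hn' : (0 : ℝ) < n := Nat.cast_pos.2 hn
    have h1 : 0 ≤ Real.log n := Real.log_natCast_nonneg n
    have h2 : 0 ≤ Real.log (p n) := Real.log_natCast_nonneg _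
    have h3 := hs n
    have ha : 0 ≤ Real.log n / (n : ℝ) ^ (3 / 8 : ℝ) := by positivity
    have hb : 0 ≤ s n * Real.log (p n) / √(n : ℝ) := by positivity
    unfold logScale effSparsity
    split_ifs with hp
    · have hp8 : (p n : ℝ) ≤ (n : ℝ) ^ (1 / 8 : ℝ) := by
        have : ((p n : ℝ) ^ (8 : ℕ)) ≤ n := by exact_mod_cast hp
        have h4 := Real.rpow_le_rpow (by positivity) this (by norm_num : (0 : ℝ) ≤ 1 / 8)
        rwa [← Real.rpow_natCast, ← Real.rpow_mul (by positivity),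
          show ((8 : ℕ) : ℝ) * (1 / 8) = 1 by
          norm_num, Real.rpow_one] at h4
      have h5 : Real.log n * p n / √(n : ℝ) ≤ Real.log n / (n : ℝ) ^ (3 / 8 : ℝ) := by
        rw [div_le_div_iff₀ (Real.sqrt_pos.2 hn') (by positivity), mul_assoc]
        refine mul_le_mul_of_nonneg_left ?_ h1
        calc (p n : ℝ) * (n : ℝ) ^ (3 / 8 : ℝ) ≤ (n : ℝ) ^ (1 / 8 : ℝ) * (n : ℝ) ^ (3 / 8 : ℝ) :=
              mul_le_mul_of_nonneg_right hp8 (by positivity)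
          _ = √(n : ℝ) := by
            rw [← Real.rpow_add hn', Real.sqrt_eq_rpow]; norm_num
      linarith
    · rw [mul_comm (Real.log _)]; linarith

theorem one_le_l0 {p : ℕ} {Θ : Matrix (Fin p) (Fin p) ℝ} (hΘ : Θ.PosDef) (k : Fin p) :
    (1 : ℝ) ≤ l0 (Θ.col k) := by
  have : 0 < l0 (Θ.col k) := by
    rw [l0, Set.ncard_pos]
    exact ⟨k, (hΘ.diag_pos (i := k)).ne'⟩
  exact_mod_cast this

/-- The remainder of the de-sparsified estimator is negligible, uniformly over the class. -/
theorem exists_uniform_remainder_bound {C₁ C₂ C₃ : ℝ} (hC₁ : 0 < C₁) (hC₂ : 0 < C₂) (hC₃ : 0 < C₃) :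
    ∃ c₀ : ℝ, 0 < c₀ ∧
      ∀ (p : ℕ → ℕ) (i j : ∀ n, Fin (p n)) (d : ∀ n, Fin (p n) → ℝ)
        (S : ∀ n, Set (Matrix (Fin (p n)) (Fin (p n)) ℝ)),
        (∀ n, (precisionClass (S n) C₁ C₂ C₃ (d n)).Nonempty) →
        ((fun n => max (d n (i n)) (d n (j n)) * Real.log (p n)) =o[atTop]
          fun n : ℕ => √(n : ℝ)) →
        ∀ (lam : ∀ n, Fin (p n) → ℝ) (c₁ : ℝ)
          (γ : ∀ n, Data n (p n) → ∀ k : Fin (p n), {l : Fin (p n) // l ≠ k} → ℝ),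
          (∀ᶠ n : ℕ in atTop, ∀ k, k = i n ∨ k = j n →
            c₀ * √(Real.log (p n) / n) ≤ lam n k ∧ lam n k ≤ c₁ * √(Real.log (p n) / n)) →
          (∀ᶠ n : ℕ in atTop, ∀ k, k = i n ∨ k = j n →
            Measurable (fun X => γ n X k) ∧ ∀ X, IsNodewiseLasso X k (lam n k) (γ n X k)) →
          ∃ q : ℕ → ℝ, (∀ n, 0 ≤ q n) ∧ Tendsto (fun n => n * q n) atTop (𝓝 0) ∧
            ∀ᶠ n : ℕ in atTop, ∀ Θ ∈ precisionClass (S n) C₁ C₂ C₃ (d n),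
              MemLp (fun X => 2 * Θ (i n) (j n) - Θ.col (i n) ⬝ᵥ gram X *ᵥ Θ.col (j n) -
                desparsified X (lam n) (γ n X) (i n) (j n)) 2 (dataLaw n Θ) ∧
              ∫ X, (2 * Θ (i n) (j n) - Θ.col (i n) ⬝ᵥ gram X *ᵥ Θ.col (j n) -
                desparsified X (lam n) (γ n X) (i n) (j n)) ^ 2 ∂(dataLaw n Θ) ≤ q n := by
  obtain ⟨c₀, hc₀, H⟩ := remainder_second_moment hC₂ hC₃
  refine ⟨c₀, hc₀, ?_⟩
  intro p i j d S hne hlog lam c₁ γ hlam hγ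
  obtain ⟨K, ε, hK, hε, H⟩ := H c₁
  set s : ℕ → ℝ := fun n => C₁ * max (d n (i n)) (d n (j n)) with hs
  have hl0 : ∀ n, ∀ Θ ∈ precisionClass (S n) C₁ C₂ C₃ (d n), ∀ k, k = i n ∨ k = j n →
      (l0 (Θ.col k) : ℝ) ≤ s n := by
    intro n Θ hΘ k hk
    refine (hΘ.2.1 k).trans (mul_le_mul_of_nonneg_left ?_ hC₁.le)
    rcases hk with rfl | rfl
    · exact le_max_left _ _
    · exact le_max_right _ _
  have hs1 : ∀ n, 1 ≤ s n := by
    intro n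
    obtain ⟨Θ, hΘ⟩ := hne n
    exact (one_le_l0 (isRegular_of_mem hΘ).posDef _).trans (hl0 n Θ hΘ (i n) (Or.inl rfl))
  have hslog : Tendsto (fun n => s n * Real.log (p n) / √(n : ℝ)) atTop (𝓝 0) := by
    have := (hlog.tendsto_div_nhds_zero).const_mul C₁
    rw [mul_zero] at this
    refine this.congr fun n => ?_
    simp only [hs]; ring
  set L : ℕ → ℝ := fun n => logScale n (p n) with hL
  set e : ℕ → ℝ := fun n => effSparsity n (p n) (s n) with he
  have hf := tendsto_scale (fun n => zero_le_one.trans (hs1 n)) hslog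
  have he1 : ∀ n, 1 ≤ e n := by
    intro n
    simp only [he, effSparsity]
    split_ifs
    · exact_mod_cast (i n).pos
    · exact hs1 n
  refine ⟨fun n => K * ((L n / n * e n) ^ 2 + 1 / (n : ℝ) ^ 2), fun n => by positivity, ?_, ?_⟩
  · have h1 : Tendsto (fun n : ℕ => 1 / (n : ℝ)) atTop (𝓝 0) := tendsto_one_div_atTop_nhds_zero_nat
    have h2 := ((hf.pow 2).add h1).const_mul K
    rw [zero_pow two_ne_zero, add_zero, mul_zero] at h2
    refine h2.congr' ?_
    filter_upwards [eventually_gt_atTop 0] with n hn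
    have hn' : (0 : ℝ) < n := Nat.cast_pos.2 hn
    rw [div_pow, Real.sq_sqrt hn'.le]
    simp only [hL, he]
    field_simp
  · have hlogn : ∀ᶠ n : ℕ in atTop, 8 ≤ Real.log n :=
      (Real.tendsto_log_atTop.comp tendsto_natCast_atTop_atTop).eventually_ge_atTop 8
    have hfε : ∀ᶠ n in atTop, logScale n (p n) * effSparsity n (p n) (s n) / √(n : ℝ) < ε :=
      hf.eventually_lt_const hε
    filter_upwards [hlam, hγ, hlogn, hfε, eventually_ge_atTop 32] with n h1 h2 h3 h4 h5 Θ hΘ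
    have hn' : (0 : ℝ) < n := Nat.cast_pos.2 (by omega)
    obtain ⟨a1, a2, a3, a4⟩ := logScale_properties h3 (i n).pos
    refine H n (p n) Θ (i n) (j n) (lam n) (e n) (L n) (γ n) h5 (isRegular_of_mem hΘ) a1 a2 a3 a4
      (he1 n) ?_ h1 h2 ?_
    · simp only [hL, he, logScale, effSparsity]
      split_ifs with h
      · exact Or.inl le_rfl
      · exact Or.inr ⟨rfl, hl0 n Θ hΘ⟩
    · refine le_trans ?_ h4.le
      have h6 : √(L n / n) ≤ L n / √(n : ℝ) := by
        rw [Real.sqrt_div' _ hn'.le]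
        refine div_le_div_of_nonneg_right ?_ (Real.sqrt_nonneg _)
        rw [Real.sqrt_le_left (by linarith)]
        nlinarith
      calc √(L n / n) * e n ≤ L n / √(n : ℝ) * e n :=
            mul_le_mul_of_nonneg_right h6 (zero_le_one.trans (he1 n))
        _ = _ := by simp only [hL, he]; ring

theorem sigmaSq_le {p : ℕ} {C₂ C₃ : ℝ} {Θ : Matrix (Fin p) (Fin p) ℝ} (hΘ : IsRegular C₂ C₃ Θ)
    (i j : Fin p) : sigmaSq Θ i j ≤ 2 * C₃ ^ 2 := by
  have h1 := hΘ.col_sq j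
  have h2 : Θ i j ^ 2 ≤ Θ.col j ⬝ᵥ Θ.col j := by
    have := Finset.single_le_sum (f := fun l => Θ.col j l * Θ.col j l)
      (fun l _ => mul_self_nonneg _) (Finset.mem_univ i)
    simpa [dotProduct, sq] using this
  have h3 := mul_le_mul (hΘ.diag_upper i) (hΘ.diag_upper j) (hΘ.posDef.diag_pos (i := j)).le
    ((hΘ.posDef.diag_pos (i := i)).le.trans (hΘ.diag_upper i))
  rw [sigmaSq]; linarith

theorem sigmaSq_pos {p : ℕ} {Θ : Matrix (Fin p) (Fin p) ℝ} (hΘ : Θ.PosDef) (i j : Fin p) :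
    0 < sigmaSq Θ i j := by
  have h1 := hΘ.diag_pos (i := i)
  have h2 := hΘ.diag_pos (i := j)
  rw [sigmaSq]; positivity

/-- The de-sparsified estimator differs from the unbiased quadratic `2 Θ_ij - Θ_iᵀ Σ̂ Θ_j` by a
remainder of second moment `o(1/n)`, uniformly over the class; hence its bias is `o(1/√n)`, its
variance is that of the quadratic up to `o(1/n)`, and a rate slightly faster than `n` exists. -/
theorem desparsified_isStronglyAsympUnbiased {C₁ C₂ C₃ : ℝ} (hC₁ : 0 < C₁) (hC₂ : 0 < C₂)
    (hC₃ : 0 < C₃) :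
    ∃ c₀ : ℝ, 0 < c₀ ∧
      ∀ (p : ℕ → ℕ) (i j : ∀ n, Fin (p n)) (d : ∀ n, Fin (p n) → ℝ)
        (S : ∀ n, Set (Matrix (Fin (p n)) (Fin (p n)) ℝ))
        (Θ₀ : ∀ n, Matrix (Fin (p n)) (Fin (p n)) ℝ) (c : ℝ),
        (∀ n, Θ₀ n ∈ precisionClass (S n) C₁ C₂ C₃ (d n)) →
        ((fun n => max (d n (i n)) (d n (j n)) * Real.log (p n)) =o[atTop]
          fun n : ℕ => √(n : ℝ)) →
        ∀ (lam : ∀ n, Fin (p n) → ℝ) (c₁ : ℝ)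
          (γ : ∀ n, Data n (p n) → ∀ k : Fin (p n), {l : Fin (p n) // l ≠ k} → ℝ),
          (∀ᶠ n : ℕ in atTop, ∀ k, k = i n ∨ k = j n →
            c₀ * √(Real.log (p n) / n) ≤ lam n k ∧ lam n k ≤ c₁ * √(Real.log (p n) / n)) →
          (∀ᶠ n : ℕ in atTop, ∀ k, k = i n ∨ k = j n →
            Measurable (fun X => γ n X k) ∧ ∀ X, IsNodewiseLasso X k (lam n k) (γ n X k)) →
          (∃ m : ℕ → ℝ, IsStronglyAsympUnbiased
            (fun n => precisionClass (S n) C₁ C₂ C₃ (d n)) (fun n Θ => Θ (i n) (j n)) Θ₀ c m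
            (fun n X => desparsified X (lam n) (γ n X) (i n) (j n))) ∧
          ∃ r : ℕ → ℝ, Tendsto r atTop (𝓝 0) ∧ ∀ᶠ n : ℕ in atTop,
            variance (fun X => desparsified X (lam n) (γ n X) (i n) (j n))
              (dataLaw n (Θ₀ n)) = (sigmaSq (Θ₀ n) (i n) (j n) + r n) / n := by
  obtain ⟨c₀, hc₀, H⟩ := exists_uniform_remainder_bound hC₁ hC₂ hC₃
  refine ⟨c₀, hc₀, ?_⟩
  intro p i j d S Θ₀ c hΘ₀ hlog lam c₁ γ hlam hγ
  obtain ⟨q, hq0, hq, hR⟩ := H p i j d S (fun n => ⟨_, hΘ₀ n⟩) hlog lam c₁ γ hlam hγ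
  set T : ∀ n, Data n (p n) → ℝ := fun n X => desparsified X (lam n) (γ n X) (i n) (j n) with hT
  -- mean and variance of the estimator, uniformly over the class
  have hmain : ∀ᶠ n : ℕ in atTop, ∀ Θ ∈ precisionClass (S n) C₁ C₂ C₃ (d n),
      MemLp (T n) 2 (dataLaw n Θ) ∧
      |(∫ X, T n X ∂(dataLaw n Θ)) - Θ (i n) (j n)| ≤ √(q n) ∧
      |variance (T n) (dataLaw n Θ) - sigmaSq Θ (i n) (j n) / n| ≤
        q n + 2 * √(sigmaSq Θ (i n) (j n) / n * q n) := by
    filter_upwards [hR, eventually_gt_atTop 0] with n h hn Θ hΘ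
    obtain ⟨hRL, hRq⟩ := h Θ hΘ
    obtain ⟨z1, z2, z3⟩ := linear_part_moments (n := n) hn (isRegular_of_mem hΘ).posDef (i n) (j n)
    have hTe : T n = fun X => (2 * Θ (i n) (j n) - Θ.col (i n) ⬝ᵥ gram X *ᵥ Θ.col (j n)) -
        (2 * Θ (i n) (j n) - Θ.col (i n) ⬝ᵥ gram X *ᵥ Θ.col (j n) - T n X) := by
      ext X; ring
    have hTL : MemLp (T n) 2 (dataLaw n Θ) := by
      rw [hTe]; exact z1.sub hRL
    refine ⟨hTL, ?_, ?_⟩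
    · have h1 := abs_integral_le_sqrt hRL hRq
      rw [integral_sub (z1.integrable one_le_two) (hTL.integrable one_le_two), z2, abs_sub_comm]
        at h1
      exact h1
    · have h1 := abs_variance_sub_le z1 hRL hRq
      rw [z3] at h1
      rwa [← hTe] at h1
  set b : ℕ → ℝ := fun n => √(n * q n) with hb
  have hb0 : ∀ n, 0 ≤ b n := fun n => Real.sqrt_nonneg _
  have hbt : Tendsto b atTop (𝓝 0) := by
    have := (Real.continuous_sqrt.tendsto 0).comp hq
    rwa [Real.sqrt_zero] at this
  have hbq : ∀ n : ℕ, b n ^ 2 = n * q n := fun n =>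
    Real.sq_sqrt (mul_nonneg (Nat.cast_nonneg n) (hq0 n))
  have hinv : Tendsto (fun n : ℕ => 1 / ((n : ℝ) + 1)) atTop (𝓝 0) :=
    tendsto_one_div_add_atTop_nhds_zero_nat
  -- the variance expansion
  set r : ℕ → ℝ := fun n => n * variance (T n) (dataLaw n (Θ₀ n)) - sigmaSq (Θ₀ n) (i n) (j n)
    with hr
  have hrt : Tendsto r atTop (𝓝 0) := by
    have hlim : Tendsto (fun n => b n ^ 2 + 2 * √(2 * C₃ ^ 2) * b n) atTop (𝓝 0) := by
      have := (hbt.pow 2).add (hbt.const_mul (2 * √(2 * C₃ ^ 2)))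
      simpa using this
    refine squeeze_zero_norm' ?_ hlim
    filter_upwards [hmain, eventually_gt_atTop 0] with n h hn
    have hn' : (0 : ℝ) < n := Nat.cast_pos.2 hn
    obtain ⟨-, -, h3⟩ := h _ (hΘ₀ n)
    have hσ := sigmaSq_le (isRegular_of_mem (hΘ₀ n)) (i n) (j n)
    have hσ0 := (sigmaSq_pos (isRegular_of_mem (hΘ₀ n)).posDef (i n) (j n)).le
    have e1 : r n = n * (variance (T n) (dataLaw n (Θ₀ n)) - sigmaSq (Θ₀ n) (i n) (j n) / n) := by
      simp only [hr]; field_simp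
    have e2 : (n : ℝ) * √(sigmaSq (Θ₀ n) (i n) (j n) / n * q n) ≤ √(2 * C₃ ^ 2) * b n := by
      rw [hb, ← Real.sqrt_mul (by positivity)]
      refine Real.le_sqrt_of_sq_le ?_
      rw [mul_pow, Real.sq_sqrt (mul_nonneg (div_nonneg hσ0 hn'.le) (hq0 n))]
      have e3 : (n : ℝ) ^ 2 * (sigmaSq (Θ₀ n) (i n) (j n) / n * q n) =
          sigmaSq (Θ₀ n) (i n) (j n) * (n * q n) := by field_simp
      rw [e3]
      exact mul_le_mul_of_nonneg_right hσ (mul_nonneg hn'.le (hq0 n))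
    rw [Real.norm_eq_abs, e1, abs_mul, abs_of_pos hn', hbq]
    have := mul_le_mul_of_nonneg_left h3 hn'.le
    linarith
  have hvar : ∀ᶠ n : ℕ in atTop, variance (T n) (dataLaw n (Θ₀ n)) =
      (sigmaSq (Θ₀ n) (i n) (j n) + r n) / n := by
    filter_upwards [eventually_gt_atTop 0] with n hn
    have hn' : (0 : ℝ) < n := Nat.cast_pos.2 hn
    simp only [hr]; field_simp; ring
  refine ⟨?_, r, hrt, hvar⟩
  -- the rate: slightly faster than `n`, and slow enough for the bias to be invisible
  set w : ℕ → ℝ := fun n => b n + 1 / ((n : ℝ) + 1) with hw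
  have hw0 : ∀ n, 0 < w n := fun n => add_pos_of_nonneg_of_pos (hb0 n) (by positivity)
  have hwt : Tendsto w atTop (𝓝 0) := by
    have h := hbt.add hinv
    rwa [add_zero] at h
  have hmpos : ∀ᶠ n : ℕ in atTop, 0 < (n : ℝ) / w n := by
    filter_upwards [eventually_gt_atTop 0] with n hn
    exact div_pos (Nat.cast_pos.2 hn) (hw0 n)
  refine ⟨fun n => n / w n, hmpos, ?_, ?_, ?_, ?_⟩
  · rw [isLittleO_iff_tendsto' (hmpos.mono fun n h h0 => absurd h0 h.ne')]
    refine hwt.congr' ?_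
    filter_upwards [eventually_gt_atTop 0] with n hn
    have hn' : (0 : ℝ) < n := Nat.cast_pos.2 hn
    have := (hw0 n).ne'
    field_simp
  · exact hmain.mono fun n h => (h _ (hΘ₀ n)).1
  · refine IsBigO.of_bound (2 * C₃ ^ 2 + 1) ?_
    have hr1 : ∀ᶠ n in atTop, r n < 1 := hrt.eventually_lt_const one_pos
    filter_upwards [hvar, hr1, eventually_gt_atTop 0] with n h1 h2 hn
    have hn' : (0 : ℝ) < n := Nat.cast_pos.2 hn
    rw [Real.norm_of_nonneg (variance_nonneg _ _), Real.norm_of_nonneg (by positivity), h1,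
      mul_one_div]
    have hσ := sigmaSq_le (isRegular_of_mem (hΘ₀ n)) (i n) (j n)
    exact div_le_div_of_nonneg_right (by linarith) hn'.le
  · intro Θ hΘ
    refine ⟨?_, ?_⟩
    · filter_upwards [hmain, hΘ] with n h1 h2
      exact (h1 _ h2.1).1.integrable one_le_two
    · have hsb : Tendsto (fun n => √(b n)) atTop (𝓝 0) := by
        have := (Real.continuous_sqrt.tendsto 0).comp hbt
        rwa [Real.sqrt_zero] at this
      refine squeeze_zero_norm' ?_ hsb
      filter_upwards [hmain, hΘ] with n h1 h2
      obtain ⟨-, h3, -⟩ := h1 _ h2.1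
      have hwn := hw0 n
      rw [Real.norm_eq_abs, abs_mul, abs_of_nonneg (Real.sqrt_nonneg _)]
      refine (mul_le_mul_of_nonneg_left h3 (Real.sqrt_nonneg _)).trans ?_
      rw [← Real.sqrt_mul (div_nonneg (Nat.cast_nonneg n) hwn.le)]
      refine Real.sqrt_le_sqrt ?_
      rw [div_mul_eq_mul_div, ← hbq, div_le_iff₀ hwn, sq]
      refine mul_le_mul_of_nonneg_left ?_ (hb0 n)
      simp only [hw]
      have : (0 : ℝ) ≤ 1 / ((n : ℝ) + 1) := by positivity
      linarith

/-! ### Densities and likelihood ratios of Gaussian vectors -/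

/-- A product of measures with densities has the product density. -/
theorem pi_withDensity_ofReal {ι : Type*} [Fintype ι] {α : ι → Type*}
    [∀ i, MeasurableSpace (α i)] (μ : ∀ i, Measure (α i)) [∀ i, SigmaFinite (μ i)]
    {f : ∀ i, α i → ℝ} (hf0 : ∀ i x, 0 ≤ f i x) (hf : ∀ i, Integrable (f i) (μ i)) :
    Measure.pi (fun i => (μ i).withDensity fun x => ENNReal.ofReal (f i x)) =
      (Measure.pi μ).withDensity fun x => ENNReal.ofReal (∏ i, f i (x i)) := by
  have hfin : ∀ i, IsFiniteMeasure ((μ i).withDensity fun x => ENNReal.ofReal (f i x)) :=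
    fun i => isFiniteMeasure_withDensity_ofReal (hf i).2
  refine Measure.pi_eq fun s hs => ?_
  rw [withDensity_apply _ (MeasurableSet.univ_pi hs), Measure.restrict_pi_pi,
    ← ofReal_integral_eq_lintegral_ofReal
      (Integrable.fintype_prod_dep (f := f) fun i => (hf i).integrableOn)
      (ae_of_all _ fun x => Finset.prod_nonneg fun i _ => hf0 i _),
    integral_fintype_prod_eq_prod, ENNReal.ofReal_prod_of_nonneg fun i _ =>
      integral_nonneg (hf0 i)]
  refine Finset.prod_congr rfl fun i _ => ?_
  rw [withDensity_apply _ (hs i), ofReal_integral_eq_lintegral_ofReal (hf i).integrableOn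
    (ae_of_all _ (hf0 i))]

/-- The standard Gaussian measure has a density proportional to `exp (-‖x‖² / 2)`. -/
theorem stdGaussian_eq_withDensity (p : ℕ) : ∃ K : ℝ, 0 < K ∧
    stdGaussian (EuclideanSpace ℝ (Fin p)) = volume.withDensity fun x =>
      ENNReal.ofReal (K * Real.exp (-(x.ofLp ⬝ᵥ x.ofLp) / 2)) := by
  set K : ℝ := (√(2 * Real.pi))⁻¹ ^ p with hK
  refine ⟨K, by positivity, ?_⟩
  have h1 : Measure.pi (fun _ : Fin p => gaussianReal 0 1) =
      (volume : Measure (Fin p → ℝ)).withDensity fun x =>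
        ENNReal.ofReal (∏ i, gaussianPDFReal 0 1 (x i)) := by
    rw [volume_pi, ← pi_withDensity_ofReal (fun _ : Fin p => (volume : Measure ℝ))
      (f := fun _ => gaussianPDFReal 0 1) (fun _ => gaussianPDFReal_nonneg 0 1)
      (fun _ => integrable_gaussianPDFReal 0 1)]
    congr 1; ext1 i
    rw [gaussianReal_of_var_ne_zero 0 one_ne_zero]; rfl
  have h2 : ∀ x : Fin p → ℝ, ∏ i, gaussianPDFReal 0 1 (x i) =
      K * Real.exp (-(x ⬝ᵥ x) / 2) := by
    intro x
    simp only [gaussianPDFReal, Finset.prod_mul_distrib, ← Real.exp_sum, dotProduct]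
    simp [hK, ← Finset.sum_div, sq]
  have h3 : Measurable fun x : EuclideanSpace ℝ (Fin p) =>
      ENNReal.ofReal (K * Real.exp (-(x.ofLp ⬝ᵥ x.ofLp) / 2)) := by
    unfold dotProduct; fun_prop
  have hvp := PiLp.volume_preserving_toLp (Fin p)
  rw [← map_pi_eq_stdGaussian, h1]
  ext s hs
  rw [Measure.map_apply (by fun_prop) hs, withDensity_apply _ hs,
    withDensity_apply _ (hvp.measurable hs), ← hvp.setLIntegral_comp_preimage hs h3]
  simp only [h2]

theorem measurable_quadratic {p : ℕ} (Θ : Matrix (Fin p) (Fin p) ℝ) :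
    Measurable fun x : EuclideanSpace ℝ (Fin p) => x.ofLp ⬝ᵥ Θ *ᵥ x.ofLp := by
  unfold dotProduct mulVec dotProduct; fun_prop

open scoped MatrixOrder in
/-- Integration against `N(0, Θ⁻¹)` in terms of Lebesgue measure. Only the dependence of the
normalising constant on `Θ` matters below. -/
theorem lintegral_multivariateGaussian (p : ℕ) : ∃ K : ℝ, 0 < K ∧
    ∀ Θ : Matrix (Fin p) (Fin p) ℝ, Θ.PosDef → ∀ f : EuclideanSpace ℝ (Fin p) → ENNReal,
      Measurable f → ∫⁻ x, f x ∂(multivariateGaussian 0 Θ⁻¹) =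
        ENNReal.ofReal (K * √Θ.det) *
          ∫⁻ x, ENNReal.ofReal (Real.exp (-(x.ofLp ⬝ᵥ Θ *ᵥ x.ofLp) / 2)) * f x := by
  obtain ⟨K, hK, hstd⟩ := stdGaussian_eq_withDensity p
  refine ⟨K, hK, fun Θ hΘ f hf => ?_⟩
  set A : Matrix (Fin p) (Fin p) ℝ := CFC.sqrt Θ⁻¹ with hA
  have hpsd : (0 : Matrix (Fin p) (Fin p) ℝ) ≤ Θ⁻¹ := hΘ.inv.posSemidef.nonneg
  have hAA : A * A = Θ⁻¹ := CFC.sqrt_mul_sqrt_self _ hpsd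
  have hAt : Aᵀ = A := by
    have := (Matrix.nonneg_iff_posSemidef.1 (CFC.sqrt_nonneg Θ⁻¹)).isHermitian
    rwa [IsHermitian, conjTranspose_eq_transpose_of_trivial] at this
  have hdet : 0 < Θ.det := hΘ.det_pos
  have hinv : A * (A * Θ) = 1 := by
    rw [← Matrix.mul_assoc, hAA, nonsing_inv_mul _ hdet.ne'.isUnit]
  have hinv' : A * Θ * A = 1 := mul_eq_one_comm.1 hinv
  have hdA : A.det ^ 2 * Θ.det = 1 := by
    have := congrArg det hinv
    rw [det_mul, det_mul, det_one] at this
    rw [← this]; ring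
  have hdA0 : A.det ≠ 0 := by
    rintro h; rw [h] at hdA; norm_num at hdA
  have habs : |A.det|⁻¹ = √Θ.det := by
    rw [eq_comm, Real.sqrt_eq_iff_mul_self_eq hdet.le (by positivity)]
    field_simp
    rw [sq_abs, ← hdA]; ring
  set L : EuclideanSpace ℝ (Fin p) →L[ℝ] EuclideanSpace ℝ (Fin p) :=
    toEuclideanCLM (𝕜 := ℝ) A with hL
  have hLA : ∀ y, (L y).ofLp = A *ᵥ y.ofLp := fun y => ofLp_toEuclideanCLM A y
  have hLdet : LinearMap.det (L : EuclideanSpace ℝ (Fin p) →ₗ[ℝ] EuclideanSpace ℝ (Fin p)) =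
      A.det := by
    rw [hL]
    simp [coe_toEuclideanCLM_eq_toEuclideanLin, toEuclideanLin, toLpLin_eq_toLin]
  have hquad : ∀ y : EuclideanSpace ℝ (Fin p),
      (L y).ofLp ⬝ᵥ Θ *ᵥ (L y).ofLp = y.ofLp ⬝ᵥ y.ofLp := by
    intro y
    have h := dotProduct_mulVec y.ofLp A ((Θ * A) *ᵥ y.ofLp)
    rw [← mulVec_transpose, hAt, mulVec_mulVec, ← Matrix.mul_assoc, hinv', one_mulVec] at h
    rw [hLA, mulVec_mulVec, ← h]
  set F : EuclideanSpace ℝ (Fin p) → ENNReal := fun x =>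
    ENNReal.ofReal (Real.exp (-(x.ofLp ⬝ᵥ Θ *ᵥ x.ofLp) / 2)) * f x with hF
  have hFm : Measurable F := by
    have := measurable_quadratic Θ
    fun_prop
  have hmap : (volume : Measure (EuclideanSpace ℝ (Fin p))).map L =
      ENNReal.ofReal (√Θ.det) • volume := by
    have := Measure.map_linearMap_addHaar_eq_smul_addHaar
      (volume : Measure (EuclideanSpace ℝ (Fin p)))
      (f := (L : EuclideanSpace ℝ (Fin p) →ₗ[ℝ] EuclideanSpace ℝ (Fin p))) (by rwa [hLdet])
    rw [hLdet, abs_inv, habs] at this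
    exact this
  have hd : Measurable fun x : EuclideanSpace ℝ (Fin p) =>
      ENNReal.ofReal (K * Real.exp (-(x.ofLp ⬝ᵥ x.ofLp) / 2)) := by
    unfold dotProduct; fun_prop
  have hfL : Measurable fun y => f (L y) := hf.comp L.continuous.measurable
  have hFL : Measurable fun y => F (L y) := hFm.comp L.continuous.measurable
  calc ∫⁻ x, f x ∂(multivariateGaussian 0 Θ⁻¹)
      = ∫⁻ y, f (L y) ∂(stdGaussian (EuclideanSpace ℝ (Fin p))) := by
        rw [multivariateGaussian, lintegral_map hf (by fun_prop)]
        simp [hL, hA]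
    _ = ∫⁻ y, ENNReal.ofReal (K * Real.exp (-(y.ofLp ⬝ᵥ y.ofLp) / 2)) * f (L y) := by
        rw [hstd, lintegral_withDensity_eq_lintegral_mul _ hd hfL]
        rfl
    _ = ∫⁻ y, ENNReal.ofReal K * F (L y) := by
        refine lintegral_congr fun y => ?_
        simp only [hF, hquad, ENNReal.ofReal_mul hK.le, mul_assoc]
    _ = ENNReal.ofReal K * ∫⁻ x, F x ∂((volume : Measure (EuclideanSpace ℝ (Fin p))).map L) := by
        rw [lintegral_map hFm L.continuous.measurable,
          lintegral_const_mul _ hFL]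
    _ = _ := by
        rw [hmap, lintegral_smul_measure, smul_eq_mul, ← mul_assoc, ENNReal.ofReal_mul hK.le]

/-- The likelihood ratio of `N(0, Θ₁⁻¹)` with respect to `N(0, Θ₀⁻¹)`. -/
noncomputable def gaussRatio {p : ℕ} (Θ₀ Θ₁ : Matrix (Fin p) (Fin p) ℝ)
    (x : EuclideanSpace ℝ (Fin p)) : ℝ :=
  √(Θ₁.det / Θ₀.det) * Real.exp (-(x.ofLp ⬝ᵥ (Θ₁ - Θ₀) *ᵥ x.ofLp) / 2)

theorem measurable_gaussRatio {p : ℕ} (Θ₀ Θ₁ : Matrix (Fin p) (Fin p) ℝ) :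
    Measurable (gaussRatio Θ₀ Θ₁) := by
  have := measurable_quadratic (Θ₁ - Θ₀)
  unfold gaussRatio; fun_prop

theorem gaussRatio_nonneg {p : ℕ} (Θ₀ Θ₁ : Matrix (Fin p) (Fin p) ℝ)
    (x : EuclideanSpace ℝ (Fin p)) : 0 ≤ gaussRatio Θ₀ Θ₁ x := by
  unfold gaussRatio; positivity

theorem multivariateGaussian_eq_withDensity {p : ℕ} {Θ₀ Θ₁ : Matrix (Fin p) (Fin p) ℝ}
    (h₀ : Θ₀.PosDef) (h₁ : Θ₁.PosDef) :
    multivariateGaussian 0 Θ₁⁻¹ =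
      (multivariateGaussian 0 Θ₀⁻¹).withDensity fun x => ENNReal.ofReal (gaussRatio Θ₀ Θ₁ x) := by
  obtain ⟨K, hK, H⟩ := lintegral_multivariateGaussian p
  have hm := (measurable_gaussRatio Θ₀ Θ₁).ennreal_ofReal
  refine Measure.ext_of_lintegral _ fun f hf => ?_
  rw [lintegral_withDensity_eq_lintegral_mul _ hm hf, H Θ₁ h₁ f hf, H Θ₀ h₀ _ (hm.mul hf)]
  have e : ∀ x : EuclideanSpace ℝ (Fin p),
      ENNReal.ofReal (Real.exp (-(x.ofLp ⬝ᵥ Θ₀ *ᵥ x.ofLp) / 2)) *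
        ((fun x => ENNReal.ofReal (gaussRatio Θ₀ Θ₁ x)) * f) x =
      ENNReal.ofReal (√(Θ₁.det / Θ₀.det)) *
        (ENNReal.ofReal (Real.exp (-(x.ofLp ⬝ᵥ Θ₁ *ᵥ x.ofLp) / 2)) * f x) := by
    intro x
    rw [Pi.mul_apply, ← mul_assoc, ← mul_assoc, ← ENNReal.ofReal_mul (by positivity),
      ← ENNReal.ofReal_mul (by positivity), gaussRatio, mul_left_comm, ← Real.exp_add, sub_mulVec,
      dotProduct_sub]
    congr 5; ring
  have hm1 : Measurable fun x : EuclideanSpace ℝ (Fin p) =>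
      ENNReal.ofReal (Real.exp (-(x.ofLp ⬝ᵥ Θ₁ *ᵥ x.ofLp) / 2)) * f x := by
    have := measurable_quadratic Θ₁
    fun_prop
  have hd : √Θ₀.det * √(Θ₁.det / Θ₀.det) = √Θ₁.det := by
    rw [← Real.sqrt_mul h₀.det_pos.le, mul_div_cancel₀ _ h₀.det_pos.ne']
  rw [lintegral_congr e, lintegral_const_mul _ hm1, ← mul_assoc,
    ← ENNReal.ofReal_mul (by positivity), mul_assoc K, hd]

theorem lintegral_gaussRatio {p : ℕ} {Θ₀ Θ₂ : Matrix (Fin p) (Fin p) ℝ}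
    (h₀ : Θ₀.PosDef) (h₂ : Θ₂.PosDef) :
    ∫⁻ x, ENNReal.ofReal (gaussRatio Θ₀ Θ₂ x) ∂(multivariateGaussian 0 Θ₀⁻¹) = 1 := by
  have h := congrArg (fun μ => μ Set.univ) (multivariateGaussian_eq_withDensity h₀ h₂)
  simpa using h.symm

/-- The second moment of the likelihood ratio, finite as soon as `2 Θ₁ - Θ₀` is positive
definite. -/
theorem gaussRatio_second_moment {p : ℕ} {Θ₀ Θ₁ : Matrix (Fin p) (Fin p) ℝ}
    (h₀ : Θ₀.PosDef) (h₁ : Θ₁.PosDef) (h₂ : (2 • Θ₁ - Θ₀).PosDef) :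
    Integrable (fun x => gaussRatio Θ₀ Θ₁ x ^ 2) (multivariateGaussian 0 Θ₀⁻¹) ∧
    ∫ x, gaussRatio Θ₀ Θ₁ x ^ 2 ∂(multivariateGaussian 0 Θ₀⁻¹) =
      (Θ₁.det / Θ₀.det) / √((2 • Θ₁ - Θ₀).det / Θ₀.det) := by
  have hpos : 0 < √((2 • Θ₁ - Θ₀).det / Θ₀.det) :=
    Real.sqrt_pos.2 (div_pos h₂.det_pos h₀.det_pos)
  have e : ∀ x, gaussRatio Θ₀ Θ₁ x ^ 2 = (Θ₁.det / Θ₀.det) / √((2 • Θ₁ - Θ₀).det / Θ₀.det) *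
      gaussRatio Θ₀ (2 • Θ₁ - Θ₀) x := by
    intro x
    have hq : x.ofLp ⬝ᵥ (2 • Θ₁ - Θ₀ - Θ₀) *ᵥ x.ofLp = 2 * (x.ofLp ⬝ᵥ (Θ₁ - Θ₀) *ᵥ x.ofLp) := by
      have : 2 • Θ₁ - Θ₀ - Θ₀ = (2 : ℝ) • (Θ₁ - Θ₀) := by
        rw [two_nsmul, two_smul]; abel
      rw [this, smul_mulVec, dotProduct_smul, smul_eq_mul]
    rw [gaussRatio, gaussRatio, mul_pow, Real.sq_sqrt (div_nonneg h₁.det_pos.le h₀.det_pos.le),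
      ← Real.exp_nat_mul, hq, ← mul_assoc, div_mul_cancel₀ _ hpos.ne']
    congr 2; push_cast; ring
  have hl := lintegral_gaussRatio h₀ h₂
  have hm := measurable_gaussRatio Θ₀ (2 • Θ₁ - Θ₀)
  have hI : Integrable (gaussRatio Θ₀ (2 • Θ₁ - Θ₀)) (multivariateGaussian 0 Θ₀⁻¹) := by
    refine ⟨hm.aestronglyMeasurable, ?_⟩
    rw [hasFiniteIntegral_iff_ofReal (ae_of_all _ (gaussRatio_nonneg _ _)), hl]
    exact ENNReal.one_lt_top
  simp only [e]
  refine ⟨hI.const_mul _, ?_⟩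
  rw [integral_const_mul, integral_eq_lintegral_of_nonneg_ae
    (ae_of_all _ (gaussRatio_nonneg _ _)) hm.aestronglyMeasurable, hl]
  simp

/-! ### The likelihood ratio of a sample and the Hammersley–Chapman–Robbins inequality -/

theorem integrable_gaussRatio {p : ℕ} {Θ₀ Θ₁ : Matrix (Fin p) (Fin p) ℝ}
    (h₀ : Θ₀.PosDef) (h₁ : Θ₁.PosDef) :
    Integrable (gaussRatio Θ₀ Θ₁) (multivariateGaussian 0 Θ₀⁻¹) := by
  refine ⟨(measurable_gaussRatio _ _).aestronglyMeasurable, ?_⟩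
  rw [hasFiniteIntegral_iff_ofReal (ae_of_all _ (gaussRatio_nonneg _ _)),
    lintegral_gaussRatio h₀ h₁]
  exact ENNReal.one_lt_top

theorem dataLaw_eq_withDensity {p : ℕ} (n : ℕ) {Θ₀ Θ₁ : Matrix (Fin p) (Fin p) ℝ}
    (h₀ : Θ₀.PosDef) (h₁ : Θ₁.PosDef) :
    dataLaw n Θ₁ = (dataLaw n Θ₀).withDensity fun X =>
      ENNReal.ofReal (∏ r, gaussRatio Θ₀ Θ₁ (X r)) := by
  unfold dataLaw
  rw [multivariateGaussian_eq_withDensity h₀ h₁]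
  exact pi_withDensity_ofReal _ (fun _ => gaussRatio_nonneg Θ₀ Θ₁)
    fun _ => integrable_gaussRatio h₀ h₁

/-- The rows are independent, so the second moment of the likelihood ratio of the sample is the
`n`-th power of that of one row. -/
theorem dataRatio_second_moment {p : ℕ} (n : ℕ) {Θ₀ Θ₁ : Matrix (Fin p) (Fin p) ℝ}
    (h₀ : Θ₀.PosDef) (h₁ : Θ₁.PosDef) (h₂ : (2 • Θ₁ - Θ₀).PosDef) :
    Integrable (fun X => (∏ r, gaussRatio Θ₀ Θ₁ (X r)) ^ 2) (dataLaw n Θ₀) ∧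
    ∫ X, (∏ r, gaussRatio Θ₀ Θ₁ (X r)) ^ 2 ∂(dataLaw n Θ₀) =
      ((Θ₁.det / Θ₀.det) / √((2 • Θ₁ - Θ₀).det / Θ₀.det)) ^ n := by
  obtain ⟨hI, hE⟩ := gaussRatio_second_moment h₀ h₁ h₂
  simp only [← Finset.prod_pow]
  refine ⟨Integrable.fintype_prod (f := fun _ x => gaussRatio Θ₀ Θ₁ x ^ 2) fun _ => hI, ?_⟩
  rw [dataLaw, integral_fintype_prod_eq_prod (f := fun _ x => gaussRatio Θ₀ Θ₁ x ^ 2)]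
  rw [hE, Finset.prod_const, Finset.card_univ, Fintype.card_fin]

/-- The Hammersley–Chapman–Robbins inequality: the squared change of the mean of `T` under a
change of measure is at most the variance of `T` times the `χ²` distance. -/
theorem sq_integral_sub_le {Ω : Type*} [MeasurableSpace Ω] {P : Measure Ω}
    [IsProbabilityMeasure P] {ρ T : Ω → ℝ} (hρm : Measurable ρ) (hρ0 : ∀ ω, 0 ≤ ρ ω)
    (hQ : IsProbabilityMeasure (P.withDensity fun ω => ENNReal.ofReal (ρ ω)))
    (hρ : Integrable (fun ω => ρ ω ^ 2) P) (hT : MemLp T 2 P) :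
    ((∫ ω, T ω ∂(P.withDensity fun ω => ENNReal.ofReal (ρ ω))) - ∫ ω, T ω ∂P) ^ 2 ≤
      variance T P * ((∫ ω, ρ ω ^ 2 ∂P) - 1) := by
  have hρL : MemLp ρ 2 P := (memLp_two_iff_integrable_sq hρm.aestronglyMeasurable).2 hρ
  have hρI : Integrable ρ P := hρL.integrable one_le_two
  have hTI : Integrable T P := hT.integrable one_le_two
  have hTρ : Integrable (fun ω => ρ ω * T ω) P := hρL.integrable_mul hT
  have h1 : ∫ ω, ρ ω ∂P = 1 := by
    have h := hQ.measure_univ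
    rw [withDensity_apply _ MeasurableSet.univ, Measure.restrict_univ] at h
    rw [integral_eq_lintegral_of_nonneg_ae (ae_of_all _ hρ0) hρm.aestronglyMeasurable, h]
    simp
  have h2 : ∫ ω, T ω ∂(P.withDensity fun ω => ENNReal.ofReal (ρ ω)) = ∫ ω, ρ ω * T ω ∂P := by
    rw [integral_withDensity_eq_integral_toReal_smul hρm.ennreal_ofReal
      (ae_of_all _ fun ω => ENNReal.ofReal_lt_top)]
    simp only [ENNReal.toReal_ofReal (hρ0 _), smul_eq_mul]
  set M := ∫ ω, T ω ∂P with hM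
  have h := sq_integral_mul_le (hT.sub (memLp_const M)) (hρL.sub (memLp_const 1))
  have e1 : ∫ ω, (T ω - M) * (ρ ω - 1) ∂P = (∫ ω, ρ ω * T ω ∂P) - M := by
    have : ∀ ω, (T ω - M) * (ρ ω - 1) =
        (ρ ω * T ω - T ω) - (M * ρ ω - M) := fun ω => by ring
    have i1 : Integrable (fun ω => ρ ω * T ω - T ω) P := hTρ.sub hTI
    have i2 : Integrable (fun ω => M * ρ ω - M) P := (hρI.const_mul M).sub (integrable_const M)
    simp only [this]
    rw [integral_sub i1 i2, integral_sub hTρ hTI,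
      integral_sub (hρI.const_mul M) (integrable_const M),
      integral_const_mul, h1]
    simp [hM]
  have e2 : ∫ ω, (ρ ω - 1) ^ 2 ∂P = (∫ ω, ρ ω ^ 2 ∂P) - 1 := by
    have : ∀ ω, (ρ ω - 1) ^ 2 = ρ ω ^ 2 - (2 * ρ ω - 1) := fun ω => by ring
    have i1 : Integrable (fun ω => 2 * ρ ω - 1) P := (hρI.const_mul 2).sub (integrable_const 1)
    simp only [this]
    rw [integral_sub hρ i1,
      integral_sub (hρI.const_mul 2) (integrable_const 1), integral_const_mul, h1]
    simp; norm_num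
  simp only [Pi.sub_apply] at h
  rw [e1, e2] at h
  rw [h2, variance_eq_integral hT.aestronglyMeasurable.aemeasurable]
  exact h

/-! ### Perturbing the precision matrix along the least favourable direction -/

theorem direction_apply_self {p : ℕ} {Θ : Matrix (Fin p) (Fin p) ℝ} (hΘ : Θ.PosDef)
    (i j : Fin p) : direction Θ i j i j = √(sigmaSq Θ i j) := by
  have hσ := sigmaSq_pos hΘ i j
  have : direction Θ i j i j = (√(sigmaSq Θ i j))⁻¹ * sigmaSq Θ i j := by
    simp only [direction, Matrix.smul_apply, Matrix.add_apply, vecMulVec_apply,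
      col_apply, sigmaSq, smul_eq_mul]
    rw [posDef_symm hΘ j i]; ring
  rw [this]
  have h := Real.sqrt_pos.2 hσ
  field_simp
  exact (Real.sq_sqrt hσ.le).symm

theorem quadratic_direction {p : ℕ} (Θ : Matrix (Fin p) (Fin p) ℝ) (i j : Fin p)
    (x : Fin p → ℝ) : x ⬝ᵥ direction Θ i j *ᵥ x =
      (√(sigmaSq Θ i j))⁻¹ * (2 * ((Θ.col i ⬝ᵥ x) * (Θ.col j ⬝ᵥ x))) := by
  simp only [direction, smul_mulVec, add_mulVec, vecMulVec_mulVec, dotProduct_smul, dotProduct_add,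
    smul_eq_mul, op_smul_eq_smul]
  rw [dotProduct_comm x, dotProduct_comm x]
  ring

/-- Cauchy–Schwarz in the inner product of `Θ`. -/
theorem sq_col_dotProduct_le {p : ℕ} {Θ : Matrix (Fin p) (Fin p) ℝ} (hΘ : Θ.PosDef)
    (k : Fin p) (x : Fin p → ℝ) : (Θ.col k ⬝ᵥ x) ^ 2 ≤ Θ k k * (x ⬝ᵥ Θ *ᵥ x) := by
  have hs : Θᵀ = Θ := by
    ext a b; exact posDef_symm hΘ b a
  have hd := hΘ.diag_pos (i := k)
  have e : Pi.single k 1 ⬝ᵥ Θ *ᵥ x = Θ.col k ⬝ᵥ x := by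
    rw [single_one_dotProduct, mulVec]
    congr 1; ext l; exact posDef_symm hΘ k l
  have e2 : Pi.single k 1 ⬝ᵥ Θ *ᵥ Pi.single k 1 = Θ k k := by simp
  set s := -(Θ.col k ⬝ᵥ x) / Θ k k with hsd
  have h := hΘ.posSemidef.dotProduct_mulVec_nonneg (x + s • Pi.single k 1)
  rw [star_trivial, quadratic_add hs, mulVec_smul, smul_dotProduct, smul_dotProduct,
    dotProduct_smul, e, e2] at h
  simp only [smul_eq_mul] at h
  have h3 : 2 * (s * (Θ.col k ⬝ᵥ x)) + s * (s * Θ k k) = -((Θ.col k ⬝ᵥ x) ^ 2 / Θ k k) := by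
    rw [hsd]; field_simp; ring
  have h4 : (Θ.col k ⬝ᵥ x) ^ 2 / Θ k k ≤ x ⬝ᵥ Θ *ᵥ x := by linarith
  rw [div_le_iff₀ hd] at h4; linarith

/-- `|xᵀ H x| ≤ 2 xᵀ Θ x`, so that perturbations of size less than `1/2` keep positivity. -/
theorem posDef_add_smul_direction {p : ℕ} {Θ : Matrix (Fin p) (Fin p) ℝ} (hΘ : Θ.PosDef)
    (i j : Fin p) {t : ℝ} (ht0 : 0 ≤ t) (ht : t < 1 / 2) :
    (Θ + t • direction Θ i j).PosDef := by
  refine PosDef.of_dotProduct_mulVec_pos ?_ fun x hx => ?_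
  · ext a b
    simp only [conjTranspose_apply, Matrix.add_apply, Matrix.smul_apply, direction, vecMulVec_apply,
      col_apply,
      star_trivial, posDef_symm hΘ b a]
    simp only [smul_eq_mul]; ring
  have hq := hΘ.dotProduct_mulVec_pos hx
  rw [star_trivial] at hq ⊢
  have hσ := Real.sqrt_pos.2 (sigmaSq_pos hΘ i j)
  set q := x ⬝ᵥ Θ *ᵥ x with hqd
  have h1 := sq_col_dotProduct_le hΘ i x
  have h2 := sq_col_dotProduct_le hΘ j x
  have h3 : ((Θ.col i ⬝ᵥ x) * (Θ.col j ⬝ᵥ x)) ^ 2 ≤ (√(sigmaSq Θ i j) * q) ^ 2 := by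
    rw [mul_pow, mul_pow, Real.sq_sqrt (sigmaSq_pos hΘ i j).le]
    refine (mul_le_mul h1 h2 (sq_nonneg _)
      (mul_nonneg (hΘ.diag_pos).le hq.le)).trans ?_
    have : Θ i i * q * (Θ j j * q) = (Θ i i * Θ j j) * q ^ 2 := by ring
    rw [this]
    refine mul_le_mul_of_nonneg_right ?_ (sq_nonneg q)
    rw [sigmaSq]; linarith [sq_nonneg (Θ i j)]
  have h4 := abs_le_of_sq_le_sq h3 (by positivity)
  have h5 : (√(sigmaSq Θ i j))⁻¹ * (2 * ((Θ.col i ⬝ᵥ x) * (Θ.col j ⬝ᵥ x))) ≥ -(2 * q) := by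
    rw [ge_iff_le, inv_mul_eq_div, le_div_iff₀ hσ]
    linarith [(abs_le.1 h4).1]
  rw [add_mulVec, dotProduct_add, smul_mulVec, dotProduct_smul, quadratic_direction, smul_eq_mul]
  have h6 := mul_le_mul_of_nonneg_left h5 ht0
  have h7 := mul_lt_mul_of_pos_right ht hq
  linarith

/-- The perturbation has rank two, so its effect on the determinant is a `2 × 2` determinant. -/
theorem det_add_smul_direction {p : ℕ} {Θ : Matrix (Fin p) (Fin p) ℝ} (hΘ : Θ.PosDef)
    (i j : Fin p) (t : ℝ) :
    (Θ + t • direction Θ i j).det = Θ.det *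
      (1 + 2 * t * (Θ i j / √(sigmaSq Θ i j)) +
        t ^ 2 * (2 * (Θ i j / √(sigmaSq Θ i j)) ^ 2 - 1)) := by
  set σ := √(sigmaSq Θ i j) with hσd
  have hσ : 0 < σ := Real.sqrt_pos.2 (sigmaSq_pos hΘ i j)
  have hσ2 : σ ^ 2 = Θ i i * Θ j j + Θ i j ^ 2 := Real.sq_sqrt (sigmaSq_pos hΘ i j).le
  set U : Matrix (Fin p) (Fin 2) ℝ := Matrix.of fun k a => if k = ![i, j] a then 1 else 0 with hU
  set V : Matrix (Fin 2) (Fin p) ℝ := Matrix.of fun a l => t * σ⁻¹ * Θ l (![j, i] a) with hV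
  have hΘU : ∀ k a, (Θ * U) k a = Θ k (![i, j] a) := fun k a => by simp [mul_apply, hU]
  have hVU : ∀ a b, (V * U) a b = t * σ⁻¹ * Θ (![i, j] b) (![j, i] a) := fun a b => by
    rw [mul_apply]; simp [hU, hV]
  have h1 : Θ + t • direction Θ i j = Θ * (1 + U * V) := by
    rw [mul_add, mul_one, ← Matrix.mul_assoc]
    congr 1
    ext k l
    rw [mul_apply, Fin.sum_univ_two, hΘU, hΘU]
    simp only [hV, direction, ← hσd, Matrix.smul_apply, Matrix.add_apply, vecMulVec_apply,
      col_apply, smul_eq_mul, of_apply, cons_val_zero, cons_val_one]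
    ring
  have h2 : (V * U).det = (t * σ⁻¹) ^ 2 * (Θ i j ^ 2 - Θ i i * Θ j j) := by
    simp only [det_fin_two, hVU, cons_val_zero, cons_val_one]
    rw [posDef_symm hΘ j i]; ring
  have h3 : (1 + V * U).det = 1 + 2 * (t * σ⁻¹ * Θ i j) + (V * U).det := by
    simp only [det_fin_two, Matrix.add_apply, hVU, cons_val_zero, cons_val_one,
      one_apply_eq, one_apply_ne (zero_ne_one : (0 : Fin 2) ≠ 1),
      one_apply_ne (one_ne_zero : (1 : Fin 2) ≠ 0)]
    rw [posDef_symm hΘ j i]; ring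
  rw [h1, det_mul, det_one_add_mul_comm, h3, h2]
  congr 1
  have : Θ i i * Θ j j = σ ^ 2 - Θ i j ^ 2 := by linarith
  rw [this]; field_simp; ring

theorem abs_div_sqrt_sigmaSq_le {p : ℕ} {Θ : Matrix (Fin p) (Fin p) ℝ} (hΘ : Θ.PosDef)
    (i j : Fin p) : |Θ i j / √(sigmaSq Θ i j)| ≤ 1 := by
  rw [abs_div, abs_of_nonneg (Real.sqrt_nonneg _)]
  refine div_le_one_of_le₀ (Real.abs_le_sqrt ?_) (Real.sqrt_nonneg _)
  have := mul_pos (hΘ.diag_pos (i := i)) (hΘ.diag_pos (i := j))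
  rw [sigmaSq]; linarith

/-- With `D(t) = 1 + 2 t r + t² (2 r² - 1)`, the ratio `D(t) / √D(2 t)` is `1 + t² + O(t³)`, because
`D(t)² - D(2 t) = 2 t² + O(t³)`: the dependence on `r` cancels to leading order. -/
theorem chiSq_base_le {r t : ℝ} (hr : |r| ≤ 1) (ht0 : 0 ≤ t) (ht : t ≤ 1 / 16) :
    0 ≤ (1 + 2 * t * r + t ^ 2 * (2 * r ^ 2 - 1)) /
      √(1 + 2 * (2 * t) * r + (2 * t) ^ 2 * (2 * r ^ 2 - 1)) ∧
    (1 + 2 * t * r + t ^ 2 * (2 * r ^ 2 - 1)) /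
      √(1 + 2 * (2 * t) * r + (2 * t) ^ 2 * (2 * r ^ 2 - 1)) ≤
      Real.exp (t ^ 2 * (1 + 16 * t)) := by
  obtain ⟨hr1, hr2⟩ := abs_le.1 hr
  have hrr : r ^ 2 ≤ 1 := by rw [← sq_abs]; exact pow_le_one₀ (abs_nonneg r) hr
  set u := 2 * r ^ 2 - 1 with hu
  have hu1 : -1 ≤ u := by rw [hu]; linarith [sq_nonneg r]
  have hu2 : u ≤ 1 := by rw [hu]; linarith
  have ht2 : 0 ≤ t ^ 2 := sq_nonneg t
  have htr : -t ≤ t * r := by nlinarith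
  have htu : -t ^ 2 ≤ t ^ 2 * u := by nlinarith
  have ht3 : t ^ 2 ≤ t / 16 := by nlinarith
  have hD2 : 1 - 4 * t - 4 * t ^ 2 ≤ 1 + 2 * (2 * t) * r + (2 * t) ^ 2 * u := by
    have : 1 + 2 * (2 * t) * r + (2 * t) ^ 2 * u = 1 + 4 * (t * r) + 4 * (t ^ 2 * u) := by ring
    rw [this]; linarith
  set D2 := 1 + 2 * (2 * t) * r + (2 * t) ^ 2 * u with hD2d
  have hD2p : 0 < D2 := by linarith
  have hDp : 0 ≤ 1 + 2 * t * r + t ^ 2 * u := by linarith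
  refine ⟨by positivity, ?_⟩
  rw [div_le_iff₀ (Real.sqrt_pos.2 hD2p)]
  refine (sq_le_sq₀ hDp (by positivity)).1 ?_
  rw [mul_pow, Real.sq_sqrt hD2p.le, ← Real.exp_nat_mul]
  have e1 : (1 + 2 * t * r + t ^ 2 * u) ^ 2 =
      D2 + t ^ 2 * (2 + 4 * (t * (r * u)) + t ^ 2 * u ^ 2) := by
    have : r ^ 2 = (u + 1) / 2 := by rw [hu]; ring
    have h2 : (1 + 2 * t * r + t ^ 2 * u) ^ 2 = 1 + 4 * t * r + 4 * t ^ 2 * r ^ 2 +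
      2 * t ^ 2 * u + 4 * t ^ 3 * (r * u) + t ^ 4 * u ^ 2 := by ring
    rw [h2, this, hD2d]; ring
  have hru : r * u ≤ 1 := by
    refine (le_abs_self _).trans ?_
    rw [abs_mul]
    exact mul_le_one₀ hr (abs_nonneg u) (abs_le.2 ⟨hu1, hu2⟩)
  have huu : u ^ 2 ≤ 1 := by
    rw [← sq_abs]; exact pow_le_one₀ (abs_nonneg u) (abs_le.2 ⟨hu1, hu2⟩)
  have h1 : t * (r * u) ≤ t := by nlinarith
  have h2 : t ^ 2 * u ^ 2 ≤ t ^ 2 := by nlinarith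
  have h3 : 2 + 4 * (t * (r * u)) + t ^ 2 * u ^ 2 ≤ 2 * (1 + 16 * t) * D2 := by
    have h4 : 2 * (1 + 16 * t) * (1 - 4 * t - 4 * t ^ 2) ≤ 2 * (1 + 16 * t) * D2 :=
      mul_le_mul_of_nonneg_left hD2 (by positivity)
    have h5 : t ^ 3 ≤ t / 256 := by nlinarith
    nlinarith
  have h6 := mul_le_mul_of_nonneg_left h3 ht2
  have h7 := mul_le_mul_of_nonneg_right
    (Real.add_one_le_exp (((2 : ℕ) : ℝ) * (t ^ 2 * (1 + 16 * t)))) hD2p.le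
  push_cast at h7 ⊢
  rw [e1]
  linarith

/-- Hammersley–Chapman–Robbins along the least favourable direction. -/
theorem sq_mean_change_le {p n : ℕ} {Θ : Matrix (Fin p) (Fin p) ℝ} (hΘ : Θ.PosDef)
    (i j : Fin p) {t : ℝ} (ht0 : 0 ≤ t) (ht : t ≤ 1 / 16) {T : Data n p → ℝ}
    (hT : MemLp T 2 (dataLaw n Θ)) :
    ((∫ X, T X ∂(dataLaw n (Θ + t • direction Θ i j))) - ∫ X, T X ∂(dataLaw n Θ)) ^ 2 ≤
      variance T (dataLaw n Θ) * (Real.exp (n * t ^ 2 * (1 + 16 * t)) - 1) := by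
  have h₁ := posDef_add_smul_direction hΘ i j ht0 (by linarith)
  have e2 : 2 • (Θ + t • direction Θ i j) - Θ = Θ + (2 * t) • direction Θ i j := by
    rw [two_nsmul, mul_smul, two_smul]; abel
  have h₂ : (2 • (Θ + t • direction Θ i j) - Θ).PosDef := by
    rw [e2]; exact posDef_add_smul_direction hΘ i j (by linarith) (by linarith)
  obtain ⟨hI, hE⟩ := dataRatio_second_moment n hΘ h₁ h₂
  have hQ := dataLaw_eq_withDensity n hΘ h₁
  have hm : Measurable fun X : Data n p =>
      ∏ r, gaussRatio Θ (Θ + t • direction Θ i j) (X r) :=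
    Finset.measurable_prod _ fun r _ =>
      (measurable_gaussRatio _ _).comp (measurable_pi_apply r)
  have h := sq_integral_sub_le hm (fun X => Finset.prod_nonneg fun r _ => gaussRatio_nonneg _ _ _)
    (hQ ▸ inferInstance) hI hT
  rw [← hQ, hE, e2, det_add_smul_direction hΘ, det_add_smul_direction hΘ,
    mul_div_cancel_left₀ _ hΘ.det_pos.ne', mul_div_cancel_left₀ _ hΘ.det_pos.ne'] at h
  refine h.trans (mul_le_mul_of_nonneg_left ?_ (variance_nonneg _ _))
  obtain ⟨b0, b1⟩ := chiSq_base_le (abs_div_sqrt_sigmaSq_le hΘ i j) ht0 ht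
  have := pow_le_pow_left₀ b0 b1 n
  rw [← Real.exp_nat_mul, ← mul_assoc (n : ℝ)] at this
  linarith

/-! ### The asymptotic variance bound -/

/-- If the mean changes by `t (s + o(1))` under a perturbation of size `t` with `n t² → 0`, then
the variance is at least `(s² + o(1)) / n`. -/
theorem exists_variance_lower_bound {t s e V : ℕ → ℝ} {B : ℝ} (ht0 : ∀ᶠ n in atTop, 0 < t n)
    (ht : Tendsto t atTop (𝓝 0)) (hnt : Tendsto (fun n : ℕ => n * t n ^ 2) atTop (𝓝 0))
    (hs : ∀ n, |s n| ≤ B) (he : Tendsto e atTop (𝓝 0)) (hV : ∀ n, 0 ≤ V n)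
    (h : ∀ᶠ n : ℕ in atTop, (t n * (s n + e n)) ^ 2 ≤
      V n * (Real.exp (n * t n ^ 2 * (1 + 16 * t n)) - 1)) :
    ∃ r : ℕ → ℝ, Tendsto r atTop (𝓝 0) ∧ ∀ᶠ n : ℕ in atTop, (s n ^ 2 + r n) / n ≤ V n := by
  set y : ℕ → ℝ := fun n => n * t n ^ 2 * (1 + 16 * t n) with hy
  have h16 : Tendsto (fun n => 1 + 16 * t n) atTop (𝓝 1) := by
    have := (ht.const_mul 16).const_add 1
    rwa [mul_zero, add_zero] at this
  have hyt : Tendsto y atTop (𝓝 0) := by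
    have := hnt.mul h16
    rwa [zero_mul] at this
  set A : ℕ → ℝ := fun n => (1 + 16 * t n) * (1 + y n) with hA
  have hAt : Tendsto A atTop (𝓝 1) := by
    have := h16.mul (hyt.const_add 1)
    rwa [add_zero, mul_one] at this
  set r : ℕ → ℝ := fun n => (s n + e n) ^ 2 / A n - s n ^ 2 with hr
  have hbdd : ∀ {u : ℕ → ℝ}, (∀ n, |u n| ≤ B ^ 2 + 2 * |B|) → ∀ {v : ℕ → ℝ},
      Tendsto v atTop (𝓝 0) → Tendsto (fun n => u n * v n) atTop (𝓝 0) := by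
    intro u hu v hv
    have hv' := (hv.abs).const_mul (B ^ 2 + 2 * |B|)
    rw [abs_zero, mul_zero] at hv'
    refine squeeze_zero_norm (fun n => ?_) hv'
    rw [Real.norm_eq_abs, abs_mul]
    exact mul_le_mul_of_nonneg_right (hu n) (abs_nonneg _)
  have hrt : Tendsto r atTop (𝓝 0) := by
    have hs2 : ∀ n, |2 * s n| ≤ B ^ 2 + 2 * |B| := fun n => by
      rw [abs_mul, abs_two]
      have := (hs n).trans (le_abs_self B)
      linarith [sq_nonneg B]
    have hs3 : ∀ n, |s n ^ 2| ≤ B ^ 2 + 2 * |B| := fun n => by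
      rw [abs_pow]
      have := pow_le_pow_left₀ (abs_nonneg _) (hs n) 2
      linarith [abs_nonneg B]
    have hA1 : Tendsto (fun n => 1 - A n) atTop (𝓝 0) := by
      have := hAt.const_sub 1
      rwa [sub_self] at this
    have hnum := ((hbdd hs2 he).add (he.pow 2)).add (hbdd hs3 hA1)
    have hfin := hnum.div hAt one_ne_zero
    rw [zero_pow two_ne_zero, add_zero, add_zero, zero_div] at hfin
    refine hfin.congr' ?_
    filter_upwards [hAt.eventually_ne one_ne_zero] with n hn
    simp only [hr, Pi.div_apply]
    field_simp
    ring
  refine ⟨r, hrt, ?_⟩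
  filter_upwards [h, ht0, hyt.eventually_lt_const one_pos, eventually_gt_atTop 0] with n h1 h2 h3 hn
  have hn' : (0 : ℝ) < n := Nat.cast_pos.2 hn
  have hy0 : 0 ≤ y n := by simp only [hy]; positivity
  have hA0 : 0 < A n := by simp only [hA]; positivity
  have hexp : Real.exp (y n) - 1 ≤ y n * (1 + y n) := by
    have := (abs_le.1 (Real.abs_exp_sub_one_sub_id_le (x := y n) (by
      rw [abs_of_nonneg hy0]; exact h3.le))).2
    linarith
  have h4 : (t n * (s n + e n)) ^ 2 ≤ t n ^ 2 * (V n * n * A n) := by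
    refine (h1.trans (mul_le_mul_of_nonneg_left hexp (hV n))).trans_eq ?_
    simp only [hA, hy]; ring
  rw [mul_pow] at h4
  have h5 := le_of_mul_le_mul_left h4 (by positivity)
  have h6 : (s n + e n) ^ 2 / A n ≤ V n * n := by rwa [div_le_iff₀ hA0]
  rw [div_le_iff₀ hn']
  simp only [hr]
  linarith

/-- An estimator that is unbiased, up to `o(1/√m)`, at `Θ₀` and at its perturbation of size
`1/√m` along the least favourable direction has variance at least `(σ² + o(1)) / n`. -/
theorem variance_lower_bound_of_isStronglyAsympUnbiased {C₁ C₂ C₃ : ℝ} {p : ℕ → ℕ}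
    {i j : ∀ n, Fin (p n)} {d : ∀ n, Fin (p n) → ℝ}
    {S : ∀ n, Set (Matrix (Fin (p n)) (Fin (p n)) ℝ)}
    {Θ₀ : ∀ n, Matrix (Fin (p n)) (Fin (p n)) ℝ} {c : ℝ} (hc : 0 < c)
    (hΘ₀ : ∀ n, Θ₀ n ∈ precisionClass (S n) C₁ C₂ C₃ (d n))
    {T : ∀ n, Data n (p n) → ℝ} {m : ℕ → ℝ}
    (hT : IsStronglyAsympUnbiased (fun n => precisionClass (S n) C₁ C₂ C₃ (d n))
      (fun n Θ => Θ (i n) (j n)) Θ₀ c m T)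
    (hH : ∀ᶠ n in atTop, Θ₀ n + (1 / √(m n)) • direction (Θ₀ n) (i n) (j n) ∈
      nbhd (precisionClass (S n) C₁ C₂ C₃ (d n)) (Θ₀ n) (c / √(m n))) :
    ∃ r : ℕ → ℝ, Tendsto r atTop (𝓝 0) ∧ ∀ᶠ n : ℕ in atTop,
      (sigmaSq (Θ₀ n) (i n) (j n) + r n) / n ≤ variance (T n) (dataLaw n (Θ₀ n)) := by
  have hpd : ∀ n, (Θ₀ n).PosDef := fun n => (hΘ₀ n).2.2.1
  set t : ℕ → ℝ := fun n => 1 / √(m n) with ht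
  set Θ₁ : ∀ n, Matrix (Fin (p n)) (Fin (p n)) ℝ :=
    fun n => Θ₀ n + t n • direction (Θ₀ n) (i n) (j n) with hΘ₁
  set σ : ℕ → ℝ := fun n => √(sigmaSq (Θ₀ n) (i n) (j n)) with hσ
  have ht0 : ∀ᶠ n in atTop, 0 < t n := hT.rate_pos.mono fun n h => by
    simp only [ht]; have := Real.sqrt_pos.2 h; positivity
  have ht2 : ∀ᶠ n in atTop, t n ^ 2 = 1 / m n := hT.rate_pos.mono fun n h => by
    simp only [ht]; rw [div_pow, Real.sq_sqrt h.le, one_pow]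
  have hnt : Tendsto (fun n : ℕ => n * t n ^ 2) atTop (𝓝 0) := by
    refine hT.rate.tendsto_div_nhds_zero.congr' ?_
    filter_upwards [ht2] with n h
    rw [h]; ring
  have htt : Tendsto t atTop (𝓝 0) := by
    have h2 : Tendsto (fun n => t n ^ 2) atTop (𝓝 0) := by
      refine squeeze_zero' (Eventually.of_forall fun n => sq_nonneg _) ?_ hnt
      filter_upwards [eventually_ge_atTop 1] with n hn
      exact le_mul_of_one_le_left (sq_nonneg _) (by exact_mod_cast hn)
    have h3 := h2.sqrt
    rw [Real.sqrt_zero] at h3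
    refine h3.congr' (ht0.mono fun n h => Real.sqrt_sq h.le)
  obtain ⟨-, hu0⟩ := hT.unbiased Θ₀ (hT.rate_pos.mono fun n h => ⟨hΘ₀ n, by
    have : frob (Θ₀ n - Θ₀ n) = 0 := by simp [frob]
    rw [this]; positivity⟩)
  obtain ⟨-, hu1⟩ := hT.unbiased Θ₁ hH
  have he := hu1.sub hu0
  rw [sub_zero] at he
  have hsq : ∀ n, sigmaSq (Θ₀ n) (i n) (j n) = σ n ^ 2 := fun n =>
    (Real.sq_sqrt (sigmaSq_pos (hpd n) _ _).le).symm
  simp only [hsq]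
  refine exists_variance_lower_bound (t := t) (B := √(2 * C₃ ^ 2)) ht0 htt hnt (fun n => ?_) he
    (fun n => variance_nonneg _ _) ?_
  · simp only [hσ]
    rw [abs_of_nonneg (Real.sqrt_nonneg _)]
    exact Real.sqrt_le_sqrt (sigmaSq_le (isRegular_of_mem (hΘ₀ n)) _ _)
  filter_upwards [hT.rate_pos, ht0, htt.eventually_le_const (u := 1 / 16) (by norm_num),
    hT.memLp] with n hm h0 h1 hTL
  have h := sq_mean_change_le (hpd n) (i n) (j n) h0.le h1 hTL
  refine Eq.trans_le ?_ h
  have hm' := Real.sqrt_pos.2 hm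
  have hg : Θ₁ n (i n) (j n) = Θ₀ n (i n) (j n) + t n * σ n := by
    simp only [hΘ₁, Matrix.add_apply, Matrix.smul_apply, smul_eq_mul,
      direction_apply_self (hpd n), hσ]
  congr 1
  rw [hg]
  simp only [ht, hΘ₁]
  field_simp
  ring

end GGM

theorem theorem8p2 (C₁ C₂ C₃ : ℝ) (hC₁ : 0 < C₁) (hC₂ : 0 < C₂) (hC₃ : 0 < C₃) :
    ∃ c₀ : ℝ, 0 < c₀ ∧
      ∀ (p : ℕ → ℕ) (i j : ∀ n, Fin (p n)) (d : ∀ n, Fin (p n) → ℝ)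
        (S : ∀ n, Set (Matrix (Fin (p n)) (Fin (p n)) ℝ))
        (Θ₀ : ∀ n, Matrix (Fin (p n)) (Fin (p n)) ℝ) (c : ℝ), 0 < c →
        (∀ n, Θ₀ n ∈ GGM.precisionClass (S n) C₁ C₂ C₃ (d n)) →
        ((fun n => max (d n (i n)) (d n (j n)) * Real.log (p n)) =o[atTop]
          fun n : ℕ => √(n : ℝ)) →
        -- the de-sparsified nodewise Lasso
        (∀ (lam : ∀ n, Fin (p n) → ℝ) (c₁ : ℝ)
          (γ : ∀ n, GGM.Data n (p n) → ∀ k : Fin (p n), {l : Fin (p n) // l ≠ k} → ℝ),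
          (∀ᶠ n : ℕ in atTop, ∀ k, k = i n ∨ k = j n →
            c₀ * √(Real.log (p n) / n) ≤ lam n k ∧ lam n k ≤ c₁ * √(Real.log (p n) / n)) →
          (∀ᶠ n : ℕ in atTop, ∀ k, k = i n ∨ k = j n →
            Measurable (fun X => γ n X k) ∧
              ∀ X, GGM.IsNodewiseLasso X k (lam n k) (γ n X k)) →
          (∃ m : ℕ → ℝ, GGM.IsStronglyAsympUnbiased
            (fun n => GGM.precisionClass (S n) C₁ C₂ C₃ (d n)) (fun n Θ => Θ (i n) (j n)) Θ₀ c m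
            (fun n X => GGM.desparsified X (lam n) (γ n X) (i n) (j n))) ∧
          ∃ r : ℕ → ℝ, Tendsto r atTop (𝓝 0) ∧ ∀ᶠ n : ℕ in atTop,
            variance (fun X => GGM.desparsified X (lam n) (γ n X) (i n) (j n))
              (GGM.dataLaw n (Θ₀ n)) = (GGM.sigmaSq (Θ₀ n) (i n) (j n) + r n) / n) ∧
        -- any strongly asymptotically unbiased estimator
        (∀ (T : ∀ n, GGM.Data n (p n) → ℝ) (m : ℕ → ℝ),
          GGM.IsStronglyAsympUnbiased
            (fun n => GGM.precisionClass (S n) C₁ C₂ C₃ (d n)) (fun n Θ => Θ (i n) (j n))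
            Θ₀ c m T →
          (∀ᶠ n in atTop, Θ₀ n + (1 / √(m n)) • GGM.direction (Θ₀ n) (i n) (j n) ∈
            GGM.nbhd (GGM.precisionClass (S n) C₁ C₂ C₃ (d n)) (Θ₀ n) (c / √(m n))) →
          ∃ r : ℕ → ℝ, Tendsto r atTop (𝓝 0) ∧ ∀ᶠ n : ℕ in atTop,
            (GGM.sigmaSq (Θ₀ n) (i n) (j n) + r n) / n ≤
              variance (T n) (GGM.dataLaw n (Θ₀ n))) := by
  obtain ⟨c₀, hc₀, H⟩ := GGM.desparsified_isStronglyAsympUnbiased hC₁ hC₂ hC₃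
  refine ⟨c₀, hc₀, fun p i j d S Θ₀ c hc hΘ₀ hlog =>
    ⟨H p i j d S Θ₀ c hΘ₀ hlog, fun T m hT hH => ?_⟩⟩
  exact GGM.variance_lower_bound_of_isStronglyAsympUnbiased hc hΘ₀ hT hH
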